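/- **Proposition (Fourier–Motzkin elimination).** Let $\mathsf k$ be an ordered field. *Circuits.* Consider the generators copier $\mathsf c\colon 1\to 2$, discharger $\mathsf d\colon 1\to 0$, amplifier $\langle k\rangle\colon 1\to 1$ ($k\in\mathsf k$), adder $\mathsf a\colon 2\to 1$, zero $\mathsf z\colon 0\to 1$, their mirror images $\mathsf c^{o}\colon 2\to1$, $\mathsf d^{o}\colon 0\to1$, $\langle k\rangle^{o}\colon 1\to1$, $\mathsf a^{o}\colon 1\to2$, $\mathsf z^{o}\colon 1\to 0$, and one further generator $\mathsf g\colon 1\to 1$ (written $\geq$). A *circuit* $n\to m$ is an arrow of the prop freely generated by all these generators, i.e. a term built from generators, identities $\mathrm{id}_n$ and symmetries $\sigma_{n,m}$ with sequential composition $;$ and monoidal product $\oplus$, modulo the laws of symmetric strict monoidal categories. A *matrix circuit* is an arrow of the prop freely generated by $\mathsf c,\mathsf d,\langle k\rangle,\mathsf a,\mathsf z$ only, regarded as a circuit. Write $\iota=\mathrm{id}_1$, $\sigma=\sigma_{1,1}$. *The theory $\mathbb{IHP}_{\mathsf k}$.* Let $\subseteq$ be the smallest preorder on circuits of equal type that is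 compatible with $;$ and $\oplus$ and contains the axioms below (an equation counts as two inequalities); circuits $c,d$ are *IHP-equal* if $c\subseteq d$ and $d\subseteq c$. The axioms are, with $k,l\in\mathsf k$: (i) the following, together with their mirror images (left and right exchanged): * $(\mathsf a\oplus\iota);\mathsf a=(\iota\oplus\mathsf a);\mathsf a$, $\ \sigma;\mathsf a=\mathsf a$, $\ (\mathsf z\oplus\iota);\mathsf a=\iota$, $\ \mathsf c;(\mathsf c\oplus\iota)=\mathsf c;(\iota\oplus\mathsf c)$, $\ \mathsf c;\sigma=\mathsf c$, $\ \mathsf c;(\mathsf d\oplus\iota)=\iota$; * $\mathsf a;\mathsf c=(\mathsf c\oplus\mathsf c);(\iota\oplus\sigma\oplus\iota);(\mathsf a\oplus\mathsf a)$, $\ \mathsf z;\mathsf c=\mathsf z\oplus\mathsf z$, $\ \mathsf a;\mathsf d=\mathsf d\oplus\mathsf d$, $\ \mathsf z;\mathsf d=\mathrm{id}_0$; * $\mathsf a;\langle k\rangle=(\langle k\rangle\oplus\langle k\rangle);\mathsf a$, $\ \mathsf z;\langle k\rangle=\mathsf z$, $\ \langle k\rangle;\mathsf c=\mathsf c;(\langle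 k\rangle\oplus\langle k\rangle)$, $\ \langle k\rangle;\mathsf d=\mathsf d$, $\ \langle k\rangle;\langle l\rangle=\langle kl\rangle$, $\ \mathsf c;(\langle k\rangle\oplus\langle l\rangle);\mathsf a=\langle k+l\rangle$, $\ \langle 0\rangle=\mathsf d;\mathsf z$; * $\langle k\rangle;\langle k\rangle^{o}=\iota=\langle k\rangle^{o};\langle k\rangle$ for $k\neq0$; * $(\mathsf c\oplus\iota);(\iota\oplus\mathsf c^{o})=\mathsf c^{o};\mathsf c=(\iota\oplus\mathsf c);(\mathsf c^{o}\oplus\iota)$, $\ \mathsf c;\mathsf c^{o}=\iota$, $\ \mathsf d^{o};\mathsf d=\mathrm{id}_0$; * $(\mathsf a^{o}\oplus\iota);(\iota\oplus\mathsf a)=\mathsf a;\mathsf a^{o}=(\iota\oplus\mathsf a^{o});(\mathsf a\oplus\iota)$, $\ \mathsf a^{o};\mathsf a=\iota$, $\ \mathsf z;\mathsf z^{o}=\mathrm{id}_0$; * $(\langle -1\rangle\oplus\iota);\mathsf a;\mathsf z^{o}=\mathsf c^{o};\mathsf d$, $\ \mathsf z;\mathsf a^{o};(\langle -1\rangle\oplus\iota)=\mathsf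 d^{o};\mathsf c$, $\ \mathsf z^{o}\subseteq\mathsf d$. (ii) with $\mathsf g^{o}=((\mathsf d^{o};\mathsf c)\oplus\iota);(\iota\oplus\mathsf g\oplus\iota);(\iota\oplus(\mathsf c^{o};\mathsf d))$: * $\mathsf g;\mathsf c\subseteq\mathsf c;(\mathsf g\oplus\mathsf g)$, $\ \mathsf a;\mathsf g=(\mathsf g\oplus\mathsf g);\mathsf a$, $\ \mathsf g;\mathsf d=\mathsf d$, $\ \mathsf z^{o}\subseteq\mathsf g;\mathsf z^{o}$; * $\langle k\rangle;\mathsf g=\mathsf g;\langle k\rangle$ for $k>0$, $\ \langle k\rangle;\mathsf g=\mathsf g^{o};\langle k\rangle$ for $k<0$; * $\mathsf c;(\mathsf g\oplus\mathsf g^{o});\mathsf c^{o}\subseteq\iota$, $\ \mathsf g^{o};\mathsf g=\mathsf d;\mathsf d^{o}$; * $(\mathsf g\oplus\mathsf g);\mathsf c^{o};\mathsf c;(\mathsf g\oplus\mathsf g)=(\mathsf c\oplus\mathsf c);(\mathsf g\oplus\mathsf g\oplus\mathsf g\oplus\mathsf g);(\iota\oplus\sigma\oplus\iota);(\mathsf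 c^{o}\oplus\mathsf c^{o})$. *Claim.* For every $n\ge1$, every $m\ge 0$ and every matrix circuit $A\colon n\to m$ there are $l\ge0$ and a matrix circuit $B\colon n-1\to l$ such that $$(\mathsf d^{o}\oplus\mathrm{id}_{n-1})\,;\,A\,;\,\mathsf g^{\oplus m}\,;\,(\mathsf z^{o})^{\oplus m}\qquad\text{and}\qquad B\,;\,\mathsf g^{\oplus l}\,;\,(\mathsf z^{o})^{\oplus l}$$ are IHP-equal. -/

import Mathlib

namespace PolyCone

universe u v

/-! ## Free props and symmetric monoidal (in)equality theories -/

/-- Terms over a monoidal signature `S` (`S n m` is the set of generators with arity `n` and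
coarity `m`): generators, identities and symmetries, closed under sequential composition and
monoidal product. -/
inductive Term (S : ℕ → ℕ → Type u) : ℕ → ℕ → Type u
  | gen {n m : ℕ} (g : S n m) : Term S n m
  | id (n : ℕ) : Term S n n
  | sym (n m : ℕ) : Term S (n + m) (m + n)
  | comp {n m p : ℕ} (a : Term S n m) (b : Term S m p) : Term S n p
  | tensor {n m p q : ℕ} (a : Term S n m) (b : Term S p q) : Term S (n + p) (m + q)

infixr:65 " ;; " => Term.comp
infixl:70 " ⊠ " => Term.tensor

namespace Term

/-- Transport of a term along equalities of its arities. -/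
def cast {S : ℕ → ℕ → Type u} {n m n' m' : ℕ} (hn : n = n') (hm : m = m')
    (a : Term S n m) : Term S n' m' :=
  hm ▸ hn ▸ a

/-- The translation of terms induced by a translation of generators. -/
def map {S : ℕ → ℕ → Type u} {T : ℕ → ℕ → Type v} (f : ∀ {n m : ℕ}, S n m → T n m) :
    ∀ {n m : ℕ}, Term S n m → Term T n m
  | _, _, gen g => gen (f g)
  | _, _, id n => id n
  | _, _, sym n m => sym n m
  | _, _, comp a b => comp (map f a) (map f b)
  | _, _, tensor a b => tensor (map f a) (map f b)

end Term

/-- The laws of symmetric strict monoidal categories, for terms. Strictness identifies terms whose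
arities are equal but not syntactically so, such as `(n + p) + r` and `n + (p + r)`; the relation is
therefore allowed to relate terms with different indices. -/
inductive SSMLaw {S : ℕ → ℕ → Type u} :
    ∀ {n m n' m' : ℕ}, Term S n m → Term S n' m' → Prop
  | comp_assoc {n m p q : ℕ} (a : Term S n m) (b : Term S m p) (c : Term S p q) :
      SSMLaw ((a ;; b) ;; c) (a ;; (b ;; c))
  | id_comp {n m : ℕ} (a : Term S n m) : SSMLaw (Term.id n ;; a) a
  | comp_id {n m : ℕ} (a : Term S n m) : SSMLaw (a ;; Term.id m) a
  | tensor_assoc {n m p q r s : ℕ} (a : Term S n m) (b : Term S p q) (c : Term S r s) :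
      SSMLaw ((a ⊠ b) ⊠ c) (a ⊠ (b ⊠ c))
  | unit_tensor {n m : ℕ} (a : Term S n m) : SSMLaw (Term.id 0 ⊠ a) a
  | tensor_unit {n m : ℕ} (a : Term S n m) : SSMLaw (a ⊠ Term.id 0) a
  | id_tensor_id (n m : ℕ) : SSMLaw (Term.id (S := S) n ⊠ Term.id m) (Term.id (n + m))
  | interchange {n m p n' m' p' : ℕ} (a : Term S n m) (b : Term S m p)
      (a' : Term S n' m') (b' : Term S m' p') :
      SSMLaw ((a ⊠ a') ;; (b ⊠ b')) ((a ;; b) ⊠ (a' ;; b'))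
  | sym_natural {n m p q : ℕ} (a : Term S n m) (b : Term S p q) :
      SSMLaw ((a ⊠ b) ;; Term.sym m q) (Term.sym n p ;; (b ⊠ a))
  | sym_sym (n m : ℕ) :
      SSMLaw (Term.sym (S := S) n m ;; Term.sym m n) (Term.id (n + m))
  | hexagon (n m p : ℕ) :
      SSMLaw (Term.sym (S := S) n (m + p))
        ((Term.sym n m ⊠ Term.id p) ;;
          Term.cast (Nat.add_assoc m n p).symm rfl (Term.id m ⊠ Term.sym n p))

/-- `Le I` is the order of the free ordered prop on the inequality theory `I`: the smallest
precongruence for `;;` and `⊠` that contains `I` and the laws of symmetric strict monoidal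
categories (the latter in both directions). -/
inductive Le {S : ℕ → ℕ → Type u} (I : ∀ {n m : ℕ}, Term S n m → Term S n m → Prop) :
    ∀ {n m n' m' : ℕ}, Term S n m → Term S n' m' → Prop
  | ax {n m : ℕ} {a b : Term S n m} : I a b → Le I a b
  | law {n m n' m' : ℕ} {a : Term S n m} {b : Term S n' m'} : SSMLaw a b → Le I a b
  | law_symm {n m n' m' : ℕ} {a : Term S n m} {b : Term S n' m'} : SSMLaw a b → Le I b a
  | refl {n m : ℕ} (a : Term S n m) : Le I a a
  | trans {n m n' m' n'' m'' : ℕ} {a : Term S n m} {b : Term S n' m'} {c : Term S n'' m''} :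
      Le I a b → Le I b c → Le I a c
  | comp {n m p n' m' p' : ℕ} {a : Term S n m} {b : Term S m p}
      {a' : Term S n' m'} {b' : Term S m' p'} :
      Le I a a' → Le I b b' → Le I (a ;; b) (a' ;; b')
  | tensor {n m p q n' m' p' q' : ℕ} {a : Term S n m} {b : Term S p q}
      {a' : Term S n' m'} {b' : Term S p' q'} :
      Le I a a' → Le I b b' → Le I (a ⊠ b) (a' ⊠ b')

/-- Related terms have the same arity and the same coarity. -/
theorem Le.arity_eq {S : ℕ → ℕ → Type u} {I : ∀ {n m : ℕ}, Term S n m → Term S n m → Prop}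
    {n m n' m' : ℕ} {a : Term S n m} {b : Term S n' m'} (h : Le I a b) : n = n' ∧ m = m' := by
  induction h with
  | ax _ => exact ⟨rfl, rfl⟩
  | law h => cases h <;> constructor <;> omega
  | law_symm h => cases h <;> constructor <;> omega
  | refl _ => exact ⟨rfl, rfl⟩
  | trans _ _ h₁ h₂ => exact ⟨h₁.1.trans h₂.1, h₁.2.trans h₂.2⟩
  | comp _ _ h₁ h₂ => exact ⟨h₁.1, h₂.2⟩
  | tensor _ _ h₁ h₂ => constructor <;> omega

/-! ## Circuits -/

/-- Generators of matrix circuits: copier, discharger, amplifiers, adder and zero. -/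
inductive FwdGen (𝕜 : Type u) : ℕ → ℕ → Type u
  | copy : FwdGen 𝕜 1 2
  | delete : FwdGen 𝕜 1 0
  | scalar (r : 𝕜) : FwdGen 𝕜 1 1
  | add : FwdGen 𝕜 2 1
  | zero : FwdGen 𝕜 0 1

/-- Generators of circuits: the generators of matrix circuits and their mirror images. -/
inductive CircGen (𝕜 : Type u) : ℕ → ℕ → Type u
  | fwd {n m : ℕ} (g : FwdGen 𝕜 n m) : CircGen 𝕜 n m
  | bwd {n m : ℕ} (g : FwdGen 𝕜 n m) : CircGen 𝕜 m n

/-- Generators of circuits with the order primitive. -/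
inductive OrdGen (𝕜 : Type u) : ℕ → ℕ → Type u
  | circ {n m : ℕ} (g : CircGen 𝕜 n m) : OrdGen 𝕜 n m
  | geq : OrdGen 𝕜 1 1

/-- Matrix circuits. -/
abbrev MatrixCircuit (𝕜 : Type u) : ℕ → ℕ → Type u := Term (FwdGen 𝕜)

/-- Circuits. -/
abbrev Circuit (𝕜 : Type u) : ℕ → ℕ → Type u := Term (CircGen 𝕜)

/-- Circuits with the order primitive. -/
abbrev OrdCircuit (𝕜 : Type u) : ℕ → ℕ → Type u := Term (OrdGen 𝕜)

namespace Circuit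

variable {𝕜 : Type u}

def copy : Circuit 𝕜 1 2 := Term.gen (CircGen.fwd FwdGen.copy)
def delete : Circuit 𝕜 1 0 := Term.gen (CircGen.fwd FwdGen.delete)
def scalar (r : 𝕜) : Circuit 𝕜 1 1 := Term.gen (CircGen.fwd (FwdGen.scalar r))
def add : Circuit 𝕜 2 1 := Term.gen (CircGen.fwd FwdGen.add)
def zero : Circuit 𝕜 0 1 := Term.gen (CircGen.fwd FwdGen.zero)
def coCopy : Circuit 𝕜 2 1 := Term.gen (CircGen.bwd FwdGen.copy)
def coDelete : Circuit 𝕜 0 1 := Term.gen (CircGen.bwd FwdGen.delete)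
def coScalar (r : 𝕜) : Circuit 𝕜 1 1 := Term.gen (CircGen.bwd (FwdGen.scalar r))
def coAdd : Circuit 𝕜 1 2 := Term.gen (CircGen.bwd FwdGen.add)
def coZero : Circuit 𝕜 1 0 := Term.gen (CircGen.bwd FwdGen.zero)

/-- A single wire. -/
def wire : Circuit 𝕜 1 1 := Term.id 1

/-- The exchange of the two middle wires among four. -/
def midSwap : Circuit 𝕜 4 4 := wire ⊠ Term.sym 1 1 ⊠ wire

/-- The wire bent to the right, relating the empty tuple to all pairs `(x, x)`. -/
def cup : Circuit 𝕜 0 2 := coDelete ;; copy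

/-- The wire bent to the left, relating all pairs `(x, x)` to the empty tuple. -/
def cap : Circuit 𝕜 2 0 := coCopy ;; delete

end Circuit

/-- The mirror image of a generator. -/
def CircGen.op {𝕜 : Type u} : ∀ {n m : ℕ}, CircGen 𝕜 n m → CircGen 𝕜 m n
  | _, _, CircGen.fwd g => CircGen.bwd g
  | _, _, CircGen.bwd g => CircGen.fwd g

/-- The mirror image of a circuit. -/
def Circuit.op {𝕜 : Type u} : ∀ {n m : ℕ}, Circuit 𝕜 n m → Circuit 𝕜 m n
  | _, _, Term.gen g => Term.gen g.op
  | _, _, Term.id n => Term.id n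
  | _, _, Term.sym n m => Term.sym m n
  | _, _, Term.comp a b => Term.comp (Circuit.op b) (Circuit.op a)
  | _, _, Term.tensor a b => Term.tensor (Circuit.op a) (Circuit.op b)

open Circuit in
/-- The equations of interacting Hopf algebras, up to mirror image. -/
inductive IHEquation {𝕜 : Type u} [Field 𝕜] :
    ∀ {n m : ℕ}, Circuit 𝕜 n m → Circuit 𝕜 n m → Prop
  -- commutative monoid and cocommutative comonoid
  | add_assoc : IHEquation (n := 3) (m := 1) ((add ⊠ wire) ;; add) ((wire ⊠ add) ;; add)
  | add_comm : IHEquation (n := 2) (m := 1) (Term.sym 1 1 ;; add) add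
  | add_unit : IHEquation (n := 1) (m := 1) ((zero ⊠ wire) ;; add) wire
  | copy_assoc : IHEquation (n := 1) (m := 3) (copy ;; (copy ⊠ wire)) (copy ;; (wire ⊠ copy))
  | copy_comm : IHEquation (n := 1) (m := 2) (copy ;; Term.sym 1 1) copy
  | copy_unit : IHEquation (n := 1) (m := 1) (copy ;; (delete ⊠ wire)) wire
  -- bimonoid
  | bimonoid : IHEquation (n := 2) (m := 2) (add ;; copy)
      ((copy ⊠ copy) ;; midSwap ;; (add ⊠ add))
  | bimonoid_unit : IHEquation (n := 0) (m := 2) (zero ;; copy) (zero ⊠ zero)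
  | bimonoid_counit : IHEquation (n := 2) (m := 0) (add ;; delete) (delete ⊠ delete)
  | bone : IHEquation (n := 0) (m := 0) (zero ;; delete) (Term.id 0)
  -- scalars
  | scalar_add (r : 𝕜) :
      IHEquation (n := 2) (m := 1) (add ;; scalar r) ((scalar r ⊠ scalar r) ;; add)
  | scalar_zero (r : 𝕜) : IHEquation (n := 0) (m := 1) zero (zero ;; scalar r)
  | scalar_copy (r : 𝕜) :
      IHEquation (n := 1) (m := 2) (scalar r ;; copy) (copy ;; (scalar r ⊠ scalar r))
  | scalar_delete (r : 𝕜) : IHEquation (n := 1) (m := 0) (scalar r ;; delete) delete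
  | mul (r s : 𝕜) : IHEquation (n := 1) (m := 1) (scalar r ;; scalar s) (scalar (r * s))
  | sum (r s : 𝕜) :
      IHEquation (n := 1) (m := 1) (copy ;; (scalar r ⊠ scalar s) ;; add) (scalar (r + s))
  | zero_scalar : IHEquation (n := 1) (m := 1) (scalar 0) (delete ;; zero)
  | scalar_inv (r : 𝕜) (hr : r ≠ 0) :
      IHEquation (n := 1) (m := 1) (scalar r ;; coScalar r) wire
  | scalar_coinv (r : 𝕜) (hr : r ≠ 0) :
      IHEquation (n := 1) (m := 1) wire (coScalar r ;; scalar r)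
  -- Frobenius algebra of the copier
  | copy_frob_left : IHEquation (n := 2) (m := 2)
      ((copy ⊠ wire) ;; (wire ⊠ coCopy)) (coCopy ;; copy)
  | copy_frob_right : IHEquation (n := 2) (m := 2)
      (coCopy ;; copy) ((wire ⊠ copy) ;; (coCopy ⊠ wire))
  | copy_special : IHEquation (n := 1) (m := 1) (copy ;; coCopy) wire
  | copy_bone : IHEquation (n := 0) (m := 0) (coDelete ;; delete) (Term.id 0)
  -- Frobenius algebra of the adder
  | add_frob_left : IHEquation (n := 2) (m := 2)
      ((coAdd ⊠ wire) ;; (wire ⊠ add)) (add ;; coAdd)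
  | add_frob_right : IHEquation (n := 2) (m := 2)
      (add ;; coAdd) ((wire ⊠ coAdd) ;; (add ⊠ wire))
  | add_special : IHEquation (n := 1) (m := 1) (coAdd ;; add) wire
  | add_bone : IHEquation (n := 0) (m := 0) (zero ;; coZero) (Term.id 0)
  -- the two compact closed structures agree up to the antipode
  | white_cap : IHEquation (n := 2) (m := 0) ((scalar (-1) ⊠ wire) ;; add ;; coZero) cap
  | white_cup : IHEquation (n := 0) (m := 2) (zero ;; coAdd ;; (scalar (-1) ⊠ wire)) cup

/-- A circuit, seen as a circuit with the order primitive. -/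
def Circuit.toOrd {𝕜 : Type u} {n m : ℕ} (a : Circuit 𝕜 n m) : OrdCircuit 𝕜 n m :=
  Term.map (fun g => OrdGen.circ g) a

/-- A matrix circuit, seen as a circuit. -/
def MatrixCircuit.toCircuit {𝕜 : Type u} {n m : ℕ} (A : MatrixCircuit 𝕜 n m) : Circuit 𝕜 n m :=
  Term.map (fun g => CircGen.fwd g) A

/-- A matrix circuit, seen as a circuit with the order primitive. -/
def MatrixCircuit.toOrd {𝕜 : Type u} {n m : ℕ} (A : MatrixCircuit 𝕜 n m) : OrdCircuit 𝕜 n m :=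
  Circuit.toOrd (MatrixCircuit.toCircuit A)

namespace OrdCircuit

variable {𝕜 : Type u}

def copy : OrdCircuit 𝕜 1 2 := Circuit.toOrd Circuit.copy
def delete : OrdCircuit 𝕜 1 0 := Circuit.toOrd Circuit.delete
def scalar (r : 𝕜) : OrdCircuit 𝕜 1 1 := Circuit.toOrd (Circuit.scalar r)
def add : OrdCircuit 𝕜 2 1 := Circuit.toOrd Circuit.add
def coCopy : OrdCircuit 𝕜 2 1 := Circuit.toOrd Circuit.coCopy
def coDelete : OrdCircuit 𝕜 0 1 := Circuit.toOrd Circuit.coDelete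
def coZero : OrdCircuit 𝕜 1 0 := Circuit.toOrd Circuit.coZero
def wire : OrdCircuit 𝕜 1 1 := Term.id 1
def midSwap : OrdCircuit 𝕜 4 4 := Circuit.toOrd Circuit.midSwap
def cup : OrdCircuit 𝕜 0 2 := Circuit.toOrd Circuit.cup
def cap : OrdCircuit 𝕜 2 0 := Circuit.toOrd Circuit.cap

/-- The order primitive `≥`. -/
def geq : OrdCircuit 𝕜 1 1 := Term.gen OrdGen.geq

/-- The opposite of `≥`, obtained by bending both of its wires. -/
def leq : OrdCircuit 𝕜 1 1 :=
  Term.comp (n := 1) (m := 3) (cup ⊠ wire)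
    (Term.comp (m := 3) (wire ⊠ geq ⊠ wire) (wire ⊠ cap))

/-- `n` parallel copies of `≥`. -/
def geqs : ∀ n : ℕ, OrdCircuit 𝕜 n n
  | 0 => Term.id 0
  | n + 1 => geqs n ⊠ geq

/-- `n` parallel copies of the co-zero. -/
def coZeros : ∀ n : ℕ, OrdCircuit 𝕜 n 0
  | 0 => Term.id 0
  | n + 1 => coZeros n ⊠ coZero

end OrdCircuit

open OrdCircuit in
/-- The equations of polyhedral cones that involve `≥`. -/
inductive OrdEquation {𝕜 : Type u} [Field 𝕜] [LinearOrder 𝕜] :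
    ∀ {n m : ℕ}, OrdCircuit 𝕜 n m → OrdCircuit 𝕜 n m → Prop
  | geq_add : OrdEquation (n := 2) (m := 1) (add ;; geq) ((geq ⊠ geq) ;; add)
  | geq_delete : OrdEquation (n := 1) (m := 0) (geq ;; delete) delete
  | scalar_pos (r : 𝕜) (hr : 0 < r) :
      OrdEquation (n := 1) (m := 1) (scalar r ;; geq) (geq ;; scalar r)
  | scalar_neg (r : 𝕜) (hr : r < 0) :
      OrdEquation (n := 1) (m := 1) (scalar r ;; geq) (leq ;; scalar r)
  | spider : OrdEquation (n := 2) (m := 2)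
      ((geq ⊠ geq) ;; coCopy ;; copy ;; (geq ⊠ geq))
      ((copy ⊠ copy) ;; ((geq ⊠ geq) ⊠ (geq ⊠ geq)) ;; midSwap ;; (coCopy ⊠ coCopy))
  | direction : OrdEquation (n := 1) (m := 1) (leq ;; geq) (delete ;; coDelete)

open OrdCircuit in
/-- The inequalities of polyhedral cones that involve `≥`. -/
inductive OrdInequality {𝕜 : Type u} :
    ∀ {n m : ℕ}, OrdCircuit 𝕜 n m → OrdCircuit 𝕜 n m → Prop
  | geq_copy : OrdInequality (n := 1) (m := 2) (geq ;; copy) (copy ;; (geq ⊠ geq))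
  | coZero_le : OrdInequality (n := 1) (m := 0) coZero (geq ;; coZero)
  | antisymm : OrdInequality (n := 1) (m := 1) (copy ;; (geq ⊠ leq) ;; coCopy) wire

/-- The theory of polyhedral cones: the equations (in both directions) and the inequality of
interacting Hopf algebras, together with their mirror images, and the (in)equalities for `≥`. -/
inductive IHPAxiom {𝕜 : Type u} [Field 𝕜] [LinearOrder 𝕜] :
    ∀ {n m : ℕ}, OrdCircuit 𝕜 n m → OrdCircuit 𝕜 n m → Prop
  | ih {n m : ℕ} {a b : Circuit 𝕜 n m} : IHEquation a b → IHPAxiom a.toOrd b.toOrd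
  | ih_symm {n m : ℕ} {a b : Circuit 𝕜 n m} : IHEquation a b → IHPAxiom b.toOrd a.toOrd
  | ih_op {n m : ℕ} {a b : Circuit 𝕜 n m} :
      IHEquation a b → IHPAxiom a.op.toOrd b.op.toOrd
  | ih_op_symm {n m : ℕ} {a b : Circuit 𝕜 n m} :
      IHEquation a b → IHPAxiom b.op.toOrd a.op.toOrd
  | inclusion : IHPAxiom (Circuit.toOrd Circuit.coZero) (Circuit.toOrd Circuit.delete)
  | inclusion_op :
      IHPAxiom (Circuit.toOrd Circuit.coZero.op) (Circuit.toOrd Circuit.delete.op)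
  | eq {n m : ℕ} {a b : OrdCircuit 𝕜 n m} : OrdEquation a b → IHPAxiom a b
  | eq_symm {n m : ℕ} {a b : OrdCircuit 𝕜 n m} : OrdEquation a b → IHPAxiom b a
  | le {n m : ℕ} {a b : OrdCircuit 𝕜 n m} : OrdInequality a b → IHPAxiom a b

/-- Equality in the prop of the theory of polyhedral cones: the equivalence induced by the derived
order. -/
def IHPEq {𝕜 : Type u} [Field 𝕜] [LinearOrder 𝕜] {n m n' m' : ℕ}
    (a : OrdCircuit 𝕜 n m) (b : OrdCircuit 𝕜 n' m') : Prop :=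
  Le IHPAxiom a b ∧ Le IHPAxiom b a

/-- The circuit `A` followed by `≥` into zero on each of its outputs, which denotes the cone
`A x ≥ 0`. -/
def MatrixCircuit.geqZero {𝕜 : Type u} {n m : ℕ} (A : MatrixCircuit 𝕜 n m) :
    OrdCircuit 𝕜 n 0 :=
  A.toOrd ;; OrdCircuit.geqs m ;; OrdCircuit.coZeros m

end PolyCone

namespace PolyCone

variable {𝕜 : Type*} [Field 𝕜] [LinearOrder 𝕜]

-- Reading circuits as relations, the left-hand side says that some value of one variable solves a
-- homogeneous system of linear inequalities. The claim is that the theory can carry out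
-- Fourier–Motzkin elimination. No semantics and no completeness theorem for cones is available, so
-- the classical argument is redone inside the calculus.
--
-- A predicate `P` with no outputs entails a linear form `v` when `P ≼ row n v ;; pos`. Entailment
-- is closed under sums and nonnegative multiples. Since a system of inequalities can be copied and
-- discarded, `IsCone.le_geqZero` shows that `P` lies below a system as soon as it entails each of
-- its forms. Inclusions of cones thus become statements about coefficient vectors. This uses
-- `toOrd_eq_of_pull`: matrix circuits with equal matrices are provably equal.
--
-- Precomposition with `coDelete` acts as an existential quantifier. It is monotone
-- (`projCone_mono`), compatible with substitution (`comp_projCone`), trivial on predicates free of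
-- the variable (`projCone_weaken`), and satisfies Frobenius reciprocity (`copyN_projCone`). The
-- projection lies below the eliminated system because each eliminated inequality is a positive
-- combination in which the variable cancels.
--
-- Conversely a solution must be produced. Two axioms do this. The spider axiom, with its outputs
-- bent round, says that if two lower bounds lie below two upper bounds pairwise, then some number
-- lies between them (`pairwiseSums_le_bounds`). The axiom `direction` supplies a number above any
-- two (`lowerBounds_geqZero`). Finitely many bounds follow by induction, always improving a
-- solution already found: to respect one more lower bound `-a`, a solution `y` is replaced by some
-- `z` above `y` and `-a` (`cone_le_projCone_cons`). This gives arbitrarily many lower bounds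
-- against two upper ones (`cone_le_projCone_two`). After the reflection `x ↦ -x`, that case is the
-- induction step for adding upper bounds (`cone_le_projCone_boundForms`). Normalising the
-- coefficients of the eliminated variable to `±1` then yields `projCone_eliminate`.

infix:50 " ≼ " => Le IHPAxiom
infix:50 " ≋ " => IHPEq

/-! ### Equality in the theory as a congruence. -/

namespace IHPEq

variable {n m p q n' m' p' q' n'' m'' : ℕ}

@[refl] theorem refl (a : OrdCircuit 𝕜 n m) : a ≋ a := ⟨.refl a, .refl a⟩

@[symm] theorem symm {a : OrdCircuit 𝕜 n m} {b : OrdCircuit 𝕜 n' m'} (h : a ≋ b) : b ≋ a :=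
  ⟨h.2, h.1⟩

theorem trans {a : OrdCircuit 𝕜 n m} {b : OrdCircuit 𝕜 n' m'} {c : OrdCircuit 𝕜 n'' m''}
    (h : a ≋ b) (h' : b ≋ c) : a ≋ c := ⟨h.1.trans h'.1, h'.2.trans h.2⟩

theorem comp {a : OrdCircuit 𝕜 n m} {b : OrdCircuit 𝕜 m p} {a' : OrdCircuit 𝕜 n' m'}
    {b' : OrdCircuit 𝕜 m' p'} (h : a ≋ a') (h' : b ≋ b') : a ;; b ≋ a' ;; b' :=
  ⟨.comp h.1 h'.1, .comp h.2 h'.2⟩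

theorem tensor {a : OrdCircuit 𝕜 n m} {b : OrdCircuit 𝕜 p q} {a' : OrdCircuit 𝕜 n' m'}
    {b' : OrdCircuit 𝕜 p' q'} (h : a ≋ a') (h' : b ≋ b') : a ⊠ b ≋ a' ⊠ b' :=
  ⟨.tensor h.1 h'.1, .tensor h.2 h'.2⟩

theorem law {a : OrdCircuit 𝕜 n m} {b : OrdCircuit 𝕜 n' m'} (h : SSMLaw a b) : a ≋ b :=
  ⟨.law h, .law_symm h⟩

theorem of_eq {a b : OrdCircuit 𝕜 n m} (h : a = b) : a ≋ b := h ▸ refl a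

theorem id_of_eq (h : n = m) : (Term.id n : OrdCircuit 𝕜 n n) ≋ (Term.id m : OrdCircuit 𝕜 m m) := by
  subst h; rfl

/-- Because the relation allows different indices, transport is invisible to it. Casts can therefore
be inserted wherever typing demands them and dropped again. -/
theorem cast (hn : n = n') (hm : m = m') (a : OrdCircuit 𝕜 n m) : Term.cast hn hm a ≋ a := by
  subst hn hm; rfl

end IHPEq

instance {n m n' m' n'' m'' : ℕ} : Trans
    (IHPEq : OrdCircuit 𝕜 n m → OrdCircuit 𝕜 n' m' → Prop)
    (IHPEq : OrdCircuit 𝕜 n' m' → OrdCircuit 𝕜 n'' m'' → Prop)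
    (IHPEq : OrdCircuit 𝕜 n m → OrdCircuit 𝕜 n'' m'' → Prop) := ⟨IHPEq.trans⟩

instance {n m n' m' n'' m'' : ℕ} : Trans
    (Le IHPAxiom : OrdCircuit 𝕜 n m → OrdCircuit 𝕜 n' m' → Prop)
    (Le IHPAxiom : OrdCircuit 𝕜 n' m' → OrdCircuit 𝕜 n'' m'' → Prop)
    (Le IHPAxiom : OrdCircuit 𝕜 n m → OrdCircuit 𝕜 n'' m'' → Prop) := ⟨Le.trans⟩

instance {n m n' m' n'' m'' : ℕ} : Trans
    (IHPEq : OrdCircuit 𝕜 n m → OrdCircuit 𝕜 n' m' → Prop)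
    (Le IHPAxiom : OrdCircuit 𝕜 n' m' → OrdCircuit 𝕜 n'' m'' → Prop)
    (Le IHPAxiom : OrdCircuit 𝕜 n m → OrdCircuit 𝕜 n'' m'' → Prop) := ⟨fun h h' => h.1.trans h'⟩

instance {n m n' m' n'' m'' : ℕ} : Trans
    (Le IHPAxiom : OrdCircuit 𝕜 n m → OrdCircuit 𝕜 n' m' → Prop)
    (IHPEq : OrdCircuit 𝕜 n' m' → OrdCircuit 𝕜 n'' m'' → Prop)
    (Le IHPAxiom : OrdCircuit 𝕜 n m → OrdCircuit 𝕜 n'' m'' → Prop) := ⟨fun h h' => h.trans h'.1⟩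

/-! ## Symmetric strict monoidal structure -/

section Structural

variable {n m p q r s n' m' p' q' : ℕ}

theorem comp_assoc (a : OrdCircuit 𝕜 n m) (b : OrdCircuit 𝕜 m p) (c : OrdCircuit 𝕜 p q) :
    (a ;; b) ;; c ≋ a ;; (b ;; c) := .law (.comp_assoc a b c)

theorem id_comp (a : OrdCircuit 𝕜 n m) : Term.id n ;; a ≋ a := .law (.id_comp a)

theorem comp_id (a : OrdCircuit 𝕜 n m) : a ;; Term.id m ≋ a := .law (.comp_id a)

theorem tensor_assoc (a : OrdCircuit 𝕜 n m) (b : OrdCircuit 𝕜 p q) (c : OrdCircuit 𝕜 r s) :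
    (a ⊠ b) ⊠ c ≋ a ⊠ (b ⊠ c) := .law (.tensor_assoc a b c)

theorem unit_tensor (a : OrdCircuit 𝕜 n m) : Term.id 0 ⊠ a ≋ a := .law (.unit_tensor a)

theorem tensor_unit (a : OrdCircuit 𝕜 n m) : a ⊠ Term.id 0 ≋ a := .law (.tensor_unit a)

variable (𝕜) in
theorem id_tensor_id (n m : ℕ) :
    (Term.id n ⊠ Term.id m : OrdCircuit 𝕜 _ _) ≋ Term.id (n + m) := .law (.id_tensor_id n m)

theorem interchange (a : OrdCircuit 𝕜 n m) (b : OrdCircuit 𝕜 m p)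
    (a' : OrdCircuit 𝕜 n' m') (b' : OrdCircuit 𝕜 m' p') :
    (a ⊠ a') ;; (b ⊠ b') ≋ (a ;; b) ⊠ (a' ;; b') := .law (.interchange a b a' b')

theorem sym_natural (a : OrdCircuit 𝕜 n m) (b : OrdCircuit 𝕜 p q) :
    (a ⊠ b) ;; Term.sym m q ≋ Term.sym n p ;; (b ⊠ a) := .law (.sym_natural a b)

variable (𝕜) in
theorem sym_sym (n m : ℕ) :
    (Term.sym n m ;; Term.sym m n : OrdCircuit 𝕜 _ _) ≋ Term.id (n + m) := .law (.sym_sym n m)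

theorem comp_tensor_id (a : OrdCircuit 𝕜 n m) (b : OrdCircuit 𝕜 m p) (q : ℕ) :
    (a ;; b) ⊠ Term.id q ≋ (a ⊠ Term.id q) ;; (b ⊠ Term.id q) :=
  ((interchange a b _ _).trans (.tensor (.refl _) (comp_id _))).symm

theorem id_tensor_comp (q : ℕ) (a : OrdCircuit 𝕜 n m) (b : OrdCircuit 𝕜 m p) :
    Term.id q ⊠ (a ;; b) ≋ (Term.id q ⊠ a) ;; (Term.id q ⊠ b) :=
  ((interchange _ _ a b).trans (.tensor (comp_id _) (.refl _))).symm

theorem tensor_eq_left (a : OrdCircuit 𝕜 n m) (b : OrdCircuit 𝕜 p q) :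
    a ⊠ b ≋ (a ⊠ Term.id p) ;; (Term.id m ⊠ b) :=
  ((interchange _ _ _ _).trans (.tensor (comp_id _) (id_comp _))).symm

theorem tensor_eq_right (a : OrdCircuit 𝕜 n m) (b : OrdCircuit 𝕜 p q) :
    a ⊠ b ≋ (Term.id n ⊠ b) ;; (a ⊠ Term.id q) :=
  ((interchange _ _ _ _).trans (.tensor (id_comp _) (comp_id _))).symm

theorem whisker_exchange (a : OrdCircuit 𝕜 n m) (b : OrdCircuit 𝕜 p q) :
    (a ⊠ Term.id p) ;; (Term.id m ⊠ b) ≋ (Term.id n ⊠ b) ;; (a ⊠ Term.id q) :=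
  (tensor_eq_left a b).symm.trans (tensor_eq_right a b)

-- The hexagon with two trivial blocks makes this symmetry idempotent, and an invertible idempotent
-- is an identity.
variable (𝕜) in
theorem sym_zero_right (n : ℕ) : (Term.sym n 0 : OrdCircuit 𝕜 (n + 0) (0 + n)) ≋ Term.id n := by
  have h : (Term.sym n 0 : OrdCircuit 𝕜 (n + 0) (0 + n)) ≋
      Term.sym n 0 ;; Term.cast (Nat.zero_add n).symm rfl (Term.sym n 0) :=
    (IHPEq.law (.hexagon n 0 0)).trans (.comp (tensor_unit _)
      ((IHPEq.cast _ _ _).trans ((unit_tensor _).trans (IHPEq.cast _ _ _).symm)))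
  calc (Term.sym n 0 : OrdCircuit 𝕜 (n + 0) (0 + n))
      ≋ Term.cast (Nat.zero_add n).symm rfl (Term.sym n 0) := (IHPEq.cast _ _ _).symm
    _ ≋ Term.id (0 + n) ;; Term.cast (Nat.zero_add n).symm rfl (Term.sym n 0) := (id_comp _).symm
    _ ≋ (Term.sym 0 n ;; Term.sym n 0) ;; Term.cast (Nat.zero_add n).symm rfl (Term.sym n 0) :=
      .comp (sym_sym 𝕜 0 n).symm (.refl _)
    _ ≋ Term.sym 0 n ;; (Term.sym n 0 ;; Term.cast (Nat.zero_add n).symm rfl (Term.sym n 0)) :=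
      comp_assoc _ _ _
    _ ≋ Term.sym 0 n ;; Term.sym n 0 := .comp (.refl _) h.symm
    _ ≋ Term.id (0 + n) := sym_sym 𝕜 0 n
    _ ≋ Term.id n := .id_of_eq (Nat.zero_add n)

variable (𝕜) in
theorem sym_zero_left (n : ℕ) : (Term.sym 0 n : OrdCircuit 𝕜 (0 + n) (n + 0)) ≋ Term.id n :=
  (comp_id _).symm.trans
    ((IHPEq.comp (.refl _) (sym_zero_right 𝕜 n).symm).trans
      ((sym_sym 𝕜 0 n).trans (.id_of_eq (Nat.zero_add n))))

end Structural
end PolyCone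

namespace PolyCone

variable {𝕜 : Type*} [Field 𝕜] [LinearOrder 𝕜]

/-! ## Deciding equality modulo the laws of strict monoidal categories

A diagram is flattened to the list of its boxes, each recorded with the number of wires on its left
and on its right; moving boxes past each other brings this list into a normal form. -/

/-- A box with `left` wires on its left and `right` wires on its right. -/
structure Layer (𝕜 : Type*) where
  left : ℕ
  right : ℕ
  dom : ℕ
  cod : ℕ
  box : OrdCircuit 𝕜 dom cod

namespace Layer

/-- The circuit denoted by a layer. -/
def term (L : Layer 𝕜) : OrdCircuit 𝕜 (L.left + L.dom + L.right) (L.left + L.cod + L.right) :=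
  Term.id L.left ⊠ L.box ⊠ Term.id L.right

/-- Add wires on the right. -/
def addRight (p : ℕ) (L : Layer 𝕜) : Layer 𝕜 := ⟨L.left, L.right + p, L.dom, L.cod, L.box⟩

/-- Add wires on the left. -/
def addLeft (p : ℕ) (L : Layer 𝕜) : Layer 𝕜 := ⟨p + L.left, L.right, L.dom, L.cod, L.box⟩

/-- Insert a layer in front of a list, moving it behind the boxes that are entirely on its left. -/
def insert (L : Layer 𝕜) : List (Layer 𝕜) → List (Layer 𝕜)
  | [] => [L]
  | K :: l =>
    bif Nat.ble (K.left + K.dom) L.left then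
      ⟨K.left, L.left + L.dom + L.right - (K.left + K.dom), K.dom, K.cod, K.box⟩ ::
        insert ⟨L.left - K.dom + K.cod, L.right, L.dom, L.cod, L.box⟩ l
    else L :: K :: l

/-- Bring a list of layers into normal form. -/
def normalize : List (Layer 𝕜) → List (Layer 𝕜)
  | [] => []
  | L :: l => insert L (normalize l)

end Layer

/-- The list of boxes of a circuit. -/
def layers : ∀ {n m : ℕ}, OrdCircuit 𝕜 n m → List (Layer 𝕜)
  | _, _, Term.gen (n := n) (m := m) g => [⟨0, 0, n, m, Term.gen g⟩]
  | _, _, Term.id _ => []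
  | _, _, Term.sym n m => [⟨0, 0, n + m, m + n, Term.sym n m⟩]
  | _, _, Term.comp a b => layers a ++ layers b
  | _, _, Term.tensor (m := m) (p := p) a b =>
    (layers a).map (Layer.addRight p) ++ (layers b).map (Layer.addLeft m)

/-- `Represents l t` says that the circuit `t` is the composite of the layers in `l`. -/
def Represents : List (Layer 𝕜) → ∀ {n m : ℕ}, OrdCircuit 𝕜 n m → Prop
  | [], n, _, t => t ≋ (Term.id n : OrdCircuit 𝕜 n n)
  | L :: l, _, m, t =>
    ∃ s : OrdCircuit 𝕜 (L.left + L.cod + L.right) m, t ≋ L.term ;; s ∧ Represents l s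

namespace Represents

variable {n m p n' m' : ℕ}

theorem congr {l : List (Layer 𝕜)} {t : OrdCircuit 𝕜 n m} {t' : OrdCircuit 𝕜 n' m'}
    (h : t ≋ t') (ht : Represents l t) : Represents l t' := by
  obtain ⟨rfl, rfl⟩ := h.1.arity_eq
  cases l with
  | nil => exact h.symm.trans ht
  | cons L l => obtain ⟨s, hs, hl⟩ := ht; exact ⟨s, h.symm.trans hs, hl⟩

/-- This is what makes the normal form sound: a list of layers and a domain determine the circuit up
to equality. -/
theorem unique {l : List (Layer 𝕜)} {t : OrdCircuit 𝕜 n m} {t' : OrdCircuit 𝕜 n m'}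
    (ht : Represents l t) (ht' : Represents l t') : t ≋ t' := by
  induction l generalizing n with
  | nil => exact IHPEq.trans ht (IHPEq.symm ht')
  | cons L l ih =>
    obtain ⟨s, hs, hl⟩ := ht
    obtain ⟨s', hs', hl'⟩ := ht'
    exact hs.trans ((IHPEq.comp (.refl _) (ih hl hl')).trans hs'.symm)

theorem append {l l' : List (Layer 𝕜)} {t : OrdCircuit 𝕜 n m} {s : OrdCircuit 𝕜 m p}
    (ht : Represents l t) (hs : Represents l' s) : Represents (l ++ l') (t ;; s) := by
  induction l generalizing n with
  | nil =>
    obtain ⟨-, rfl⟩ := (show t ≋ _ from ht).1.arity_eq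
    exact congr ((IHPEq.comp ht (.refl s)).trans (id_comp s)).symm hs
  | cons L l ih =>
    obtain ⟨s', hs', hl⟩ := ht
    exact ⟨s' ;; s, (IHPEq.comp hs' (.refl s)).trans (comp_assoc _ _ _), ih hl⟩

theorem addRight {l : List (Layer 𝕜)} {t : OrdCircuit 𝕜 n m} (p : ℕ) (ht : Represents l t) :
    Represents (l.map (Layer.addRight p)) (t ⊠ Term.id p) := by
  induction l generalizing n with
  | nil => exact (IHPEq.tensor ht (.refl _)).trans (id_tensor_id 𝕜 _ _)
  | cons L l ih =>
    obtain ⟨s, hs, hl⟩ := ht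
    refine ⟨Term.cast (Nat.add_assoc _ _ _) rfl (s ⊠ Term.id p), ?_,
      congr (IHPEq.cast _ _ _).symm (ih hl)⟩
    refine (IHPEq.tensor hs (.refl _)).trans ((comp_tensor_id _ _ _).trans ?_)
    refine .comp ?_ (IHPEq.cast _ _ _).symm
    exact (tensor_assoc _ _ _).trans (.tensor (.refl _) (id_tensor_id 𝕜 _ _))

theorem addLeft {l : List (Layer 𝕜)} {t : OrdCircuit 𝕜 n m} (p : ℕ) (ht : Represents l t) :
    Represents (l.map (Layer.addLeft p)) (Term.id p ⊠ t) := by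
  induction l generalizing n with
  | nil => exact (IHPEq.tensor (.refl _) ht).trans (id_tensor_id 𝕜 _ _)
  | cons L l ih =>
    obtain ⟨s, hs, hl⟩ := ht
    refine ⟨Term.cast (by simp only [Layer.addLeft]; omega) rfl (Term.id p ⊠ s), ?_,
      congr (IHPEq.cast _ _ _).symm (ih hl)⟩
    refine (IHPEq.tensor (.refl _) hs).trans ((id_tensor_comp _ _ _).trans ?_)
    refine .comp ?_ (IHPEq.cast _ _ _).symm
    refine (tensor_assoc _ _ _).symm.trans (.tensor ?_ (.refl _))
    exact (tensor_assoc _ _ _).symm.trans (.tensor (id_tensor_id 𝕜 _ _) (.refl _))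

theorem box (a : OrdCircuit 𝕜 n m) : Represents [⟨0, 0, n, m, a⟩] a :=
  ⟨Term.cast (Nat.zero_add m).symm rfl (Term.id m),
    (comp_id a).symm.trans (.comp ((unit_tensor a).symm.trans (tensor_unit _).symm)
      (IHPEq.cast _ _ _).symm), (IHPEq.cast _ _ _).trans (.id_of_eq (Nat.zero_add m).symm)⟩

theorem layers : ∀ {n m : ℕ} (t : OrdCircuit 𝕜 n m), Represents (layers t) t
  | _, _, Term.gen g => box (Term.gen g)
  | _, _, Term.id n => .refl _
  | _, _, Term.sym n m => box _
  | _, _, Term.comp a b => append (layers a) (layers b)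
  | _, _, Term.tensor a b => congr (tensor_eq_left a b).symm
      (append (addRight _ (layers a)) (addLeft _ (layers b)))

/-- The second box only touches wires to the left of the first, so the interchange law lets it act
first. The offsets are then adjusted for the change in the number of wires. Symmetries count as
opaque boxes, so their naturality is always invoked by hand. -/
theorem swap {L K : Layer 𝕜} {l : List (Layer 𝕜)} {t : OrdCircuit 𝕜 n m}
    (h : K.left + K.dom ≤ L.left) (ht : Represents (L :: K :: l) t) :
    Represents (⟨K.left, L.left + L.dom + L.right - (K.left + K.dom), K.dom, K.cod, K.box⟩ ::
      ⟨L.left - K.dom + K.cod, L.right, L.dom, L.cod, L.box⟩ :: l) t := by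
  obtain ⟨s, hs, s', hs', hl⟩ := ht
  obtain ⟨k₁, r₁, n₁, m₁, g₁⟩ := L
  obtain ⟨k₂, r₂, n₂, m₂, g₂⟩ := K
  -- A list of layers does not record that neighbouring layers fit together; this equation is
  -- recovered from the arities of related terms.
  have hd := hs'.1.arity_eq.1
  simp only at h hs hs' hl hd
  obtain ⟨d, rfl⟩ := Nat.exists_eq_add_of_le h
  have e₁ : k₂ + n₂ + d + n₁ + r₁ - (k₂ + n₂) = d + n₁ + r₁ := by omega
  have e₂ : k₂ + n₂ + d - n₂ + m₂ = k₂ + m₂ + d := by omega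
  have e₃ : r₂ = d + m₁ + r₁ := by omega
  simp only [e₁, e₂]
  subst e₃
  have hL (x y z : ℕ) (g : OrdCircuit 𝕜 y z) :
      (Term.id (x + d) ⊠ g ⊠ Term.id r₁) ≋ Term.id x ⊠ (Term.id d ⊠ g ⊠ Term.id r₁) :=
    (IHPEq.tensor ((IHPEq.tensor (id_tensor_id 𝕜 _ _).symm (.refl _)).trans (tensor_assoc _ _ _))
      (.refl _)).trans (tensor_assoc _ _ _)
  have hs'' : s ≋ (Term.id k₂ ⊠ g₂ ⊠ Term.id (d + m₁ + r₁)) ;; s' := hs'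
  refine ⟨(Term.id (k₂ + m₂) ⊠ (Term.id d ⊠ g₁ ⊠ Term.id r₁)) ;; s', ?_,
    Term.cast (by simp only; omega) rfl s', ?_, congr (IHPEq.cast _ _ _).symm hl⟩
  · refine hs.trans ((IHPEq.comp (hL (k₂ + n₂) n₁ m₁ g₁) hs'').trans ?_)
    exact (comp_assoc _ _ _).symm.trans ((IHPEq.comp (whisker_exchange (Term.id k₂ ⊠ g₂)
      (Term.id d ⊠ g₁ ⊠ Term.id r₁)).symm (.refl _)).trans (comp_assoc _ _ _))
  · exact .comp (hL _ _ _ _).symm (IHPEq.cast _ _ _).symm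

theorem insert {L : Layer 𝕜} {l : List (Layer 𝕜)} {t : OrdCircuit 𝕜 n m}
    (ht : Represents (L :: l) t) : Represents (L.insert l) t := by
  induction l generalizing L n with
  | nil => exact ht
  | cons K l ih =>
    unfold Layer.insert
    cases h : Nat.ble (K.left + K.dom) L.left with
    | false => exact ht
    | true =>
      obtain ⟨s, hs, hl⟩ := swap (Nat.le_of_ble_eq_true h) ht
      exact ⟨s, hs, ih hl⟩

theorem normalize {l : List (Layer 𝕜)} {t : OrdCircuit 𝕜 n m} (ht : Represents l t) :
    Represents (Layer.normalize l) t := by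
  induction l generalizing n with
  | nil => exact ht
  | cons L l ih =>
    obtain ⟨s, hs, hl⟩ := ht
    exact insert ⟨s, hs, ih hl⟩

end Represents

/-- Circuits with the same normal form are equal by the laws of strict monoidal categories. -/
theorem IHPEq.of_normalize {n m m' : ℕ} {t : OrdCircuit 𝕜 n m} {s : OrdCircuit 𝕜 n m'}
    (h : Layer.normalize (layers t) = Layer.normalize (layers s)) : t ≋ s :=
  (Represents.layers t).normalize.unique (h ▸ (Represents.layers s).normalize)

end PolyCone

/-! ### Symmetries of blocks of wires. -/

namespace PolyCone

/-- The exchange of the two middle blocks among four blocks of wires. -/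
def Term.shuffle {S : ℕ → ℕ → Type*} (n n' p p' : ℕ) :
    Term S ((n + n') + (p + p')) ((n + p) + (n' + p')) :=
  Term.cast (by omega) (by omega) (Term.id n ⊠ Term.sym n' p ⊠ Term.id p')

theorem Term.map_cast {S : ℕ → ℕ → Type*} {T : ℕ → ℕ → Type*}
    (f : ∀ {n m : ℕ}, S n m → T n m) {n m n' m' : ℕ} (hn : n = n') (hm : m = m')
    (a : Term S n m) : Term.map f (Term.cast hn hm a) = Term.cast hn hm (Term.map f a) := by
  subst hn hm; rfl

variable {𝕜 : Type*} [Field 𝕜] [LinearOrder 𝕜]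

/-- Sequential composition along a propositional equality of arities. -/
def seq {n m m' p : ℕ} (h : m = m') (a : OrdCircuit 𝕜 n m) (b : OrdCircuit 𝕜 m' p) :
    OrdCircuit 𝕜 n p :=
  a ;; Term.cast h.symm rfl b

section Seq

variable {n m p q r s n' m' p' q' : ℕ}

theorem seq_congr {h : m = m'} {a : OrdCircuit 𝕜 n m} {b : OrdCircuit 𝕜 m' p}
    {n₁ m₁ m₁' p₁ : ℕ} {a₁ : OrdCircuit 𝕜 n₁ m₁} {b₁ : OrdCircuit 𝕜 m₁' p₁}
    (ha : a ≋ a₁) (hb : b ≋ b₁) :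
    seq h a b ≋ seq (ha.1.arity_eq.2.symm.trans (h.trans hb.1.arity_eq.1)) a₁ b₁ :=
  .comp ha ((IHPEq.cast _ _ _).trans (hb.trans (IHPEq.cast _ _ _).symm))

theorem comp_eq_seq {a : OrdCircuit 𝕜 n m} {b : OrdCircuit 𝕜 m p}
    {n₁ m₁ m₁' p₁ : ℕ} {a₁ : OrdCircuit 𝕜 n₁ m₁} {b₁ : OrdCircuit 𝕜 m₁' p₁}
    (ha : a ≋ a₁) (hb : b ≋ b₁) :
    a ;; b ≋ seq (ha.1.arity_eq.2.symm.trans hb.1.arity_eq.1) a₁ b₁ :=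
  .comp ha (hb.trans (IHPEq.cast _ _ _).symm)

theorem seq_eq_comp {h : m = m'} {a : OrdCircuit 𝕜 n m} {b : OrdCircuit 𝕜 m' p}
    {n₁ m₁ p₁ : ℕ} {a₁ : OrdCircuit 𝕜 n₁ m₁} {b₁ : OrdCircuit 𝕜 m₁ p₁}
    (ha : a ≋ a₁) (hb : b ≋ b₁) : seq h a b ≋ a₁ ;; b₁ :=
  .comp ha ((IHPEq.cast _ _ _).trans hb)

theorem seq_assoc (h : m = m') (h' : p = p') (a : OrdCircuit 𝕜 n m) (b : OrdCircuit 𝕜 m' p)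
    (c : OrdCircuit 𝕜 p' q) : seq h' (seq h a b) c ≋ seq h a (seq h' b c) := by
  subst h h'; exact comp_assoc _ _ _

theorem id_tensor_seq (k : ℕ) (h : m = m') (a : OrdCircuit 𝕜 n m) (b : OrdCircuit 𝕜 m' p) :
    Term.id k ⊠ seq h a b ≋ seq (congrArg (k + ·) h) (Term.id k ⊠ a) (Term.id k ⊠ b) := by
  subst h; exact id_tensor_comp _ _ _

theorem seq_tensor_id (k : ℕ) (h : m = m') (a : OrdCircuit 𝕜 n m) (b : OrdCircuit 𝕜 m' p) :
    seq h a b ⊠ Term.id k ≋ seq (congrArg (· + k) h) (a ⊠ Term.id k) (b ⊠ Term.id k) := by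
  subst h; exact comp_tensor_id _ _ _

theorem seq_id (h : m = m') (a : OrdCircuit 𝕜 n m) : seq h a (Term.id m') ≋ a := by
  subst h; exact comp_id _

end Seq

section Shuffle

variable {n m p q n' m' p' q' : ℕ}

variable (𝕜) in
theorem hexagon_right (n m p : ℕ) : (Term.sym n (m + p) : OrdCircuit 𝕜 _ _) ≋
    seq (Nat.add_assoc m n p) (Term.sym n m ⊠ Term.id p) (Term.id m ⊠ Term.sym n p) :=
  .law (.hexagon n m p)

-- The right-hand side is a one-sided inverse of `Term.sym p (n + m)`, by `hexagon_right` and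
-- cancellation of crossings. The symmetry `Term.sym (n + m) p` is a two-sided inverse, so the two
-- agree.
variable (𝕜) in
theorem hexagon_left (n m p : ℕ) : (Term.sym (n + m) p : OrdCircuit 𝕜 _ _) ≋
    seq (Nat.add_assoc n p m).symm (Term.id n ⊠ Term.sym m p) (Term.sym n p ⊠ Term.id m) := by
  have key : seq rfl (Term.sym p (n + m) : OrdCircuit 𝕜 _ _)
      (seq (n := (n + m) + p) (Nat.add_assoc n p m).symm
        (Term.cast (Nat.add_assoc n m p).symm rfl (Term.id n ⊠ Term.sym m p))
        (Term.sym n p ⊠ Term.id m)) ≋ Term.id (p + n + m) := by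
    refine (seq_congr (hexagon_right 𝕜 p n m) (.refl _)).trans ?_
    refine (seq_assoc _ _ _ _ _).trans ?_
    refine (seq_congr (.refl _) (seq_assoc (by omega) (by omega) _ _ _).symm).trans ?_
    have h : seq (by omega) (Term.id n ⊠ Term.sym p m : OrdCircuit 𝕜 _ _)
        (Term.cast (Nat.add_assoc n m p).symm rfl (Term.id n ⊠ Term.sym m p)) ≋
        Term.id (n + (p + m)) :=
      (seq_eq_comp (.refl _) (.cast _ _ _)).trans ((id_tensor_comp _ _ _).symm.trans
        ((IHPEq.tensor (.refl _) (sym_sym 𝕜 _ _)).trans (id_tensor_id 𝕜 _ _)))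
    refine (seq_congr (.refl _) (seq_congr h (.refl _))).trans ?_
    have h' : seq (by omega) (Term.id (n + (p + m))) (Term.sym n p ⊠ Term.id m) ≋
        (Term.sym n p ⊠ Term.id m : OrdCircuit 𝕜 _ _) :=
      (seq_eq_comp (.id_of_eq (Nat.add_assoc n p m).symm) (.refl _)).trans (id_comp _)
    refine (seq_congr (.refl _) h').trans ((comp_tensor_id _ _ _).symm.trans ?_)
    exact (IHPEq.tensor (sym_sym 𝕜 _ _) (.refl _)).trans (id_tensor_id 𝕜 _ _)
  calc (Term.sym (n + m) p : OrdCircuit 𝕜 _ _)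
      ≋ Term.sym (n + m) p ;; Term.id (p + (n + m)) := (comp_id _).symm
    _ ≋ seq rfl (Term.sym (n + m) p) _ :=
      .comp (.refl _) ((IHPEq.id_of_eq (Nat.add_assoc p n m).symm).trans key.symm)
    _ ≋ _ := (seq_assoc rfl rfl _ _ _).symm
    _ ≋ _ := seq_eq_comp (sym_sym 𝕜 _ _) (.refl _)
    _ ≋ _ := (id_comp _).trans (seq_congr (.cast _ _ _) (.refl _))

theorem tensor_middle (a : OrdCircuit 𝕜 n m) (a' : OrdCircuit 𝕜 n' m') (b : OrdCircuit 𝕜 p q)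
    (b' : OrdCircuit 𝕜 p' q') : (a ⊠ a') ⊠ (b ⊠ b') ≋ (a ⊠ (a' ⊠ b)) ⊠ b' :=
  (tensor_assoc _ _ _).symm.trans (.tensor (tensor_assoc _ _ _) (.refl _))

theorem shuffle_natural (a : OrdCircuit 𝕜 n m) (a' : OrdCircuit 𝕜 n' m') (b : OrdCircuit 𝕜 p q)
    (b' : OrdCircuit 𝕜 p' q') : ((a ⊠ a') ⊠ (b ⊠ b')) ;; Term.shuffle m m' q q' ≋
      Term.shuffle n n' p p' ;; ((a ⊠ b) ⊠ (a' ⊠ b')) :=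
  calc ((a ⊠ a') ⊠ (b ⊠ b')) ;; Term.shuffle m m' q q'
      ≋ ((a ⊠ (a' ⊠ b)) ⊠ b') ;; (Term.id m ⊠ Term.sym m' q ⊠ Term.id q') :=
        .comp (tensor_middle _ _ _ _) (.cast _ _ _)
    _ ≋ (a ;; Term.id m) ⊠ ((a' ⊠ b) ;; Term.sym m' q) ⊠ (b' ;; Term.id q') :=
        (interchange _ _ _ _).trans (.tensor (interchange _ _ _ _) (.refl _))
    _ ≋ (Term.id n ;; a) ⊠ (Term.sym n' p ;; (b ⊠ a')) ⊠ (Term.id p' ;; b') :=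
        .tensor (.tensor ((comp_id _).trans (id_comp _).symm) (sym_natural _ _))
          ((comp_id _).trans (id_comp _).symm)
    _ ≋ (Term.id n ⊠ Term.sym n' p ⊠ Term.id p') ;; ((a ⊠ (b ⊠ a')) ⊠ b') :=
        ((interchange _ _ _ _).trans (.tensor (interchange _ _ _ _) (.refl _))).symm
    _ ≋ Term.shuffle n n' p p' ;; ((a ⊠ b) ⊠ (a' ⊠ b')) :=
        .comp (IHPEq.cast _ _ _).symm (tensor_middle _ _ _ _).symm

-- Both sides expand into the same three elementary crossings; they differ only in the order of the
-- two crossings on disjoint wires.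
variable (𝕜) in
theorem sym_hexagon (n p p' q : ℕ) :
    seq (by omega) (Term.sym n p ⊠ Term.id (p' + q)) (Term.id p ⊠ Term.sym (n + p') q) ≋
    (seq (by omega) (Term.id (n + p) ⊠ Term.sym p' q) (Term.sym n (p + q) ⊠ Term.id p') :
      OrdCircuit 𝕜 _ _) := by
  have h₁ : (Term.id p ⊠ Term.sym (n + p') q : OrdCircuit 𝕜 _ _) ≋
      seq (by omega) (Term.id (p + n) ⊠ Term.sym p' q) (Term.id p ⊠ (Term.sym n q ⊠ Term.id p')) :=
    (IHPEq.tensor (.refl _) (hexagon_left 𝕜 n p' q)).trans ((id_tensor_seq _ _ _ _).trans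
      (seq_congr ((tensor_assoc _ _ _).symm.trans (.tensor (id_tensor_id 𝕜 _ _) (.refl _)))
        (.refl _)))
  have h₂ : (Term.sym n (p + q) ⊠ Term.id p' : OrdCircuit 𝕜 _ _) ≋
      seq (by omega) (Term.sym n p ⊠ Term.id (q + p')) (Term.id p ⊠ (Term.sym n q ⊠ Term.id p')) :=
    (IHPEq.tensor (hexagon_right 𝕜 n p q) (.refl _)).trans ((seq_tensor_id _ _ _ _).trans
      (seq_congr ((tensor_assoc _ _ _).trans (.tensor (.refl _) (id_tensor_id 𝕜 _ _)))
        (tensor_assoc _ _ _)))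
  refine (seq_congr (.refl _) h₁).trans ((seq_assoc _ _ _ _ _).symm.trans ?_)
  refine .trans ?_ (seq_congr (.refl _) h₂).symm
  refine .trans ?_ (seq_assoc rfl (by omega) _ _ _)
  refine seq_congr ?_ (.refl _)
  exact whisker_exchange _ _

variable (𝕜) in
/-- Two ways of exchanging the blocks of three pairs of blocks. -/
theorem shuffle_shuffle (n n' p p' q q' : ℕ) :
    (Term.shuffle n n' p p' ⊠ Term.id (q + q')) ;; Term.shuffle (n + p) (n' + p') q q' ≋
    (seq (by omega) (Term.id (n + n') ⊠ Term.shuffle p p' q q')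
      (Term.shuffle n n' (p + q) (p' + q')) : OrdCircuit 𝕜 _ _) := by
  have h₁ : (Term.shuffle n n' p p' ⊠ Term.id (q + q') : OrdCircuit 𝕜 _ _) ≋
      Term.id n ⊠ (Term.sym n' p ⊠ Term.id (p' + q)) ⊠ Term.id q' := by
    refine (IHPEq.tensor (IHPEq.cast _ _ _) (id_tensor_id 𝕜 _ _).symm).trans ?_
    refine (tensor_middle _ _ _ _).trans ?_
    refine (IHPEq.tensor (tensor_assoc _ _ _) (.refl _)).trans ?_
    exact .tensor (.tensor (.refl _) (.tensor (.refl _) (id_tensor_id 𝕜 _ _))) (.refl _)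
  have h₂ : (Term.shuffle (n + p) (n' + p') q q' : OrdCircuit 𝕜 _ _) ≋
      Term.id n ⊠ (Term.id p ⊠ Term.sym (n' + p') q) ⊠ Term.id q' :=
    (IHPEq.cast _ _ _).trans (.tensor ((IHPEq.tensor (id_tensor_id 𝕜 _ _).symm (.refl _)).trans
      (tensor_assoc _ _ _)) (.refl _))
  have h₃ : (Term.id (n + n') ⊠ Term.shuffle p p' q q' : OrdCircuit 𝕜 _ _) ≋
      Term.id n ⊠ (Term.id (n' + p) ⊠ Term.sym p' q) ⊠ Term.id q' := by
    refine (IHPEq.tensor (id_tensor_id 𝕜 _ _).symm (IHPEq.cast _ _ _)).trans ?_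
    refine (tensor_assoc _ _ _).symm.trans (.tensor ?_ (.refl _))
    refine (tensor_middle _ _ _ _).trans ((tensor_assoc _ _ _).trans ?_)
    exact .tensor (.refl _) (.tensor (id_tensor_id 𝕜 _ _) (.refl _))
  have h₄ : (Term.shuffle n n' (p + q) (p' + q') : OrdCircuit 𝕜 _ _) ≋
      Term.id n ⊠ (Term.sym n' (p + q) ⊠ Term.id p') ⊠ Term.id q' :=
    (IHPEq.cast _ _ _).trans ((IHPEq.tensor (.refl _) (id_tensor_id 𝕜 _ _).symm).trans
      ((tensor_assoc _ _ _).symm.trans (.tensor (tensor_assoc _ _ _) (.refl _))))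
  have h (a b c d e : ℕ) (hc : b = c) (x : OrdCircuit 𝕜 a b) (y : OrdCircuit 𝕜 c d) (h' : _) :
      seq h' (Term.id n ⊠ x ⊠ Term.id e) (Term.id n ⊠ y ⊠ Term.id e) ≋
        Term.id n ⊠ seq hc x y ⊠ Term.id e :=
    ((IHPEq.tensor (id_tensor_seq _ _ _ _) (.refl _)).trans (seq_tensor_id _ _ _ _)).symm
  refine (comp_eq_seq h₁ h₂).trans ?_
  refine .trans ?_ (seq_congr h₃ h₄).symm
  refine (h _ _ _ _ _ (by omega) _ _ _).trans ?_
  refine .trans ?_ (h _ _ _ _ _ (by omega) _ _ _).symm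
  exact .tensor (.tensor (.refl _) (sym_hexagon 𝕜 n' p p' q)) (.refl _)

-- The block symmetry splits into four crossings. The last of them exchanges `n` with `m'` and is
-- undone by the shuffle that follows (`h₃`).
variable (𝕜) in
theorem sym_shuffle (n n' m m' : ℕ) :
    (Term.sym (n + n') (m + m') ;; Term.shuffle m m' n n' : OrdCircuit 𝕜 _ _) ≋
      Term.shuffle n n' m m' ;; (Term.sym n m ⊠ Term.sym n' m') := by
  have h₁ : (Term.id n ⊠ Term.sym n' (m + m') : OrdCircuit 𝕜 _ _) ≋
      seq (by omega) (Term.shuffle n n' m m') (Term.id (n + m) ⊠ Term.sym n' m') := by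
    refine (IHPEq.tensor (.refl _) (hexagon_right 𝕜 n' m m')).trans ?_
    refine (id_tensor_seq _ _ _ _).trans (seq_congr ?_ ?_)
    · exact (tensor_assoc _ _ _).symm.trans (IHPEq.cast _ _ _).symm
    · exact (tensor_assoc _ _ _).symm.trans (.tensor (id_tensor_id 𝕜 _ _) (.refl _))
  have h₂ : (Term.sym n (m + m') ⊠ Term.id n' : OrdCircuit 𝕜 _ _) ≋
      seq (by omega) (Term.sym n m ⊠ Term.id (m' + n')) (Term.id m ⊠ Term.sym n m' ⊠ Term.id n') := by
    refine (IHPEq.tensor (hexagon_right 𝕜 n m m') (.refl _)).trans ?_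
    refine (seq_tensor_id _ _ _ _).trans (seq_congr ?_ (.refl _))
    exact (tensor_assoc _ _ _).trans (.tensor (.refl _) (id_tensor_id 𝕜 _ _))
  have h₃ : seq (by omega) (Term.id m ⊠ Term.sym n m' ⊠ Term.id n') (Term.shuffle m m' n n') ≋
      (Term.id (m + (n + m') + n') : OrdCircuit 𝕜 _ _) := by
    refine (seq_eq_comp (.refl _) (.cast _ _ _)).trans ((comp_tensor_id _ _ _).symm.trans ?_)
    refine (IHPEq.tensor ((id_tensor_comp _ _ _).symm.trans ((IHPEq.tensor (.refl _)
      (sym_sym 𝕜 _ _)).trans (id_tensor_id 𝕜 _ _))) (.refl _)).trans (id_tensor_id 𝕜 _ _)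
  have h₄ : (Term.sym (n + n') (m + m') : OrdCircuit 𝕜 _ _) ≋ _ :=
    (hexagon_left 𝕜 n n' (m + m')).trans (seq_congr h₁ h₂)
  refine (comp_eq_seq h₄ (.refl _)).trans ((seq_assoc _ _ _ _ _).trans ?_)
  refine (seq_congr (.refl _) (seq_assoc _ _ _ _ _)).trans ?_
  refine (seq_congr (.refl _) (seq_congr (.refl _) h₃)).trans ?_
  refine (seq_assoc (by omega) (by omega) _ _ _).trans (seq_eq_comp (.refl _) ?_)
  refine (seq_congr (.refl _) (seq_id (by omega) _)).trans ?_
  refine (seq_congr (h := by omega) (IHPEq.refl (Term.id (n + m) ⊠ Term.sym n' m'))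
    (IHPEq.refl (Term.sym n m ⊠ Term.id (m' + n')))).trans ?_
  exact (tensor_eq_right _ _).symm

end Shuffle
end PolyCone

/-! ### Copying and discarding matrix circuits. -/

namespace PolyCone

variable {𝕜 : Type*}

namespace MatrixCircuit

def copy : MatrixCircuit 𝕜 1 2 := Term.gen FwdGen.copy
def delete : MatrixCircuit 𝕜 1 0 := Term.gen FwdGen.delete
def scalar (r : 𝕜) : MatrixCircuit 𝕜 1 1 := Term.gen (FwdGen.scalar r)
def add : MatrixCircuit 𝕜 2 1 := Term.gen FwdGen.add
def zero : MatrixCircuit 𝕜 0 1 := Term.gen FwdGen.zero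
def wire : MatrixCircuit 𝕜 1 1 := Term.id 1

/-- The copier of `n` wires. -/
def copyN : ∀ n : ℕ, MatrixCircuit 𝕜 n (n + n)
  | 0 => Term.id 0
  | n + 1 => (copyN n ⊠ copy) ;; Term.shuffle n n 1 1

/-- The discharger of `n` wires. -/
def deleteN : ∀ n : ℕ, MatrixCircuit 𝕜 n 0
  | 0 => Term.id 0
  | n + 1 => deleteN n ⊠ delete

/-- The linear form with coefficients `v`. -/
def row : ∀ n : ℕ, (Fin n → 𝕜) → MatrixCircuit 𝕜 n 1
  | 0, _ => zero
  | n + 1, v => (row n (fun i => v i.castSucc) ⊠ scalar (v (Fin.last n))) ;; add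

variable [Field 𝕜]

/-- The pullback of a linear form along the linear map denoted by a matrix circuit. -/
def pull : ∀ {n m : ℕ}, MatrixCircuit 𝕜 n m → (Fin m → 𝕜) → Fin n → 𝕜
  | _, _, Term.gen FwdGen.copy, v => fun _ => v 0 + v 1
  | _, _, Term.gen FwdGen.delete, _ => fun _ => 0
  | _, _, Term.gen (FwdGen.scalar r), v => fun _ => r * v 0
  | _, _, Term.gen FwdGen.add, v => fun _ => v 0
  | _, _, Term.gen FwdGen.zero, _ => Fin.elim0
  | _, _, Term.id _, v => v
  | _, _, Term.sym n m, v => Fin.addCases (fun i => v (Fin.natAdd m i)) fun j => v (Fin.castAdd n j)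
  | _, _, Term.comp a b, v => pull a (pull b v)
  | _, _, Term.tensor (m := m) (q := q) a b, v =>
    Fin.addCases (pull a fun i => v (Fin.castAdd q i)) (pull b fun j => v (Fin.natAdd m j))

end MatrixCircuit

namespace OrdCircuit

def zero : OrdCircuit 𝕜 0 1 := Circuit.toOrd Circuit.zero
def coScalar (r : 𝕜) : OrdCircuit 𝕜 1 1 := Circuit.toOrd (Circuit.coScalar r)
def copyN (n : ℕ) : OrdCircuit 𝕜 n (n + n) := (MatrixCircuit.copyN n).toOrd
def deleteN (n : ℕ) : OrdCircuit 𝕜 n 0 := (MatrixCircuit.deleteN n).toOrd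
def row (n : ℕ) (v : Fin n → 𝕜) : OrdCircuit 𝕜 n 1 := (MatrixCircuit.row n v).toOrd

end OrdCircuit

open OrdCircuit

variable [Field 𝕜] [LinearOrder 𝕜]

theorem ih_eq {n m : ℕ} {a b : Circuit 𝕜 n m} (h : IHEquation a b) : a.toOrd ≋ b.toOrd :=
  ⟨.ax (.ih h), .ax (.ih_symm h)⟩

theorem ih_op_eq {n m : ℕ} {a b : Circuit 𝕜 n m} (h : IHEquation a b) :
    a.op.toOrd ≋ b.op.toOrd :=
  ⟨.ax (.ih_op h), .ax (.ih_op_symm h)⟩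

theorem ord_eq {n m : ℕ} {a b : OrdCircuit 𝕜 n m} (h : OrdEquation a b) : a ≋ b :=
  ⟨.ax (.eq h), .ax (.eq_symm h)⟩

theorem ord_le {n m : ℕ} {a b : OrdCircuit 𝕜 n m} (h : OrdInequality a b) : a ≼ b :=
  .ax (.le h)

section MatrixLaws

variable (𝕜) in
theorem copyN_succ (n : ℕ) :
    (copyN (n + 1) : OrdCircuit 𝕜 _ _) ≋ (copyN n ⊠ copy) ;; Term.shuffle n n 1 1 := by
  refine .comp (.refl _) (.of_eq ?_)
  change Term.map _ (Term.map _ (Term.cast _ _ _)) = Term.cast _ _ _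
  rw [Term.map_cast, Term.map_cast]; rfl

variable (𝕜) in
theorem shuffle_unit (n p p' : ℕ) :
    (Term.shuffle n 0 p p' : OrdCircuit 𝕜 _ _) ≋ Term.id (n + p + p') :=
  (IHPEq.cast _ _ _).trans ((IHPEq.tensor ((IHPEq.tensor (.refl _) (sym_zero_left 𝕜 p)).trans
    (id_tensor_id 𝕜 _ _)) (.refl _)).trans (id_tensor_id 𝕜 _ _))

variable (𝕜) in
theorem shuffle_unit' (n n' p' : ℕ) :
    (Term.shuffle n n' 0 p' : OrdCircuit 𝕜 _ _) ≋ Term.id (n + n' + p') :=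
  (IHPEq.cast _ _ _).trans ((IHPEq.tensor ((IHPEq.tensor (.refl _) (sym_zero_right 𝕜 n')).trans
    (id_tensor_id 𝕜 _ _)) (.refl _)).trans (id_tensor_id 𝕜 _ _))

variable (𝕜) in
theorem shuffle_one : (Term.shuffle 1 1 1 1 : OrdCircuit 𝕜 _ _) ≋ midSwap := .refl _

variable (𝕜) in
theorem copyN_add (n p : ℕ) : (copyN (n + p) : OrdCircuit 𝕜 _ _) ≋
    (copyN n ⊠ copyN p) ;; Term.shuffle n n p p := by
  induction p with
  | zero =>
    refine .symm (IHPEq.trans (.comp (b' := Term.id (n + n)) (tensor_unit _) ?_) (comp_id _))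
    exact (shuffle_unit' 𝕜 n n 0)
  | succ p ih =>
    refine (copyN_succ 𝕜 (n + p)).trans ?_
    refine (IHPEq.comp ((IHPEq.tensor ih (comp_id copy).symm).trans (interchange _ _ _ _).symm)
      (.refl _)).trans ((comp_assoc _ _ _).trans ?_)
    refine (comp_eq_seq (tensor_assoc _ _ _) (shuffle_shuffle 𝕜 n n p p 1 1)).trans ?_
    refine (seq_assoc (by omega) (by omega) _ _ _).symm.trans ?_
    refine seq_eq_comp ?_ (.refl _)
    refine (interchange _ _ _ _).trans (.tensor (comp_id _) ?_)
    exact (copyN_succ 𝕜 p).symm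

variable (𝕜) in
theorem copyN_one : (copyN 1 : OrdCircuit 𝕜 1 2) ≋ (copy : OrdCircuit 𝕜 1 2) := 
  (copyN_succ 𝕜 0).trans ((IHPEq.comp (unit_tensor _) (shuffle_unit 𝕜 0 1 1)).trans (comp_id _))

variable (𝕜) in
theorem copyN_two : (copyN 2 : OrdCircuit 𝕜 2 4) ≋ ((copy ⊠ copy) ;; midSwap : OrdCircuit 𝕜 2 4) :=
  (copyN_succ 𝕜 1).trans (.comp (.tensor (copyN_one 𝕜) (.refl _)) (shuffle_one 𝕜))

variable (𝕜) in
theorem deleteN_one : (deleteN 1 : OrdCircuit 𝕜 1 0) ≋ (delete : OrdCircuit 𝕜 1 0) :=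
  unit_tensor _

variable (𝕜) in
theorem deleteN_two : (deleteN 2 : OrdCircuit 𝕜 2 0) ≋ (delete ⊠ delete : OrdCircuit 𝕜 2 0) :=
  .tensor (deleteN_one 𝕜) (.refl _)

variable (𝕜) in
theorem deleteN_add (n p : ℕ) :
    (deleteN (n + p) : OrdCircuit 𝕜 _ _) ≋ (deleteN n ⊠ deleteN p : OrdCircuit 𝕜 _ _) := by
  induction p with
  | zero => exact (tensor_unit _).symm
  | succ p ih => exact (IHPEq.tensor ih (.refl _)).trans (tensor_assoc _ _ _)

-- By coassociativity the two middle copies can be taken from a single copier, where cocommutativity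
-- absorbs the swap.
variable (𝕜) in
theorem copy_copy : (copy ;; (copy ⊠ copy) ;; midSwap : OrdCircuit 𝕜 1 4) ≋
    (copy ;; (copy ⊠ copy) : OrdCircuit 𝕜 1 4) := by
  have h : (copy ;; (copy ⊠ copy) : OrdCircuit 𝕜 1 4) ≋
      copy ;; (wire ⊠ copy :) ;; (wire ⊠ copy ⊠ wire :) := by
    calc (copy ;; (copy ⊠ copy) : OrdCircuit 𝕜 1 4)
        ≋ (copy ;; (copy ⊠ wire)) ;; (wire ⊠ wire ⊠ copy :) := .of_normalize rfl
      _ ≋ (copy ;; (wire ⊠ copy)) ;; (wire ⊠ wire ⊠ copy :) :=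
        .comp (ih_eq .copy_assoc) (.refl _)
      _ ≋ copy ;; (wire ⊠ (copy ;; (wire ⊠ copy) :)) := .of_normalize rfl
      _ ≋ copy ;; (wire ⊠ (copy ;; (copy ⊠ wire) :)) :=
        .comp (.refl _) (.tensor (.refl _) (ih_eq .copy_assoc).symm)
      _ ≋ copy ;; (wire ⊠ copy :) ;; (wire ⊠ copy ⊠ wire :) := .of_normalize rfl
  calc (copy ;; (copy ⊠ copy) ;; midSwap : OrdCircuit 𝕜 1 4)
      ≋ (copy ;; (copy ⊠ copy) : OrdCircuit 𝕜 1 4) ;; midSwap := (comp_assoc _ _ _).symm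
    _ ≋ (copy ;; (wire ⊠ copy :) ;; (wire ⊠ copy ⊠ wire :) : OrdCircuit 𝕜 1 4) ;; midSwap :=
      .comp h (.refl _)
    _ ≋ (copy ;; (wire ⊠ copy :) ;; (wire ⊠ (copy ;; Term.sym 1 1 :) ⊠ wire :)) := .of_normalize rfl
    _ ≋ (copy ;; (wire ⊠ copy :) ;; (wire ⊠ copy ⊠ wire :)) :=
      .comp (.refl _) (.comp (.refl _) (.tensor (.tensor (.refl _) (ih_eq .copy_comm)) (.refl _)))
    _ ≋ _ := h.symm

variable (𝕜) in
theorem copy_delete_left : (copy ;; (delete ⊠ wire :) : OrdCircuit 𝕜 1 1) ≋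
    (wire : OrdCircuit 𝕜 1 1) := ih_eq .copy_unit

variable (𝕜) in
theorem copy_delete_right : (copy ;; (wire ⊠ delete :) : OrdCircuit 𝕜 1 1) ≋
    (wire : OrdCircuit 𝕜 1 1) :=
  calc (copy ;; (wire ⊠ delete :) : OrdCircuit 𝕜 1 1)
      ≋ (copy ;; Term.sym 1 1 :) ;; (wire ⊠ delete :) := .comp (ih_eq .copy_comm).symm (.refl _)
    _ ≋ copy ;; (Term.sym 1 1 ;; (wire ⊠ delete :)) := comp_assoc _ _ _
    _ ≋ copy ;; ((delete ⊠ wire :) ;; Term.sym 0 1) :=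
      .comp (.refl _) (sym_natural delete wire).symm
    _ ≋ copy ;; ((delete ⊠ wire :) ;; wire) :=
      .comp (.refl _) (.comp (.refl _) (sym_zero_left 𝕜 1))
    _ ≋ copy ;; (delete ⊠ wire :) := .comp (.refl _) (comp_id _)
    _ ≋ wire := copy_delete_left 𝕜

/-- Together with `deleteN_natural` this makes matrix circuits cartesian, so a circuit is determined
by its separate outputs. For generators it is an axiom or a consequence of the comonoid laws;
composite circuits reduce to the block symmetries above. -/
theorem copyN_natural {n m : ℕ} (A : MatrixCircuit 𝕜 n m) :
    A.toOrd ;; copyN m ≋ copyN n ;; (A.toOrd ⊠ A.toOrd) := by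
  induction A with
  | gen g =>
    cases g with
    | copy =>
      refine (IHPEq.comp (.refl copy) (copyN_two 𝕜)).trans ?_
      exact (copy_copy 𝕜).trans (.comp (copyN_one 𝕜).symm (.refl _))
    | delete =>
      refine IHPEq.trans (b := (delete : OrdCircuit 𝕜 1 0)) (comp_id _) ?_
      refine .trans ?_ (IHPEq.comp (copyN_one 𝕜).symm (.refl (delete ⊠ delete)))
      calc (delete : OrdCircuit 𝕜 1 0) ≋ wire ;; delete := (id_comp _).symm
        _ ≋ (copy ;; (delete ⊠ wire :)) ;; delete := .comp (copy_delete_left 𝕜).symm (.refl _)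
        _ ≋ copy ;; (delete ⊠ delete :) := .of_normalize rfl
    | scalar r =>
      exact (IHPEq.comp (.refl _) (copyN_one 𝕜)).trans ((ih_eq (.scalar_copy r)).trans
        (.comp (copyN_one 𝕜).symm (.refl _)))
    | add =>
      refine (IHPEq.comp (.refl _) (copyN_one 𝕜)).trans ((ih_eq .bimonoid).trans ?_)
      exact (comp_assoc _ _ _).symm.trans (.comp (copyN_two 𝕜).symm (.refl _))
    | zero =>
      exact (IHPEq.comp (.refl _) (copyN_one 𝕜)).trans ((ih_eq .bimonoid_unit).trans
        (id_comp _).symm)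
  | id n => exact (id_comp _).trans ((comp_id _).symm.trans (.comp (.refl _) (id_tensor_id 𝕜 n n).symm))
  | sym n m =>
    calc (Term.sym n m ;; copyN (m + n) : OrdCircuit 𝕜 _ _)
        ≋ Term.sym n m ;; (copyN m ⊠ copyN n) ;; Term.shuffle m m n n :=
          .comp (.refl _) (copyN_add 𝕜 m n)
      _ ≋ ((copyN n ⊠ copyN m) ;; Term.sym (n + n) (m + m)) ;; Term.shuffle m m n n :=
          (comp_assoc _ _ _).symm.trans (.comp (sym_natural _ _).symm (.refl _))
      _ ≋ (copyN n ⊠ copyN m) ;; (Term.shuffle n n m m ;; (Term.sym n m ⊠ Term.sym n m)) :=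
          (comp_assoc _ _ _).trans (.comp (.refl _) (sym_shuffle 𝕜 n n m m))
      _ ≋ copyN (n + m) ;; (Term.sym n m ⊠ Term.sym n m) :=
          (comp_assoc _ _ _).symm.trans (.comp (copyN_add 𝕜 n m).symm (.refl _))
  | comp a b iha ihb =>
    refine (comp_assoc (MatrixCircuit.toOrd a) (MatrixCircuit.toOrd b) _).trans ((IHPEq.comp (.refl _) ihb).trans ?_)
    refine (comp_assoc _ _ _).symm.trans ((IHPEq.comp iha (.refl _)).trans ?_)
    exact (comp_assoc _ _ _).trans (.comp (.refl _) (interchange _ _ _ _))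
  | @tensor n m p q a b iha ihb =>
    calc ((MatrixCircuit.toOrd a) ⊠ (MatrixCircuit.toOrd b)) ;; copyN (m + q)
        ≋ (((MatrixCircuit.toOrd a) ⊠ (MatrixCircuit.toOrd b)) ;; (copyN m ⊠ copyN q)) ;; Term.shuffle m m q q :=
          (IHPEq.comp (.refl _) (copyN_add 𝕜 m q)).trans (comp_assoc _ _ _).symm
      _ ≋ ((copyN n ⊠ copyN p) ;; (((MatrixCircuit.toOrd a) ⊠ (MatrixCircuit.toOrd a)) ⊠ ((MatrixCircuit.toOrd b) ⊠ (MatrixCircuit.toOrd b)))) ;;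
            Term.shuffle m m q q :=
          .comp ((interchange _ _ _ _).trans ((IHPEq.tensor iha ihb).trans
            (interchange _ _ _ _).symm)) (.refl _)
      _ ≋ (copyN n ⊠ copyN p) ;; (Term.shuffle n n p p ;;
            (((MatrixCircuit.toOrd a) ⊠ (MatrixCircuit.toOrd b)) ⊠ ((MatrixCircuit.toOrd a) ⊠ (MatrixCircuit.toOrd b)))) :=
          (comp_assoc _ _ _).trans (.comp (.refl _) (shuffle_natural _ _ _ _))
      _ ≋ copyN (n + p) ;; (((MatrixCircuit.toOrd a) ⊠ (MatrixCircuit.toOrd b)) ⊠ ((MatrixCircuit.toOrd a) ⊠ (MatrixCircuit.toOrd b))) :=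
          (comp_assoc _ _ _).symm.trans (.comp (copyN_add 𝕜 n p).symm (.refl _))

theorem deleteN_natural {n m : ℕ} (A : MatrixCircuit 𝕜 n m) :
    A.toOrd ;; deleteN m ≋ (deleteN n : OrdCircuit 𝕜 n 0) := by
  induction A with
  | gen g =>
    cases g with
    | copy =>
      refine (IHPEq.comp (.refl copy) (deleteN_two 𝕜)).trans (.trans ?_ (deleteN_one 𝕜).symm)
      calc (copy ;; (delete ⊠ delete :) : OrdCircuit 𝕜 1 0)
          ≋ (copy ;; (delete ⊠ wire :)) ;; delete := .of_normalize rfl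
        _ ≋ wire ;; delete := .comp (copy_delete_left 𝕜) (.refl _)
        _ ≋ delete := id_comp _
    | delete => exact (comp_id _).trans (deleteN_one 𝕜).symm
    | scalar r =>
      exact (IHPEq.comp (.refl _) (deleteN_one 𝕜)).trans ((ih_eq (.scalar_delete r)).trans
        (deleteN_one 𝕜).symm)
    | add =>
      exact (IHPEq.comp (.refl _) (deleteN_one 𝕜)).trans ((ih_eq .bimonoid_counit).trans
        (deleteN_two 𝕜).symm)
    | zero => exact (IHPEq.comp (.refl _) (deleteN_one 𝕜)).trans (ih_eq .bone)
  | id n => exact id_comp _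
  | sym n m =>
    refine (IHPEq.comp (.refl _) (deleteN_add 𝕜 m n)).trans ((sym_natural _ _).symm.trans ?_)
    exact (IHPEq.comp (.refl _) (sym_zero_left 𝕜 0)).trans ((comp_id _).trans
      (deleteN_add 𝕜 n m).symm)
  | comp a b iha ihb =>
    exact (comp_assoc (MatrixCircuit.toOrd a) (MatrixCircuit.toOrd b) _).trans ((IHPEq.comp (.refl _) ihb).trans iha)
  | @tensor n m p q a b iha ihb =>
    exact (IHPEq.comp (.refl _) (deleteN_add 𝕜 m q)).trans ((interchange _ _ _ _).trans
      ((IHPEq.tensor iha ihb).trans (deleteN_add 𝕜 n p).symm))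

variable (𝕜) in
theorem copyN_deleteN_right (n : ℕ) : copyN n ;; (Term.id n ⊠ deleteN n) ≋
    (Term.id n : OrdCircuit 𝕜 n n) := by
  induction n with
  | zero => exact (id_comp _).trans (unit_tensor _)
  | succ n ih =>
    calc (copyN (n + 1) ;; (Term.id (n + 1) ⊠ deleteN (n + 1)) : OrdCircuit 𝕜 _ _)
        ≋ ((copyN n ⊠ copy) ;; Term.shuffle n n 1 1) ;;
            ((Term.id n ⊠ wire) ⊠ (deleteN n ⊠ delete)) :=
          .comp (copyN_succ 𝕜 n) (.tensor (id_tensor_id 𝕜 n 1).symm (.refl _))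
      _ ≋ (copyN n ⊠ copy) ;; (((Term.id n ⊠ deleteN n) ⊠ (wire ⊠ delete)) ;;
            Term.shuffle n 0 1 0) :=
          (comp_assoc _ _ _).trans (.comp (.refl _) (shuffle_natural _ _ _ _).symm)
      _ ≋ (copyN n ⊠ copy) ;; ((Term.id n ⊠ deleteN n) ⊠ (wire ⊠ delete)) :=
          .comp (.refl _) ((IHPEq.comp (.refl _) (shuffle_unit 𝕜 n 1 0)).trans (comp_id _))
      _ ≋ Term.id n ⊠ wire :=
          (interchange _ _ _ _).trans (.tensor ih (copy_delete_right 𝕜))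
      _ ≋ Term.id (n + 1) := id_tensor_id 𝕜 n 1

variable (𝕜) in
/-- The copier followed by the projections to the first wires and to the last wire. -/
theorem copyN_projections (n : ℕ) :
    copyN (n + 1) ;; ((Term.id n ⊠ delete) ⊠ (deleteN n ⊠ wire)) ≋
      (Term.id (n + 1) : OrdCircuit 𝕜 _ _) :=
  calc copyN (n + 1) ;; ((Term.id n ⊠ delete) ⊠ (deleteN n ⊠ wire))
      ≋ ((copyN n ⊠ copy) ;; Term.shuffle n n 1 1) ;;
          ((Term.id n ⊠ delete) ⊠ (deleteN n ⊠ wire)) := .comp (copyN_succ 𝕜 n) (.refl _)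
    _ ≋ (copyN n ⊠ copy) ;; (((Term.id n ⊠ deleteN n) ⊠ (delete ⊠ wire)) ;;
          Term.shuffle n 0 0 1) :=
        (comp_assoc _ _ _).trans (.comp (.refl _) (shuffle_natural _ _ _ _).symm)
    _ ≋ (copyN n ⊠ copy) ;; ((Term.id n ⊠ deleteN n) ⊠ (delete ⊠ wire)) :=
        .comp (.refl _) ((IHPEq.comp (.refl _) (shuffle_unit 𝕜 n 0 1)).trans (comp_id _))
    _ ≋ Term.id n ⊠ wire :=
        (interchange _ _ _ _).trans (.tensor (copyN_deleteN_right 𝕜 n) (copy_delete_left 𝕜))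
    _ ≋ Term.id (n + 1) := id_tensor_id 𝕜 n 1

end MatrixLaws
end PolyCone

/-! ### Completeness for matrix circuits. -/

namespace PolyCone

open OrdCircuit

variable {𝕜 : Type*} [Field 𝕜]

namespace MatrixCircuit

theorem pull_cast {n m n' m' : ℕ} (hn : n = n') (hm : m = m') (A : MatrixCircuit 𝕜 n m)
    (v : Fin m' → 𝕜) (i : Fin n') :
    pull (Term.cast hn hm A) v i = pull A (fun j => v (j.cast hm)) (i.cast hn.symm) := by
  subst hn hm; rfl

theorem pull_shuffle (n : ℕ) (v : Fin ((n + 1) + (n + 1)) → 𝕜) :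
    pull (Term.shuffle n n 1 1) v = Fin.addCases
      (Fin.addCases (fun i => v (Fin.castAdd (n + 1) i.castSucc))
        (fun i => v (Fin.natAdd (n + 1) i.castSucc)))
      ![v (Fin.castAdd (n + 1) (Fin.last n)), v (Fin.natAdd (n + 1) (Fin.last n))] := by
  funext i
  rw [Term.shuffle, pull_cast]
  refine Fin.addCases (fun i => ?_) (fun i => ?_) i
  · rw [Fin.addCases_left]
    refine Fin.addCases (fun i => ?_) (fun i => ?_) i
    · rw [Fin.addCases_left]
      -- The same wire is named in the bracketing `(n + (n + 1)) + 1` in which the shuffle was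
      -- defined before its cast, so that `pull` can compute.
      have : Fin.cast (by omega) (Fin.castAdd (1 + 1) (Fin.castAdd n i)) =
        Fin.castAdd 1 (Fin.castAdd (n + 1) i) := rfl
      rw [this]
      simp only [pull, Fin.addCases_left]
      rfl
    · rw [Fin.addCases_right]
      have : Fin.cast (by omega) (Fin.castAdd (1 + 1) (Fin.natAdd n i)) =
        Fin.castAdd 1 (Fin.natAdd n (Fin.castAdd 1 i)) := rfl
      rw [this]
      simp only [pull, Fin.addCases_left, Fin.addCases_right]
      congr 1
      ext; simp; omega
  · rw [Fin.addCases_right]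
    fin_cases i
    · have : Fin.cast (by omega) (Fin.natAdd (n + n) (0 : Fin 2)) =
        Fin.castAdd 1 (Fin.natAdd n (Fin.natAdd n (0 : Fin 1))) := by ext; simp
      simp only [Fin.zero_eta, this]
      simp only [pull, Fin.addCases_left, Fin.addCases_right]
      simp
      congr 1
    · have : Fin.cast (by omega) (Fin.natAdd (n + n) (1 : Fin 2)) =
        Fin.natAdd (n + (n + 1)) (0 : Fin 1) := by ext; simp; omega
      simp only [Fin.mk_one, this]
      simp only [pull, Fin.addCases_right]
      simp
      congr 1

theorem pull_copyN (n : ℕ) (v : Fin (n + n) → 𝕜) :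
    pull (copyN n) v = fun i => v (Fin.castAdd n i) + v (Fin.natAdd n i) := by
  induction n with
  | zero => funext i; exact i.elim0
  | succ n ih =>
    funext i
    change pull (copyN n ⊠ copy) (pull (Term.shuffle n n 1 1) v) i = _
    rw [pull, ih, pull_shuffle]
    refine Fin.addCases (fun i => ?_) (fun i => ?_) i
    · simp only [Fin.addCases_left, Fin.addCases_right]; rfl
    · obtain rfl : i = 0 := Subsingleton.elim _ _
      simp only [copy, pull, Fin.addCases_right]; rfl

theorem pull_deleteN (n : ℕ) (v : Fin 0 → 𝕜) : pull (deleteN n) v = 0 := by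
  induction n generalizing v with
  | zero => funext i; exact i.elim0
  | succ n ih =>
    funext i
    change pull (deleteN n ⊠ delete) v i = _
    rw [pull, ih]
    refine Fin.addCases (fun i => ?_) (fun i => ?_) i <;> simp [delete, pull]

theorem pull_row (n : ℕ) (v : Fin n → 𝕜) (w : Fin 1 → 𝕜) :
    pull (row n v) w = w 0 • v := by
  induction n generalizing w with
  | zero => funext i; exact i.elim0
  | succ n ih =>
    funext i
    change pull (row n (fun i => v i.castSucc) ⊠ scalar (v (Fin.last n))) (pull add w) i = _
    rw [pull, ih]
    refine Fin.addCases (fun i => ?_) (fun i => ?_) i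
    · simp only [Fin.addCases_left]; rfl
    · obtain rfl : i = 0 := Subsingleton.elim _ _
      simp only [Fin.addCases_right]; exact mul_comm _ _

end MatrixCircuit

open MatrixCircuit (pull)

variable [LinearOrder 𝕜]

section Complete

variable (𝕜) in
theorem sym_add : (Term.sym 1 1 ;; add : OrdCircuit 𝕜 2 1) ≋ (add : OrdCircuit 𝕜 2 1) :=
  ih_eq .add_comm

variable (𝕜) in
theorem zero_add_left : ((zero ⊠ wire :) ;; add : OrdCircuit 𝕜 1 1) ≋ (wire : OrdCircuit 𝕜 1 1) :=
  ih_eq .add_unit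

variable (𝕜) in
theorem zero_add_right :
    ((wire ⊠ zero :) ;; add : OrdCircuit 𝕜 1 1) ≋ (wire : OrdCircuit 𝕜 1 1) :=
  calc ((wire ⊠ zero :) ;; add : OrdCircuit 𝕜 1 1)
      ≋ (wire ⊠ zero :) ;; (Term.sym 1 1 ;; add) := .comp (.refl _) (sym_add 𝕜).symm
    _ ≋ ((wire ⊠ zero :) ;; Term.sym 1 1) ;; add := (comp_assoc _ _ _).symm
    _ ≋ (Term.sym 1 0 ;; (zero ⊠ wire :)) ;; add :=
      .comp (sym_natural wire zero) (.refl _)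
    _ ≋ (wire ;; (zero ⊠ wire :)) ;; add :=
      .comp (.comp (sym_zero_right 𝕜 1) (.refl _)) (.refl _)
    _ ≋ (zero ⊠ wire :) ;; add := .comp (id_comp _) (.refl _)
    _ ≋ wire := zero_add_left 𝕜

theorem scalar_mul (r s : 𝕜) :
    (scalar r ;; scalar s : OrdCircuit 𝕜 1 1) ≋ (scalar (r * s) : OrdCircuit 𝕜 1 1) :=
  ih_eq (.mul r s)

theorem scalar_coScalar {r : 𝕜} (hr : r ≠ 0) :
    (scalar r ;; coScalar r : OrdCircuit 𝕜 1 1) ≋ (wire : OrdCircuit 𝕜 1 1) :=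
  ih_eq (.scalar_inv r hr)

theorem copy_scalar_add (r s : 𝕜) :
    (copy ;; (scalar r ⊠ scalar s :) ;; add : OrdCircuit 𝕜 1 1) ≋
      (scalar (r + s) : OrdCircuit 𝕜 1 1) :=
  ih_eq (.sum r s)

variable (𝕜) in
theorem scalar_zero : (scalar 0 : OrdCircuit 𝕜 1 1) ≋ (delete ;; zero : OrdCircuit 𝕜 1 1) :=
  ih_eq .zero_scalar

theorem add_scalar (r : 𝕜) : (add ;; scalar r : OrdCircuit 𝕜 2 1) ≋
    ((scalar r ⊠ scalar r :) ;; add : OrdCircuit 𝕜 2 1) :=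
  ih_eq (.scalar_add r)

theorem zero_scalar (r : 𝕜) : (zero ;; scalar r : OrdCircuit 𝕜 0 1) ≋ (zero : OrdCircuit 𝕜 0 1) :=
  (ih_eq (.scalar_zero r)).symm

variable (𝕜) in
theorem scalar_one : (scalar 1 : OrdCircuit 𝕜 1 1) ≋ (wire : OrdCircuit 𝕜 1 1) :=
  calc (scalar 1 : OrdCircuit 𝕜 1 1) ≋ scalar 1 ;; wire := (comp_id _).symm
    _ ≋ scalar 1 ;; (scalar 1 ;; coScalar 1) :=
      .comp (.refl _) (scalar_coScalar one_ne_zero).symm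
    _ ≋ (scalar 1 ;; scalar 1) ;; coScalar 1 := (comp_assoc _ _ _).symm
    _ ≋ scalar (1 * 1) ;; coScalar 1 := .comp (scalar_mul 1 1) (.refl _)
    _ ≋ scalar 1 ;; coScalar 1 := .of_eq (by rw [mul_one])
    _ ≋ wire := scalar_coScalar one_ne_zero

theorem add_assoc_terms {n m p : ℕ} (x : OrdCircuit 𝕜 n 1) (y : OrdCircuit 𝕜 m 1)
    (z : OrdCircuit 𝕜 p 1) : (((x ⊠ y) ;; add) ⊠ z) ;; add ≋ (x ⊠ ((y ⊠ z) ;; add)) ;; add :=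
  calc (((x ⊠ y) ;; add) ⊠ z) ;; add
      ≋ (((x ⊠ y) ⊠ z) ;; (add ⊠ wire)) ;; add :=
        .comp ((IHPEq.tensor (.refl _) (comp_id z).symm).trans (interchange _ _ _ _).symm) (.refl _)
    _ ≋ ((x ⊠ y) ⊠ z) ;; ((add ⊠ wire) ;; add) := comp_assoc _ _ _
    _ ≋ (x ⊠ (y ⊠ z)) ;; ((wire ⊠ add :) ;; add) :=
        .comp (tensor_assoc _ _ _) (ih_eq .add_assoc)
    _ ≋ ((x ⊠ (y ⊠ z)) ;; (wire ⊠ add :)) ;; add := (comp_assoc _ _ _).symm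
    _ ≋ (x ⊠ ((y ⊠ z) ;; add)) ;; add :=
        .comp ((interchange _ _ _ _).trans (.tensor (comp_id _) (.refl _))) (.refl _)

theorem row_succ (n : ℕ) (v : Fin (n + 1) → 𝕜) : row (n + 1) v ≋
    (row n (fun i => v i.castSucc) ⊠ scalar (v (Fin.last n)) :) ;; add := .refl _

theorem row_one (v : Fin 1 → 𝕜) : row 1 v ≋ scalar (v 0) :=
  calc row 1 v ≋ (zero ⊠ scalar (v 0) : OrdCircuit 𝕜 1 2) ;; add := .refl _
    _ ≋ scalar (v 0) ;; ((zero ⊠ wire :) ;; add) := .of_normalize rfl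
    _ ≋ scalar (v 0) := (IHPEq.comp (.refl _) (zero_add_left 𝕜)).trans (comp_id _)

theorem row_add (n p : ℕ) (v : Fin (n + p) → 𝕜) : row (n + p) v ≋
    (row n (fun i => v (Fin.castAdd p i)) ⊠ row p (fun i => v (Fin.natAdd n i)) :) ;; add := by
  induction p with
  | zero =>
    calc row n v ≋ row n v ;; ((wire ⊠ zero :) ;; add) :=
          ((IHPEq.comp (.refl _) (zero_add_right 𝕜)).trans (comp_id _)).symm
      _ ≋ ((row n v ⊠ Term.id 0) ;; (wire ⊠ zero)) ;; add :=
          (comp_assoc _ _ _).symm.trans (.comp (.comp (tensor_unit _).symm (.refl _)) (.refl _))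
      _ ≋ (row n v ⊠ zero) ;; add :=
          .comp ((interchange _ _ _ _).trans (.tensor (comp_id _) (id_comp _))) (.refl _)
  | succ p ih =>
    refine (row_succ (n + p) v).trans ((IHPEq.comp (.tensor (ih _) (.refl _)) (.refl _)).trans ?_)
    exact add_assoc_terms _ _ _

/-- Rows are the normal forms of circuits with one output. Each generator is absorbed into a row by
exactly one scalar law, up to trivial zeros. -/
theorem comp_row {n m : ℕ} (A : MatrixCircuit 𝕜 n m) (v : Fin m → 𝕜) :
    A.toOrd ;; row m v ≋ row n (pull A v) := by
  induction A with
  | gen g =>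
    cases g with
    | copy =>
      refine .trans ?_ (row_one _).symm
      refine (IHPEq.comp (.refl copy) (IHPEq.trans (row_succ 1 v) (.comp (.tensor (row_one _)
        (.refl _)) (.refl _)))).trans ?_
      exact copy_scalar_add _ _
    | delete =>
      refine .trans ?_ (row_one _).symm
      exact (scalar_zero 𝕜).symm
    | scalar r =>
      refine (IHPEq.comp (.refl (scalar r)) (row_one _)).trans (.trans ?_ (row_one _).symm)
      exact scalar_mul _ _
    | add =>
      refine (IHPEq.comp (.refl add) (row_one _)).trans (.trans (add_scalar _) ?_)
      exact .symm (IHPEq.trans (row_succ 1 _) (.comp (.tensor (row_one _) (.refl _)) (.refl _)))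
    | zero =>
      exact (IHPEq.comp (.refl zero) (row_one _)).trans (zero_scalar _)
  | id n => exact id_comp _
  | sym n m =>
    refine (IHPEq.comp (.refl _) (row_add m n v)).trans (.trans ?_ (row_add n m _).symm)
    refine (comp_assoc _ _ _).symm.trans ((IHPEq.comp (sym_natural _ _).symm (.refl _)).trans ?_)
    refine (comp_assoc _ _ _).trans (.comp (.of_eq ?_) (sym_add 𝕜))
    simp only [pull, Fin.addCases_left, Fin.addCases_right]
  | comp a b iha ihb =>
    exact (comp_assoc _ _ _).trans ((IHPEq.comp (.refl _) (ihb v)).trans (iha _))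
  | @tensor n m p q a b iha ihb =>
    refine (IHPEq.comp (.refl _) (row_add m q v)).trans (.trans ?_ (row_add n p _).symm)
    refine (comp_assoc _ _ _).symm.trans (.comp ((interchange _ _ _ _).trans
      ((IHPEq.tensor (iha _) (ihb _)).trans (.of_eq ?_))) (.refl _))
    simp only [pull, Fin.addCases_left, Fin.addCases_right]

theorem eq_pair {n m : ℕ} (A : MatrixCircuit 𝕜 n (m + 1)) :
    A.toOrd ≋ copyN n ;; ((A.toOrd ;; (Term.id m ⊠ delete)) ⊠ (A.toOrd ;; (deleteN m ⊠ wire))) :=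
  calc A.toOrd ≋ A.toOrd ;; (copyN (m + 1) ;; ((Term.id m ⊠ delete) ⊠ (deleteN m ⊠ wire))) :=
        ((IHPEq.comp (.refl _) (copyN_projections 𝕜 m)).trans (comp_id _)).symm
    _ ≋ (copyN n ;; (A.toOrd ⊠ A.toOrd)) ;; ((Term.id m ⊠ delete) ⊠ (deleteN m ⊠ wire)) :=
        (comp_assoc _ _ _).symm.trans (.comp (copyN_natural A) (.refl _))
    _ ≋ _ := (comp_assoc _ _ _).trans (.comp (.refl _) (interchange _ _ _ _))

/-- A wire is itself the row with coefficient one, so `comp_row` applies after composing with it. -/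
theorem toOrd_eq_row {n : ℕ} (A : MatrixCircuit 𝕜 n 1) : A.toOrd ≋ row n (pull A 1) :=
  calc A.toOrd ≋ A.toOrd ;; wire := (comp_id _).symm
    _ ≋ A.toOrd ;; row 1 1 := .comp (.refl _) ((row_one 1).trans (scalar_one 𝕜)).symm
    _ ≋ row n (pull A 1) := comp_row A 1

/-- Completeness of the theory for matrix circuits: circuits denoting the same matrix are equal. -/
theorem toOrd_eq_of_pull {n m : ℕ} {A B : MatrixCircuit 𝕜 n m} (h : ∀ v, pull A v = pull B v) :
    A.toOrd ≋ B.toOrd := by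
  induction m with
  | zero =>
    have h (C : MatrixCircuit 𝕜 n 0) : C.toOrd ≋ (deleteN n : OrdCircuit 𝕜 n 0) :=
      (comp_id _).symm.trans (deleteN_natural C)
    exact (h A).trans (h B).symm
  | succ m ih =>
    -- The first `m` outputs are handled by induction, the last one by its row normal form.
    refine (eq_pair A).trans (.trans (.comp (.refl _) (.tensor ?_ ?_)) (eq_pair B).symm)
    · exact ih (A := A ;; (Term.id m ⊠ MatrixCircuit.delete))
        (B := B ;; (Term.id m ⊠ MatrixCircuit.delete)) fun v => h _
    · refine (toOrd_eq_row (A ;; (MatrixCircuit.deleteN m ⊠ MatrixCircuit.wire :))).trans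
        (.trans (.of_eq ?_)
          (toOrd_eq_row (B ;; (MatrixCircuit.deleteN m ⊠ MatrixCircuit.wire :))).symm)
      exact congrArg _ (h _)

end Complete
end PolyCone

/-! ### Equality, order and positivity as diagrams. -/

namespace PolyCone

open OrdCircuit

variable {𝕜 : Type*}

namespace OrdCircuit

/-- The predicate `x ≥ 0`. -/
def pos : OrdCircuit 𝕜 1 0 := geq ;; coZero

/-- The predicate `x + y = 0`. -/
def antiCap : OrdCircuit 𝕜 2 0 := add ;; coZero

end OrdCircuit

/-- The antipode. -/
def OrdCircuit.neg (𝕜 : Type*) [Field 𝕜] : OrdCircuit 𝕜 1 1 := scalar (-1)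

variable [Field 𝕜] [LinearOrder 𝕜]

section Frobenius

variable (𝕜) in
theorem coDelete_coCopy_left : ((coDelete ⊠ wire :) ;; coCopy : OrdCircuit 𝕜 1 1) ≋
    (wire : OrdCircuit 𝕜 1 1) := ih_op_eq .copy_unit

variable (𝕜) in
theorem sym_coCopy : (Term.sym 1 1 ;; coCopy : OrdCircuit 𝕜 2 1) ≋ (coCopy : OrdCircuit 𝕜 2 1) :=
  ih_op_eq .copy_comm

variable (𝕜) in
theorem coDelete_coCopy_right : ((wire ⊠ coDelete :) ;; coCopy : OrdCircuit 𝕜 1 1) ≋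
    (wire : OrdCircuit 𝕜 1 1) :=
  calc ((wire ⊠ coDelete :) ;; coCopy : OrdCircuit 𝕜 1 1)
      ≋ (wire ⊠ coDelete :) ;; (Term.sym 1 1 ;; coCopy) := .comp (.refl _) (sym_coCopy 𝕜).symm
    _ ≋ ((wire ⊠ coDelete :) ;; Term.sym 1 1) ;; coCopy := (comp_assoc _ _ _).symm
    _ ≋ (Term.sym 1 0 ;; (coDelete ⊠ wire :)) ;; coCopy :=
      .comp (sym_natural wire coDelete) (.refl _)
    _ ≋ (wire ;; (coDelete ⊠ wire :)) ;; coCopy :=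
      .comp (.comp (sym_zero_right 𝕜 1) (.refl _)) (.refl _)
    _ ≋ (coDelete ⊠ wire :) ;; coCopy := .comp (id_comp _) (.refl _)
    _ ≋ wire := coDelete_coCopy_left 𝕜

variable (𝕜) in
theorem coCopy_copy_left : (coCopy ;; copy : OrdCircuit 𝕜 2 2) ≋
    ((copy ⊠ wire :) ;; (wire ⊠ coCopy :) : OrdCircuit 𝕜 2 2) := (ih_eq .copy_frob_left).symm

variable (𝕜) in
theorem coCopy_copy_right : (coCopy ;; copy : OrdCircuit 𝕜 2 2) ≋
    ((wire ⊠ copy :) ;; (coCopy ⊠ wire :) : OrdCircuit 𝕜 2 2) := ih_eq .copy_frob_right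

variable (𝕜) in
theorem copy_coCopy : (copy ;; coCopy : OrdCircuit 𝕜 1 1) ≋ (wire : OrdCircuit 𝕜 1 1) :=
  ih_eq .copy_special

variable (𝕜) in
theorem coDelete_delete : (coDelete ;; delete : OrdCircuit 𝕜 0 0) ≋ Term.id 0 := ih_eq .copy_bone

variable (𝕜) in
theorem coCopy_coZero : (coCopy ;; coZero : OrdCircuit 𝕜 2 0) ≋
    (coZero ⊠ coZero : OrdCircuit 𝕜 2 0) := ih_op_eq .bimonoid_unit

variable (𝕜) in
theorem zero_coZero : (zero ;; coZero : OrdCircuit 𝕜 0 0) ≋ Term.id 0 := ih_eq .add_bone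

variable (𝕜) in
theorem add_delete : (add ;; delete : OrdCircuit 𝕜 2 0) ≋
    (delete ⊠ delete : OrdCircuit 𝕜 2 0) := ih_eq .bimonoid_counit

theorem scalar_delete (r : 𝕜) : (scalar r ;; delete : OrdCircuit 𝕜 1 0) ≋
    (delete : OrdCircuit 𝕜 1 0) := ih_eq (.scalar_delete r)

variable (𝕜) in
theorem coZero_le_delete : (coZero : OrdCircuit 𝕜 1 0) ≼ (delete : OrdCircuit 𝕜 1 0) :=
  .ax .inclusion

theorem coScalar_scalar {r : 𝕜} (hr : r ≠ 0) :
    (coScalar r ;; scalar r : OrdCircuit 𝕜 1 1) ≋ (wire : OrdCircuit 𝕜 1 1) :=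
  (ih_eq (.scalar_coinv r hr)).symm

theorem coScalar_coZero (r : 𝕜) : (coScalar r ;; coZero : OrdCircuit 𝕜 1 0) ≋
    (coZero : OrdCircuit 𝕜 1 0) := (ih_op_eq (.scalar_zero r)).symm

theorem coDelete_coScalar (r : 𝕜) : (coDelete ;; coScalar r : OrdCircuit 𝕜 0 1) ≋
    (coDelete : OrdCircuit 𝕜 0 1) := ih_op_eq (.scalar_delete r)

theorem scalar_coZero {r : 𝕜} (hr : r ≠ 0) : (scalar r ;; coZero : OrdCircuit 𝕜 1 0) ≋
    (coZero : OrdCircuit 𝕜 1 0) :=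
  calc (scalar r ;; coZero : OrdCircuit 𝕜 1 0)
      ≋ scalar r ;; (coScalar r ;; coZero) := .comp (.refl _) (coScalar_coZero r).symm
    _ ≋ (scalar r ;; coScalar r) ;; coZero := (comp_assoc _ _ _).symm
    _ ≋ wire ;; coZero := .comp (scalar_coScalar hr) (.refl _)
    _ ≋ coZero := id_comp _

theorem coDelete_scalar {r : 𝕜} (hr : r ≠ 0) : (coDelete ;; scalar r : OrdCircuit 𝕜 0 1) ≋
    (coDelete : OrdCircuit 𝕜 0 1) :=
  calc (coDelete ;; scalar r : OrdCircuit 𝕜 0 1)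
      ≋ (coDelete ;; coScalar r) ;; scalar r := .comp (coDelete_coScalar r).symm (.refl _)
    _ ≋ coDelete ;; (coScalar r ;; scalar r) := comp_assoc _ _ _
    _ ≋ coDelete ;; wire := .comp (.refl _) (coScalar_scalar hr)
    _ ≋ coDelete := comp_id _

variable (𝕜) in
theorem neg_antiCap : ((neg 𝕜 ⊠ wire :) ;; antiCap : OrdCircuit 𝕜 2 0) ≋
    (cap : OrdCircuit 𝕜 2 0) := ih_eq .white_cap

variable (𝕜) in
theorem sym_cap : (Term.sym 1 1 ;; cap : OrdCircuit 𝕜 2 0) ≋ (cap : OrdCircuit 𝕜 2 0) :=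
  (comp_assoc (Term.sym 1 1) coCopy delete).symm.trans (.comp (sym_coCopy 𝕜) (.refl _))

variable (𝕜) in
theorem sym_antiCap : (Term.sym 1 1 ;; antiCap : OrdCircuit 𝕜 2 0) ≋
    (antiCap : OrdCircuit 𝕜 2 0) :=
  (comp_assoc (Term.sym 1 1) add coZero).symm.trans (.comp (sym_add 𝕜) (.refl _))

variable (𝕜) in
theorem neg_antiCap' : ((wire ⊠ neg 𝕜 :) ;; antiCap : OrdCircuit 𝕜 2 0) ≋
    (cap : OrdCircuit 𝕜 2 0) :=
  calc ((wire ⊠ neg 𝕜 :) ;; antiCap : OrdCircuit 𝕜 2 0)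
      ≋ (wire ⊠ neg 𝕜 :) ;; (Term.sym 1 1 ;; antiCap) :=
        .comp (.refl _) (sym_antiCap 𝕜).symm
    _ ≋ ((wire ⊠ neg 𝕜 :) ;; Term.sym 1 1) ;; antiCap := (comp_assoc _ _ _).symm
    _ ≋ (Term.sym 1 1 ;; (neg 𝕜 ⊠ wire :)) ;; antiCap :=
        .comp (sym_natural wire (neg 𝕜)) (.refl _)
    _ ≋ Term.sym 1 1 ;; ((neg 𝕜 ⊠ wire :) ;; antiCap) := comp_assoc _ _ _
    _ ≋ Term.sym 1 1 ;; cap := .comp (.refl _) (neg_antiCap 𝕜)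
    _ ≋ cap := sym_cap 𝕜

variable (𝕜) in
theorem scalar_neg_one_sq : (neg 𝕜 ;; neg 𝕜 : OrdCircuit 𝕜 1 1) ≋
    (wire : OrdCircuit 𝕜 1 1) :=
  (scalar_mul (-1) (-1)).trans ((IHPEq.of_eq (by rw [neg_mul_neg, one_mul])).trans (scalar_one 𝕜))

variable (𝕜) in
theorem neg_cap : ((neg 𝕜 ⊠ wire :) ;; cap : OrdCircuit 𝕜 2 0) ≋
    (antiCap : OrdCircuit 𝕜 2 0) :=
  calc ((neg 𝕜 ⊠ wire :) ;; cap : OrdCircuit 𝕜 2 0)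
      ≋ (neg 𝕜 ⊠ wire :) ;; ((neg 𝕜 ⊠ wire :) ;; antiCap) :=
        .comp (.refl _) (neg_antiCap 𝕜).symm
    _ ≋ ((neg 𝕜 ;; neg 𝕜) ⊠ wire :) ;; antiCap := .of_normalize (by cbv)
    _ ≋ (wire ⊠ wire :) ;; antiCap := .comp (.tensor (scalar_neg_one_sq 𝕜) (.refl _)) (.refl _)
    _ ≋ antiCap := .of_normalize (by cbv)

variable (𝕜) in
theorem neg_cap' : ((wire ⊠ neg 𝕜 :) ;; cap : OrdCircuit 𝕜 2 0) ≋
    (antiCap : OrdCircuit 𝕜 2 0) :=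
  calc ((wire ⊠ neg 𝕜 :) ;; cap : OrdCircuit 𝕜 2 0)
      ≋ (wire ⊠ neg 𝕜 :) ;; ((wire ⊠ neg 𝕜 :) ;; antiCap) :=
        .comp (.refl _) (neg_antiCap' 𝕜).symm
    _ ≋ (wire ⊠ (neg 𝕜 ;; neg 𝕜) :) ;; antiCap := .of_normalize (by cbv)
    _ ≋ (wire ⊠ wire :) ;; antiCap := .comp (.tensor (.refl _) (scalar_neg_one_sq 𝕜)) (.refl _)
    _ ≋ antiCap := .of_normalize (by cbv)

-- Equality of two inputs means that a difference is zero. This exposes a `coZero`, which is all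
-- that the one inclusion axiom can weaken.
variable (𝕜) in
theorem cap_le : (cap : OrdCircuit 𝕜 2 0) ≼ (delete ⊠ delete : OrdCircuit 𝕜 2 0) :=
  calc (cap : OrdCircuit 𝕜 2 0)
      ≋ (neg 𝕜 ⊠ wire :) ;; (add ;; coZero) := (neg_antiCap 𝕜).symm
    _ ≼ (neg 𝕜 ⊠ wire :) ;; (add ;; delete) :=
        .comp (.refl _) (.comp (.refl _) (coZero_le_delete 𝕜))
    _ ≋ (neg 𝕜 ⊠ wire :) ;; (delete ⊠ delete :) := .comp (.refl _) (add_delete 𝕜)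
    _ ≋ ((neg 𝕜 ;; delete) ⊠ delete :) := .of_normalize (by cbv)
    _ ≋ (delete ⊠ delete :) := .tensor (scalar_delete _) (.refl _)

variable (𝕜) in
theorem coCopy_le : (coCopy : OrdCircuit 𝕜 2 1) ≼ (wire ⊠ delete : OrdCircuit 𝕜 2 1) :=
  calc (coCopy : OrdCircuit 𝕜 2 1)
      ≋ coCopy ;; (copy ;; (wire ⊠ delete :)) :=
        ((IHPEq.comp (.refl _) (copy_delete_right 𝕜)).trans (comp_id _)).symm
    _ ≋ (coCopy ;; copy) ;; (wire ⊠ delete :) := (comp_assoc _ _ _).symm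
    _ ≋ ((copy ⊠ wire :) ;; (wire ⊠ coCopy :)) ;; (wire ⊠ delete :) :=
        .comp (coCopy_copy_left 𝕜) (.refl _)
    _ ≋ (copy ⊠ wire :) ;; (wire ⊠ cap :) := .of_normalize (by cbv)
    _ ≼ (copy ⊠ wire :) ;; (wire ⊠ (delete ⊠ delete) :) :=
        .comp (.refl _) (.tensor (.refl _) (cap_le 𝕜))
    _ ≋ ((copy ;; (wire ⊠ delete :)) ⊠ delete :) := .of_normalize (by cbv)
    _ ≋ (wire ⊠ delete :) := .tensor (copy_delete_right 𝕜) (.refl _)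

-- Instantiation of a bound variable: the number equal to `x` is `x`. It lets wires be bent round
-- and straightened again.
variable (𝕜) in
/-- Yanking. -/
theorem cup_cap : ((wire ⊠ cup :) ;; (cap ⊠ wire :) : OrdCircuit 𝕜 1 1) ≋
    (wire : OrdCircuit 𝕜 1 1) :=
  calc ((wire ⊠ cup :) ;; (cap ⊠ wire :) : OrdCircuit 𝕜 1 1)
      ≋ (wire ⊠ coDelete :) ;; ((wire ⊠ copy :) ;; (coCopy ⊠ wire :)) ;; (delete ⊠ wire :) :=
        .of_normalize (by cbv)
    _ ≋ (wire ⊠ coDelete :) ;; (coCopy ;; copy) ;; (delete ⊠ wire :) :=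
        .comp (.refl _) (.comp (coCopy_copy_right 𝕜).symm (.refl _))
    _ ≋ ((wire ⊠ coDelete :) ;; coCopy) ;; (copy ;; (delete ⊠ wire :)) := .of_normalize (by cbv)
    _ ≋ wire ;; wire := .comp (coDelete_coCopy_right 𝕜) (copy_delete_left 𝕜)
    _ ≋ wire := id_comp _

end Frobenius

section Pos

variable (𝕜) in
theorem geq_delete : (geq ;; delete : OrdCircuit 𝕜 1 0) ≋ (delete : OrdCircuit 𝕜 1 0) :=
  ord_eq .geq_delete

variable (𝕜) in
theorem add_geq : (add ;; geq : OrdCircuit 𝕜 2 1) ≋ ((geq ⊠ geq :) ;; add : OrdCircuit 𝕜 2 1) :=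
  ord_eq .geq_add

variable (𝕜) in
theorem geq_copy_le : (geq ;; copy : OrdCircuit 𝕜 1 2) ≼
    (copy ;; (geq ⊠ geq :) : OrdCircuit 𝕜 1 2) := ord_le .geq_copy

variable (𝕜) in
theorem pos_le_delete : (pos : OrdCircuit 𝕜 1 0) ≼ (delete : OrdCircuit 𝕜 1 0) :=
  calc (pos : OrdCircuit 𝕜 1 0) ≼ geq ;; delete := .comp (.refl _) (coZero_le_delete 𝕜)
    _ ≋ delete := geq_delete 𝕜

variable (𝕜) in
theorem pos_le_copy : (pos : OrdCircuit 𝕜 1 0) ≼ (copy ;; (pos ⊠ pos :) : OrdCircuit 𝕜 1 0) :=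
  calc (pos : OrdCircuit 𝕜 1 0)
      ≋ geq ;; (wire ;; coZero) := .of_normalize (by cbv)
    _ ≋ geq ;; ((copy ;; coCopy) ;; coZero) :=
        .comp (.refl _) (.comp (copy_coCopy 𝕜).symm (.refl _))
    _ ≋ (geq ;; copy) ;; (coCopy ;; coZero) := .of_normalize (by cbv)
    _ ≼ (copy ;; (geq ⊠ geq :)) ;; (coCopy ;; coZero) := .comp (geq_copy_le 𝕜) (.refl _)
    _ ≋ (copy ;; (geq ⊠ geq :)) ;; (coZero ⊠ coZero :) := .comp (.refl _) (coCopy_coZero 𝕜)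
    _ ≋ copy ;; (pos ⊠ pos :) := .of_normalize (by cbv)

variable (𝕜) in
theorem id_le_zero_pos : (Term.id 0 : OrdCircuit 𝕜 0 0) ≼ (zero ;; pos : OrdCircuit 𝕜 0 0) :=
  calc (Term.id 0 : OrdCircuit 𝕜 0 0) ≋ zero ;; coZero := (zero_coZero 𝕜).symm
    _ ≼ zero ;; (geq ;; coZero) := .comp (.refl _) (ord_le .coZero_le)

variable (𝕜) in
theorem coZero_tensor_coZero_le : (coZero ⊠ coZero : OrdCircuit 𝕜 2 0) ≼
    (antiCap : OrdCircuit 𝕜 2 0) :=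
  calc (coZero ⊠ coZero : OrdCircuit 𝕜 2 0)
      ≋ ((neg 𝕜 ;; coZero) ⊠ coZero :) :=
        .tensor (scalar_coZero (neg_ne_zero.2 one_ne_zero)).symm (.refl _)
    _ ≋ (neg 𝕜 ⊠ wire :) ;; (coZero ⊠ coZero :) := .of_normalize (by cbv)
    _ ≋ (neg 𝕜 ⊠ wire :) ;; (coCopy ;; coZero) := .comp (.refl _) (coCopy_coZero 𝕜).symm
    _ ≼ (neg 𝕜 ⊠ wire :) ;; (coCopy ;; delete) :=
        .comp (.refl _) (.comp (.refl _) (coZero_le_delete 𝕜))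
    _ ≋ antiCap := neg_cap 𝕜

-- Nonnegative numbers have nonnegative sums: weakening `x = y = 0` to `x + y = 0` leaves two copies
-- of `geq` in front of an adder, and `geq` commutes with addition.
variable (𝕜) in
theorem pos_tensor_pos_le : (pos ⊠ pos : OrdCircuit 𝕜 2 0) ≼ (add ;; pos : OrdCircuit 𝕜 2 0) :=
  calc (pos ⊠ pos : OrdCircuit 𝕜 2 0)
      ≋ (geq ⊠ geq :) ;; (coZero ⊠ coZero :) := .of_normalize (by cbv)
    _ ≼ (geq ⊠ geq :) ;; antiCap := .comp (.refl _) (coZero_tensor_coZero_le 𝕜)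
    _ ≋ ((geq ⊠ geq :) ;; add) ;; coZero := .of_normalize (by cbv)
    _ ≋ (add ;; geq) ;; coZero := .comp (add_geq 𝕜).symm (.refl _)
    _ ≋ add ;; pos := comp_assoc _ _ _

theorem pos_le_scalar_pos {r : 𝕜} (hr : 0 ≤ r) :
    (pos : OrdCircuit 𝕜 1 0) ≼ (scalar r ;; pos : OrdCircuit 𝕜 1 0) := by
  -- For `r = 0` the scalar discards its input and returns zero, which is nonnegative by
  -- `id_le_zero_pos`. For `r > 0` the scalar commutes with `geq` and is absorbed by `coZero`.
  rcases hr.eq_or_lt with rfl | hr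
  · calc (pos : OrdCircuit 𝕜 1 0) ≼ delete := pos_le_delete 𝕜
      _ ≋ delete ;; Term.id 0 := (comp_id _).symm
      _ ≼ delete ;; (zero ;; pos) := .comp (.refl _) (id_le_zero_pos 𝕜)
      _ ≋ (delete ;; zero) ;; pos := (comp_assoc _ _ _).symm
      _ ≋ scalar 0 ;; pos := .comp (scalar_zero 𝕜).symm (.refl _)
  · refine And.left (b := _ ≼ pos) (?_ : pos ≋ scalar r ;; pos)
    calc (pos : OrdCircuit 𝕜 1 0) ≋ geq ;; (scalar r ;; coZero) :=
          .comp (.refl _) (scalar_coZero hr.ne').symm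
      _ ≋ (geq ;; scalar r) ;; coZero := (comp_assoc _ _ _).symm
      _ ≋ (scalar r ;; geq) ;; coZero := .comp (ord_eq (.scalar_pos r hr)).symm (.refl _)
      _ ≋ scalar r ;; pos := comp_assoc _ _ _

variable (𝕜) in
theorem copy_geq_coCopy : (copy ;; (geq ⊠ geq :) ;; coCopy : OrdCircuit 𝕜 1 1) ≋
    (geq : OrdCircuit 𝕜 1 1) := by
  constructor
  · calc (copy ;; (geq ⊠ geq :) ;; coCopy : OrdCircuit 𝕜 1 1)
        ≼ copy ;; (geq ⊠ geq :) ;; (wire ⊠ delete :) :=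
          .comp (.refl _) (.comp (.refl _) (coCopy_le 𝕜))
      _ ≋ copy ;; (geq ⊠ (geq ;; delete) :) := .of_normalize (by cbv)
      _ ≋ copy ;; (geq ⊠ delete :) := .comp (.refl _) (.tensor (.refl _) (geq_delete 𝕜))
      _ ≋ (copy ;; (wire ⊠ delete :)) ;; geq := .of_normalize (by cbv)
      _ ≋ wire ;; geq := .comp (copy_delete_right 𝕜) (.refl _)
      _ ≋ geq := id_comp _
  · calc (geq : OrdCircuit 𝕜 1 1) ≋ geq ;; wire := (comp_id _).symm
      _ ≋ geq ;; (copy ;; coCopy) := .comp (.refl _) (copy_coCopy 𝕜).symm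
      _ ≋ (geq ;; copy) ;; coCopy := (comp_assoc _ _ _).symm
      _ ≼ (copy ;; (geq ⊠ geq :)) ;; coCopy := .comp (geq_copy_le 𝕜) (.refl _)
      _ ≋ copy ;; (geq ⊠ geq :) ;; coCopy := comp_assoc _ _ _

variable (𝕜) in
theorem spider : ((geq ⊠ geq :) ;; coCopy ;; copy ;; (geq ⊠ geq :) : OrdCircuit 𝕜 2 2) ≋
    ((copy ⊠ copy :) ;; ((geq ⊠ geq) ⊠ (geq ⊠ geq) :) ;; midSwap ;; (coCopy ⊠ coCopy :) :
      OrdCircuit 𝕜 2 2) := ord_eq .spider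

-- Transitivity and density come from the spider axiom. With its two inputs identified, and likewise
-- its two outputs, one side becomes `geq ;; geq` and the other four copies of the same inequality.
-- Forgetting three of them gives one inclusion; duplicating `geq` gives the other.
variable (𝕜) in
theorem geq_geq : (geq ;; geq : OrdCircuit 𝕜 1 1) ≋ (geq : OrdCircuit 𝕜 1 1) := by
  have h : (geq ;; geq : OrdCircuit 𝕜 1 1) ≋
      copy ;; ((copy ⊠ copy :) ;; ((geq ⊠ geq) ⊠ (geq ⊠ geq) :) ;; midSwap ;;
        (coCopy ⊠ coCopy :)) ;; coCopy :=
    calc (geq ;; geq : OrdCircuit 𝕜 1 1)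
        ≋ (copy ;; (geq ⊠ geq :) ;; coCopy) ;; (copy ;; (geq ⊠ geq :) ;; coCopy) :=
          .comp (copy_geq_coCopy 𝕜).symm (copy_geq_coCopy 𝕜).symm
      _ ≋ copy ;; ((geq ⊠ geq :) ;; coCopy ;; copy ;; (geq ⊠ geq :)) ;; coCopy :=
          .of_normalize (by cbv)
      _ ≋ _ := .comp (.refl _) (.comp (spider 𝕜) (.refl _))
  constructor
  · calc (geq ;; geq : OrdCircuit 𝕜 1 1)
        ≼ copy ;; ((copy ⊠ copy :) ;; ((geq ⊠ geq) ⊠ (geq ⊠ geq) :) ;; midSwap ;;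
            ((wire ⊠ delete) ⊠ (wire ⊠ delete) :)) ;; (wire ⊠ delete :) :=
          h.1.trans (.comp (.refl _) (.comp (.comp (.refl _) (.comp (.refl _) (.comp (.refl _)
            (.tensor (coCopy_le 𝕜) (coCopy_le 𝕜))))) (coCopy_le 𝕜)))
      _ ≋ copy ;; ((copy ⊠ copy :) ;; ((geq ⊠ geq) ⊠ (geq ⊠ geq) :) ;;
            (wire ⊠ (Term.sym 1 1 ;; (delete ⊠ delete :)) ⊠ delete :)) := .of_normalize (by cbv)
      _ ≋ copy ;; ((copy ⊠ copy :) ;; ((geq ⊠ geq) ⊠ (geq ⊠ geq) :) ;;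
            (wire ⊠ (delete ⊠ delete) ⊠ delete :)) :=
          .comp (.refl _) (.comp (.refl _) (.comp (.refl _) (.tensor (.tensor (.refl _)
            ((sym_natural delete delete).symm.trans ((IHPEq.comp (.refl _)
              (sym_zero_left 𝕜 0)).trans (comp_id _)))) (.refl _))))
      _ ≋ copy ;; (copy ⊠ copy :) ;;
            (geq ⊠ (geq ;; delete) ⊠ (geq ;; delete) ⊠ (geq ;; delete) :) := .of_normalize (by cbv)
      _ ≋ copy ;; (copy ⊠ copy :) ;; (geq ⊠ delete ⊠ delete ⊠ delete :) :=
          .comp (.refl _) (.comp (.refl _) (.tensor (.tensor (.tensor (.refl _) (geq_delete 𝕜))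
            (geq_delete 𝕜)) (geq_delete 𝕜)))
      _ ≋ copy ;; ((copy ;; (wire ⊠ delete :)) ⊠ (copy ;; (wire ⊠ delete :)) :) ;;
            (geq ⊠ delete :) := .of_normalize (by cbv)
      _ ≋ copy ;; (wire ⊠ wire :) ;; (geq ⊠ delete :) :=
          .comp (.refl _) (.comp (.tensor (copy_delete_right 𝕜) (copy_delete_right 𝕜)) (.refl _))
      _ ≋ (copy ;; (wire ⊠ delete :)) ;; geq := .of_normalize (by cbv)
      _ ≋ wire ;; geq := .comp (copy_delete_right 𝕜) (.refl _)
      _ ≋ geq := id_comp _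
  · calc (geq : OrdCircuit 𝕜 1 1)
        ≋ geq ;; wire := (comp_id _).symm
      _ ≋ geq ;; (copy ;; coCopy) := .comp (.refl _) (copy_coCopy 𝕜).symm
      _ ≋ geq ;; (copy ;; (wire ⊠ wire : OrdCircuit 𝕜 2 2) ;; coCopy) := .of_normalize (by cbv)
      _ ≋ geq ;; (copy ;; ((copy ;; coCopy) ⊠ (copy ;; coCopy) :) ;; coCopy) :=
          .comp (.refl _) (.comp (.refl _) (.comp (.tensor (copy_coCopy 𝕜).symm
            (copy_coCopy 𝕜).symm) (.refl _)))
      _ ≋ geq ;; ((copy ;; (copy ⊠ copy :)) ;; (coCopy ⊠ coCopy :) ;; coCopy) := .of_normalize (by cbv)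
      _ ≋ geq ;; ((copy ;; (copy ⊠ copy :) ;; midSwap) ;; (coCopy ⊠ coCopy :) ;; coCopy) :=
          .comp (.refl _) (.comp (copy_copy 𝕜).symm (.refl _))
      _ ≋ (geq ;; copy) ;; (copy ⊠ copy :) ;; midSwap ;; (coCopy ⊠ coCopy :) ;; coCopy :=
          .of_normalize (by cbv)
      _ ≼ (copy ;; (geq ⊠ geq :)) ;; (copy ⊠ copy :) ;; midSwap ;; (coCopy ⊠ coCopy :) ;; coCopy :=
          .comp (geq_copy_le 𝕜) (.refl _)
      _ ≋ copy ;; ((geq ;; copy) ⊠ (geq ;; copy) :) ;; midSwap ;; (coCopy ⊠ coCopy :) ;; coCopy :=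
          .of_normalize (by cbv)
      _ ≼ copy ;; ((copy ;; (geq ⊠ geq :)) ⊠ (copy ;; (geq ⊠ geq :)) :) ;; midSwap ;;
            (coCopy ⊠ coCopy :) ;; coCopy :=
          .comp (.refl _) (.comp (.tensor (geq_copy_le 𝕜) (geq_copy_le 𝕜)) (.refl _))
      _ ≋ _ := .of_normalize (by cbv)
      _ ≋ geq ;; geq := h.symm

end Pos

section Leq

-- By definition `leq` is `geq` with both wires bent, so one bend is undone by yanking.
variable (𝕜) in
theorem leq_cap : ((wire ⊠ leq :) ;; cap : OrdCircuit 𝕜 2 0) ≋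
    ((geq ⊠ wire :) ;; cap : OrdCircuit 𝕜 2 0) :=
  calc ((wire ⊠ leq :) ;; cap : OrdCircuit 𝕜 2 0)
      ≋ (((wire ⊠ cup :) ;; (cap ⊠ wire :)) ⊠ wire :) ;; (geq ⊠ wire :) ;; cap :=
        .of_normalize (by cbv)
    _ ≋ (wire ⊠ wire :) ;; (geq ⊠ wire :) ;; cap :=
        .comp (.tensor (cup_cap 𝕜) (.refl _)) (.refl _)
    _ ≋ (geq ⊠ wire :) ;; cap := .of_normalize (by cbv)

variable (𝕜) [IsStrictOrderedRing 𝕜]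

theorem scalar_neg_one_geq : (neg 𝕜 ;; geq : OrdCircuit 𝕜 1 1) ≋
    (leq ;; neg 𝕜 : OrdCircuit 𝕜 1 1) :=
  ord_eq (.scalar_neg (-1) (neg_lt_zero.2 one_pos))

theorem geq_scalar_neg_one : (geq ;; neg 𝕜 : OrdCircuit 𝕜 1 1) ≋
    (neg 𝕜 ;; leq : OrdCircuit 𝕜 1 1) :=
  calc (geq ;; neg 𝕜 : OrdCircuit 𝕜 1 1)
      ≋ wire ;; (geq ;; neg 𝕜) := (id_comp _).symm
    _ ≋ (neg 𝕜 ;; neg 𝕜) ;; (geq ;; neg 𝕜) :=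
        .comp (scalar_neg_one_sq 𝕜).symm (.refl _)
    _ ≋ neg 𝕜 ;; (neg 𝕜 ;; geq) ;; neg 𝕜 := .of_normalize (by cbv)
    _ ≋ neg 𝕜 ;; (leq ;; neg 𝕜) ;; neg 𝕜 :=
        .comp (.refl _) (.comp (scalar_neg_one_geq 𝕜) (.refl _))
    _ ≋ (neg 𝕜 ;; leq) ;; (neg 𝕜 ;; neg 𝕜) := .of_normalize (by cbv)
    _ ≋ (neg 𝕜 ;; leq) ;; wire := .comp (.refl _) (scalar_neg_one_sq 𝕜)
    _ ≋ neg 𝕜 ;; leq := comp_id _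

/-- Passing the antipode turns `geq` into `leq`, and passing the cap turns it back. -/
theorem geq_antiCap : ((wire ⊠ geq :) ;; antiCap : OrdCircuit 𝕜 2 0) ≋
    ((geq ⊠ wire :) ;; antiCap : OrdCircuit 𝕜 2 0) :=
  calc ((wire ⊠ geq :) ;; antiCap : OrdCircuit 𝕜 2 0)
      ≋ (wire ⊠ geq :) ;; ((wire ⊠ neg 𝕜 :) ;; cap) := .comp (.refl _) (neg_cap' 𝕜).symm
    _ ≋ (wire ⊠ (geq ;; neg 𝕜) :) ;; cap := .of_normalize (by cbv)
    _ ≋ (wire ⊠ (neg 𝕜 ;; leq) :) ;; cap :=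
        .comp (.tensor (.refl _) (geq_scalar_neg_one 𝕜)) (.refl _)
    _ ≋ (wire ⊠ neg 𝕜 :) ;; ((wire ⊠ leq :) ;; cap) := .of_normalize (by cbv)
    _ ≋ (wire ⊠ neg 𝕜 :) ;; ((geq ⊠ wire :) ;; cap) := .comp (.refl _) (leq_cap 𝕜)
    _ ≋ (geq ⊠ wire :) ;; ((wire ⊠ neg 𝕜 :) ;; cap) := .of_normalize (by cbv)
    _ ≋ (geq ⊠ wire :) ;; antiCap := .comp (.refl _) (neg_cap' 𝕜)

/-- Distributing `geq` over the sum gives one copy on each summand. The right one slides across the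
bend, and the two merge by `geq_geq`. This is the bridge between the relation `geq` and systems `A x
≥ 0`. -/
theorem add_pos_eq_left : (add ;; pos : OrdCircuit 𝕜 2 0) ≋
    ((geq ⊠ wire :) ;; antiCap : OrdCircuit 𝕜 2 0) :=
  calc (add ;; pos : OrdCircuit 𝕜 2 0) ≋ (add ;; geq) ;; coZero := (comp_assoc _ _ _).symm
    _ ≋ ((geq ⊠ geq :) ;; add) ;; coZero := .comp (add_geq 𝕜) (.refl _)
    _ ≋ (geq ⊠ wire :) ;; ((wire ⊠ geq :) ;; antiCap) := .of_normalize (by cbv)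
    _ ≋ (geq ⊠ wire :) ;; ((geq ⊠ wire :) ;; antiCap) := .comp (.refl _) (geq_antiCap 𝕜)
    _ ≋ ((geq ;; geq) ⊠ wire :) ;; antiCap := .of_normalize (by cbv)
    _ ≋ (geq ⊠ wire :) ;; antiCap := .comp (.tensor (geq_geq 𝕜) (.refl _)) (.refl _)

theorem add_pos_eq_right : (add ;; pos : OrdCircuit 𝕜 2 0) ≋
    ((wire ⊠ geq :) ;; antiCap : OrdCircuit 𝕜 2 0) :=
  (add_pos_eq_left 𝕜).trans (geq_antiCap 𝕜).symm

/-- `x ≥ y` if and only if `x - y ≥ 0`. -/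
theorem geq_cap : ((geq ⊠ wire :) ;; cap : OrdCircuit 𝕜 2 0) ≋
    ((wire ⊠ neg 𝕜 :) ;; add ;; pos : OrdCircuit 𝕜 2 0) :=
  calc ((geq ⊠ wire :) ;; cap : OrdCircuit 𝕜 2 0)
      ≋ (geq ⊠ wire :) ;; ((wire ⊠ neg 𝕜 :) ;; antiCap) :=
        .comp (.refl _) (neg_antiCap' 𝕜).symm
    _ ≋ (wire ⊠ neg 𝕜 :) ;; ((geq ⊠ wire :) ;; antiCap) := .of_normalize (by cbv)
    _ ≋ (wire ⊠ neg 𝕜 :) ;; add ;; pos := .comp (.refl _) (add_pos_eq_left 𝕜).symm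

end Leq
end PolyCone

/-! ### Cones and entailed inequalities. -/

namespace PolyCone

open OrdCircuit
open MatrixCircuit (pull)

variable {𝕜 : Type*}

/-- The predicate that all `n` inputs are nonnegative. -/
def OrdCircuit.posN (n : ℕ) : OrdCircuit 𝕜 n 0 := geqs n ;; coZeros n

namespace MatrixCircuit

/-- The matrix circuit with the linear forms in `L` as outputs. -/
def ofForms {n : ℕ} : ∀ L : List (Fin n → 𝕜), MatrixCircuit 𝕜 n L.length
  | [] => deleteN n
  | v :: L => copyN n ;; (ofForms L ⊠ row n v)

theorem pull_ofForms_cons [Field 𝕜] {n : ℕ} (v : Fin n → 𝕜) (L : List (Fin n → 𝕜))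
    (w : Fin (L.length + 1) → 𝕜) :
    pull (ofForms (v :: L)) w =
      pull (ofForms L) (fun i => w i.castSucc) + w (Fin.last _) • v := by
  funext i
  change pull (copyN n) (pull (ofForms L ⊠ row n v) w) i = _
  rw [pull_copyN]
  simp only [pull, pull_row, Fin.addCases_left, Fin.addCases_right]
  rfl

theorem pull_ofForms_zero [Field 𝕜] {n : ℕ} (L : List (Fin n → 𝕜)) : pull (ofForms L) 0 = 0 := by
  induction L with
  | nil => exact pull_deleteN _ _
  | cons w L ih =>
    rw [pull_ofForms_cons]
    simp only [Pi.zero_apply, zero_smul, add_zero]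
    exact ih

theorem pull_ofForms_single_last [Field 𝕜] {n : ℕ} (v : Fin n → 𝕜) (L : List (Fin n → 𝕜)) :
    pull (ofForms (v :: L)) (Pi.single (Fin.last L.length) 1) = v := by
  have h : (fun i : Fin L.length => (Pi.single (Fin.last L.length) 1 :
      Fin (L.length + 1) → 𝕜) i.castSucc) = 0 := by
    funext j; exact Pi.single_eq_of_ne (Fin.castSucc_lt_last j).ne _
  rw [pull_ofForms_cons, h, pull_ofForms_zero]
  simp

theorem pull_ofForms_single_castSucc [Field 𝕜] {n : ℕ} (v : Fin n → 𝕜) (L : List (Fin n → 𝕜))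
    (i : Fin L.length) :
    pull (ofForms (v :: L)) (Pi.single i.castSucc 1) = pull (ofForms L) (Pi.single i 1) := by
  have h : (fun j : Fin L.length => (Pi.single i.castSucc 1 :
      Fin (L.length + 1) → 𝕜) j.castSucc) = Pi.single i 1 := by
    funext j
    by_cases hj : j = i
    · subst hj; simp
    · rw [Pi.single_eq_of_ne hj, Pi.single_eq_of_ne (by simpa using hj)]
  rw [pull_ofForms_cons, h, Pi.single_eq_of_ne (Fin.castSucc_lt_last i).ne', zero_smul, add_zero]

theorem pull_ofForms_single [Field 𝕜] {n : ℕ} (L : List (Fin n → 𝕜)) (i : Fin L.length) :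
    pull (ofForms L) (Pi.single i 1) ∈ L := by
  induction L with
  | nil => exact i.elim0
  | cons v L ih =>
    refine Fin.lastCases (n := L.length) ?_ (fun i => ?_) i
    · rw [pull_ofForms_single_last]
      exact List.mem_cons_self
    · rw [pull_ofForms_single_castSucc]
      exact List.mem_cons_of_mem _ (ih i)

theorem exists_pull_ofForms [Field 𝕜] {n : ℕ} {L : List (Fin n → 𝕜)} {v : Fin n → 𝕜}
    (hv : v ∈ L) : ∃ i, pull (ofForms L) (Pi.single i 1) = v := by
  induction L with
  | nil => cases hv
  | cons u L ih =>
    rcases List.mem_cons.1 hv with rfl | hv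
    · exact ⟨Fin.last _, pull_ofForms_single_last _ _⟩
    · obtain ⟨i, rfl⟩ := ih hv
      exact ⟨i.castSucc, pull_ofForms_single_castSucc _ _ _⟩

theorem pull_tensor_castSucc [Field 𝕜] {n m q : ℕ} (A : MatrixCircuit 𝕜 n m)
    (B : MatrixCircuit 𝕜 1 q) (v : Fin (m + q) → 𝕜) (i : Fin n) :
    pull (A ⊠ B) v i.castSucc = pull A (fun i => v (Fin.castAdd q i)) i :=
  Fin.addCases_left (motive := fun _ => 𝕜) (left := pull A fun i => v (Fin.castAdd q i))
    (right := pull B fun i => v (Fin.natAdd m i)) i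

theorem pull_tensor_last [Field 𝕜] {n m q : ℕ} (A : MatrixCircuit 𝕜 n m)
    (B : MatrixCircuit 𝕜 1 q) (v : Fin (m + q) → 𝕜) :
    pull (A ⊠ B) v (Fin.last n) = pull B (fun i => v (Fin.natAdd m i)) 0 :=
  Fin.addCases_right (motive := fun _ => 𝕜) (left := pull A fun i => v (Fin.castAdd q i))
    (right := pull B fun i => v (Fin.natAdd m i)) (0 : Fin 1)

theorem pull_id_tensor_delete [Field 𝕜] {n : ℕ} (v : Fin n → 𝕜) :
    pull (Term.id n ⊠ delete) v = (Fin.snoc v 0 : Fin (n + 1) → 𝕜) := by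
  funext i
  refine Fin.lastCases ?_ (fun i => ?_) i
  · rw [pull_tensor_last, Fin.snoc_last]; rfl
  · rw [pull_tensor_castSucc, Fin.snoc_castSucc]; rfl

theorem pull_deleteN_tensor_wire [Field 𝕜] (n : ℕ) :
    pull (deleteN n ⊠ wire) 1 = (Pi.single (Fin.last n) 1 : Fin (n + 1) → 𝕜) := by
  funext i
  refine Fin.lastCases ?_ (fun i => ?_) i
  · rw [pull_tensor_last, Pi.single_eq_same]; rfl
  · rw [pull_tensor_castSucc, pull_deleteN, Pi.single_eq_of_ne (Fin.castSucc_lt_last i).ne]; rfl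

theorem snoc_single [Field 𝕜] {n : ℕ} (i : Fin n) :
    (Fin.snoc (Pi.single i 1 : Fin n → 𝕜) 0 : Fin (n + 1) → 𝕜) = Pi.single i.castSucc 1 := by
  funext j
  refine Fin.lastCases ?_ (fun j => ?_) j
  · rw [Fin.snoc_last, Pi.single_eq_of_ne (Fin.castSucc_lt_last i).ne']
  · rw [Fin.snoc_castSucc]
    by_cases hj : j = i
    · subst hj; simp
    · rw [Pi.single_eq_of_ne hj, Pi.single_eq_of_ne (by simpa using hj)]

end MatrixCircuit

open MatrixCircuit (ofForms pull_ofForms_single exists_pull_ofForms)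

/-- The cone of the points at which all linear forms in `L` are nonnegative. -/
def cone {n : ℕ} (L : List (Fin n → 𝕜)) : OrdCircuit 𝕜 n 0 := (ofForms L).geqZero

/-- The projection of a cone along the last coordinate. -/
def projCone {n : ℕ} (M : List (Fin (n + 1) → 𝕜)) : OrdCircuit 𝕜 n 0 :=
  (Term.id n ⊠ coDelete) ;; cone M

variable [Field 𝕜] [LinearOrder 𝕜]

/-- The predicate `P` entails that the linear form `v` is nonnegative. -/
def Entails {n : ℕ} (P : OrdCircuit 𝕜 n 0) (v : Fin n → 𝕜) : Prop := P ≼ row n v ;; pos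

section Cone

theorem posN_succ (n : ℕ) :
    (posN (n + 1) : OrdCircuit 𝕜 _ _) ≋ (posN n ⊠ pos : OrdCircuit 𝕜 (n + 1) 0) :=
  interchange (geqs n) (coZeros n) geq coZero

theorem posN_add (n m : ℕ) :
    (posN (n + m) : OrdCircuit 𝕜 _ _) ≋ (posN n ⊠ posN m : OrdCircuit 𝕜 (n + m) 0) := by
  induction m with
  | zero => exact .symm (IHPEq.trans (.tensor (.refl _) (id_comp _)) (tensor_unit _))
  | succ m ih =>
    exact (posN_succ (n + m)).trans ((IHPEq.tensor ih (.refl _)).trans ((tensor_assoc _ _ _).trans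
      (.tensor (.refl _) (posN_succ m).symm)))

theorem posN_le_deleteN (n : ℕ) : (posN n : OrdCircuit 𝕜 n 0) ≼ (deleteN n : OrdCircuit 𝕜 n 0) := by
  induction n with
  | zero => exact (id_comp _).1
  | succ n ih => exact (posN_succ n).1.trans (.tensor ih (pos_le_delete 𝕜))

theorem posN_le_copyN (n : ℕ) :
    (posN n : OrdCircuit 𝕜 n 0) ≼ (copyN n ;; (posN n ⊠ posN n) : OrdCircuit 𝕜 n 0) := by
  induction n with
  | zero => exact ((id_comp _).trans ((IHPEq.tensor (id_comp _) (id_comp _)).trans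
      (id_tensor_id 𝕜 0 0))).2.trans (.refl _) |> fun h => (id_comp _).1.trans h
  | succ n ih =>
    calc (posN (n + 1) : OrdCircuit 𝕜 _ _) ≋ (posN n ⊠ pos : OrdCircuit 𝕜 (n + 1) 0) := posN_succ n
      _ ≼ (copyN n ;; (posN n ⊠ posN n)) ⊠ (copy ;; (pos ⊠ pos :)) :=
          .tensor ih (pos_le_copy 𝕜)
      _ ≋ (copyN n ⊠ copy) ;; ((posN n ⊠ posN n) ⊠ (pos ⊠ pos)) := (interchange _ _ _ _).symm
      _ ≋ (copyN n ⊠ copy) ;; (((posN n ⊠ posN n) ⊠ (pos ⊠ pos)) ;; Term.shuffle 0 0 0 0) :=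
          .comp (.refl _) ((IHPEq.comp (.refl _) (shuffle_unit 𝕜 0 0 0)).trans (comp_id _)).symm
      _ ≋ (copyN n ⊠ copy) ;; (Term.shuffle n n 1 1 ;; ((posN n ⊠ pos) ⊠ (posN n ⊠ pos))) :=
          .comp (.refl _) (shuffle_natural _ _ _ _)
      _ ≋ ((copyN n ⊠ copy) ;; Term.shuffle n n 1 1) ;; ((posN n ⊠ pos) ⊠ (posN n ⊠ pos)) :=
          (comp_assoc _ _ _).symm
      _ ≋ copyN (n + 1) ;; (posN (n + 1) ⊠ posN (n + 1)) :=
          .comp (copyN_succ 𝕜 n).symm (.tensor (posN_succ n).symm (posN_succ n).symm)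

/-- Nonnegative combinations of nonnegative inputs are nonnegative: scale each input, then add with
`pos_tensor_pos_le`. -/
theorem posN_entails (n : ℕ) {v : Fin n → 𝕜} (hv : ∀ i, 0 ≤ v i) : Entails (posN n) v := by
  unfold Entails
  induction n with
  | zero => exact (id_comp _).1.trans (id_le_zero_pos 𝕜)
  | succ n ih =>
    calc (posN (n + 1) : OrdCircuit 𝕜 _ _) ≋ (posN n ⊠ pos : OrdCircuit 𝕜 (n + 1) 0) := posN_succ n
      _ ≼ (row n (fun i => v i.castSucc) ;; pos) ⊠ (scalar (v (Fin.last n)) ;; pos) :=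
          .tensor (ih fun i => hv _) (pos_le_scalar_pos (hv _))
      _ ≋ (row n (fun i => v i.castSucc) ⊠ scalar (v (Fin.last n))) ;; (pos ⊠ pos) :=
          (interchange _ _ _ _).symm
      _ ≼ (row n (fun i => v i.castSucc) ⊠ scalar (v (Fin.last n))) ;; (add ;; pos) :=
          .comp (.refl _) (pos_tensor_pos_le 𝕜)
      _ ≋ row (n + 1) v ;; pos := (comp_assoc _ _ _).symm

variable {n m k : ℕ}

theorem comp_geqZero (B : MatrixCircuit 𝕜 k n) (A : MatrixCircuit 𝕜 n m) :
    B.toOrd ;; A.geqZero ≋ MatrixCircuit.geqZero (B ;; A) :=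
  (comp_assoc _ _ _).symm

theorem geqZero_le_deleteN (A : MatrixCircuit 𝕜 n m) :
    A.geqZero ≼ (deleteN n : OrdCircuit 𝕜 n 0) :=
  calc A.geqZero ≼ A.toOrd ;; deleteN m := .comp (.refl _) (posN_le_deleteN m)
    _ ≋ deleteN n := deleteN_natural A

theorem geqZero_le_copyN (A : MatrixCircuit 𝕜 n m) :
    A.geqZero ≼ (copyN n ;; (A.geqZero ⊠ A.geqZero) : OrdCircuit 𝕜 n 0) :=
  calc A.geqZero ≼ A.toOrd ;; (copyN m ;; (posN m ⊠ posN m)) := .comp (.refl _) (posN_le_copyN m)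
    _ ≋ (copyN n ;; (A.toOrd ⊠ A.toOrd)) ;; (posN m ⊠ posN m) :=
        (comp_assoc _ _ _).symm.trans (.comp (copyN_natural A) (.refl _))
    _ ≋ copyN n ;; (A.geqZero ⊠ A.geqZero) :=
        (comp_assoc _ _ _).trans (.comp (.refl _) (interchange _ _ _ _))

theorem Entails.comp {P : OrdCircuit 𝕜 m 0} {v : Fin m → 𝕜} (h : Entails P v)
    (A : MatrixCircuit 𝕜 n m) : Entails (A.toOrd ;; P) (pull A v) :=
  calc A.toOrd ;; P ≼ A.toOrd ;; (row m v ;; pos) := .comp (.refl _) h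
    _ ≋ (A.toOrd ;; row m v) ;; pos := (comp_assoc _ _ _).symm
    _ ≋ row n (pull A v) ;; pos := .comp (comp_row A v) (.refl _)

theorem Entails.mono {P Q : OrdCircuit 𝕜 n 0} {v : Fin n → 𝕜} (h : Entails P v) (hQ : Q ≼ P) :
    Entails Q v := hQ.trans h

theorem geqZero_entails (A : MatrixCircuit 𝕜 n m) {v : Fin m → 𝕜} (hv : ∀ i, 0 ≤ v i) :
    Entails A.geqZero (pull A v) := (posN_entails m hv).comp A

/-- Predicates given by linear inequalities. -/
def IsCone (P : OrdCircuit 𝕜 n 0) : Prop :=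
  P ≼ (deleteN n : OrdCircuit 𝕜 n 0) ∧ P ≼ (copyN n ;; (P ⊠ P) : OrdCircuit 𝕜 n 0)

theorem isCone_geqZero (A : MatrixCircuit 𝕜 n m) : IsCone A.geqZero :=
  ⟨geqZero_le_deleteN A, geqZero_le_copyN A⟩

theorem isCone_cone (L : List (Fin n → 𝕜)) : IsCone (cone L) := isCone_geqZero _

/-- The two conditions in `IsCone` are weakening and contraction. Contraction supplies one copy of
`P` for each row of `A`; weakening discards `P` when no rows are left. -/
theorem IsCone.le_geqZero {P : OrdCircuit 𝕜 n 0} (hP : IsCone P) {A : MatrixCircuit 𝕜 n m}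
    (h : ∀ i, Entails P (pull A (Pi.single i 1))) : P ≼ A.geqZero := by
  induction m with
  | zero =>
    exact hP.1.trans (((IHPEq.comp (.refl _) (id_comp _)).trans (deleteN_natural A)).2)
  | succ m ih =>
    let A₁ : MatrixCircuit 𝕜 n m := A ;; (Term.id m ⊠ MatrixCircuit.delete)
    let A₂ : MatrixCircuit 𝕜 n 1 := A ;; (MatrixCircuit.deleteN m ⊠ MatrixCircuit.wire :)
    have h₁ : P ≼ A₁.geqZero := by
      refine ih fun i => ?_
      have : pull A₁ (Pi.single i 1) = pull A (Pi.single i.castSucc 1) := by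
        change pull A (pull (Term.id m ⊠ MatrixCircuit.delete) _) = _
        rw [MatrixCircuit.pull_id_tensor_delete, MatrixCircuit.snoc_single]
      rw [this]
      exact h _
    have h₂ : P ≼ A₂.toOrd ;; pos := by
      have : pull A₂ 1 = pull A (Pi.single (Fin.last m) 1) := by
        change pull A (pull (MatrixCircuit.deleteN m ⊠ MatrixCircuit.wire) 1) = _
        rw [MatrixCircuit.pull_deleteN_tensor_wire]
      have h' := h (Fin.last m)
      rw [← this] at h'
      exact h'.trans (IHPEq.comp (toOrd_eq_row A₂) (.refl _)).2
    calc P ≼ copyN n ;; (P ⊠ P) := hP.2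
      _ ≼ copyN n ;; ((A₁.toOrd ;; posN m) ⊠ (A₂.toOrd ;; pos)) :=
          .comp (.refl _) (.tensor h₁ h₂)
      _ ≋ (copyN n ;; (A₁.toOrd ⊠ A₂.toOrd)) ;; (posN m ⊠ pos) :=
          (IHPEq.comp (.refl _) (interchange _ _ _ _).symm).trans (comp_assoc _ _ _).symm
      _ ≋ A.toOrd ;; posN (m + 1) := .comp (eq_pair A).symm (posN_succ m).symm

theorem IsCone.le_cone {P : OrdCircuit 𝕜 n 0} (hP : IsCone P) {L : List (Fin n → 𝕜)}
    (h : ∀ v ∈ L, Entails P v) : P ≼ cone L :=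
  hP.le_geqZero fun i => h _ (pull_ofForms_single L i)

theorem cone_le {L M : List (Fin n → 𝕜)} (h : ∀ v ∈ M, Entails (cone L) v) :
    cone L ≼ cone M := (isCone_cone L).le_cone h

theorem single_nonneg [IsStrictOrderedRing 𝕜] (i j : Fin n) :
    0 ≤ (Pi.single i 1 : Fin n → 𝕜) j := by
  by_cases h : j = i
  · subst h; simp
  · rw [Pi.single_eq_of_ne h]

theorem entails_of_mem [IsStrictOrderedRing 𝕜] {L : List (Fin n → 𝕜)} {v : Fin n → 𝕜}
    (hv : v ∈ L) : Entails (cone L) v := by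
  obtain ⟨i, rfl⟩ := exists_pull_ofForms hv
  exact geqZero_entails _ (single_nonneg i)

theorem IsCone.entails_add {P : OrdCircuit 𝕜 n 0} (hP : IsCone P) {v w : Fin n → 𝕜}
    (hv : Entails P v) (hw : Entails P w) : Entails P (v + w) :=
  calc P ≼ copyN n ;; (P ⊠ P) := hP.2
    _ ≼ copyN n ;; ((row n v ;; pos) ⊠ (row n w ;; pos)) := .comp (.refl _) (.tensor hv hw)
    _ ≋ copyN n ;; ((row n v ⊠ row n w) ;; (pos ⊠ pos)) :=
        .comp (.refl _) (interchange _ _ _ _).symm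
    _ ≼ copyN n ;; ((row n v ⊠ row n w) ;; (add ;; pos)) :=
        .comp (.refl _) (.comp (.refl _) (pos_tensor_pos_le 𝕜))
    _ ≋ (copyN n ;; ((row n v ⊠ row n w) ;; add)) ;; pos :=
        (IHPEq.comp (.refl _) (comp_assoc _ _ _).symm).trans (comp_assoc _ _ _).symm
    _ ≋ row n (v + w) ;; pos := by
        refine .comp ?_ (.refl _)
        refine toOrd_eq_of_pull (A := MatrixCircuit.copyN n ;;
          ((MatrixCircuit.row n v ⊠ MatrixCircuit.row n w) ;; MatrixCircuit.add))
          (B := MatrixCircuit.row n (v + w)) fun u => ?_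
        funext i
        simp only [pull, MatrixCircuit.pull_copyN, MatrixCircuit.pull_row, Fin.addCases_left,
          Fin.addCases_right, MatrixCircuit.add, smul_add, Pi.add_apply]

theorem Entails.smul {P : OrdCircuit 𝕜 n 0} {v : Fin n → 𝕜} (hv : Entails P v) {r : 𝕜}
    (hr : 0 ≤ r) : Entails P (r • v) :=
  calc P ≼ row n v ;; pos := hv
    _ ≼ row n v ;; (scalar r ;; pos) := .comp (.refl _) (pos_le_scalar_pos hr)
    _ ≋ (row n v ;; scalar r) ;; pos := (comp_assoc _ _ _).symm
    _ ≋ row n (r • v) ;; pos := by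
        refine .comp ?_ (.refl _)
        refine toOrd_eq_of_pull (A := MatrixCircuit.row n v ;; MatrixCircuit.scalar r)
          (B := MatrixCircuit.row n (r • v)) fun u => ?_
        funext i
        simp only [pull, MatrixCircuit.pull_row, MatrixCircuit.scalar, Pi.smul_apply, smul_eq_mul]
        ring

variable [IsStrictOrderedRing 𝕜]

theorem comp_cone (A : MatrixCircuit 𝕜 n m) (L : List (Fin m → 𝕜)) :
    A.toOrd ;; cone L ≋ cone (L.map (pull A)) := by
  have hA : A.toOrd ;; cone L ≋ MatrixCircuit.geqZero (A ;; ofForms L) := comp_geqZero A _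
  constructor
  · refine hA.1.trans ((isCone_geqZero _).le_cone fun v hv => ?_)
    obtain ⟨w, hw, rfl⟩ := List.mem_map.1 hv
    exact ((entails_of_mem hw).comp A).mono hA.2
  · exact (IsCone.le_geqZero (A := A ;; ofForms L) (isCone_cone _) fun i => entails_of_mem
      (List.mem_map_of_mem (f := pull A) (pull_ofForms_single L i))).trans hA.2

/-- A conjunction of two systems is the system of all outputs of the paired circuit, and a form of
either list is selected by a unit weight on its own block. -/
theorem copyN_cone_le (L M : List (Fin n → 𝕜)) :
    copyN n ;; (cone L ⊠ cone M) ≼ cone (L ++ M) := by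
  let A : MatrixCircuit 𝕜 n (L.length + M.length) :=
    MatrixCircuit.copyN n ;; (ofForms L ⊠ ofForms M)
  have hA : copyN n ;; (cone L ⊠ cone M) ≋ A.geqZero :=
    (IHPEq.comp (.refl _) ((interchange _ _ _ _).symm.trans
      (.comp (.refl _) (posN_add _ _).symm))).trans (comp_assoc _ _ _).symm
  have hp (u : Fin L.length → 𝕜) (w : Fin M.length → 𝕜) :
      pull A (Fin.addCases u w) = pull (ofForms L) u + pull (ofForms M) w := by
    funext i
    change pull (MatrixCircuit.copyN n) (pull (ofForms L ⊠ ofForms M) _) i = _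
    simp only [MatrixCircuit.pull_copyN, pull, Fin.addCases_left, Fin.addCases_right, Pi.add_apply]
  refine hA.1.trans ((isCone_geqZero _).le_cone fun v hv => ?_)
  rcases List.mem_append.1 hv with hv | hv <;> obtain ⟨i, rfl⟩ := exists_pull_ofForms hv
  · have := geqZero_entails A (v := Fin.addCases (Pi.single i 1) 0) fun j => by
      refine Fin.addCases (fun j => ?_) (fun j => ?_) j
      · rw [Fin.addCases_left]; exact single_nonneg i j
      · rw [Fin.addCases_right]; exact le_rfl
    rwa [hp, MatrixCircuit.pull_ofForms_zero, add_zero] at this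
  · have := geqZero_entails A (v := Fin.addCases 0 (Pi.single i 1)) fun j => by
      refine Fin.addCases (fun j => ?_) (fun j => ?_) j
      · rw [Fin.addCases_left]; exact le_rfl
      · rw [Fin.addCases_right]; exact single_nonneg i j
    rwa [hp, MatrixCircuit.pull_ofForms_zero, zero_add] at this

end Cone

/-! ### Existential quantification over the last variable. -/

section Projection

variable [IsStrictOrderedRing 𝕜] {n k : ℕ}

/-- A linear form, seen as a linear form in one more variable. -/
def weaken (v : Fin n → 𝕜) : Fin (n + 1) → 𝕜 := Fin.snoc v 0

/-- A linear form, seen as a linear form in one more, last but one, variable. -/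
def weakenMiddle (v : Fin (n + 1) → 𝕜) : Fin (n + 1 + 1) → 𝕜 :=
  Fin.snoc (weaken fun i => v i.castSucc) (v (Fin.last n))

omit [IsStrictOrderedRing 𝕜] in
theorem projCone_mono {M N : List (Fin (n + 1) → 𝕜)} (h : ∀ v ∈ N, Entails (cone M) v) :
    projCone M ≼ projCone N := .comp (.refl _) (cone_le h)

theorem comp_projCone (A : MatrixCircuit 𝕜 k n) (M : List (Fin (n + 1) → 𝕜)) :
    A.toOrd ;; projCone M ≋ projCone (M.map (pull (A ⊠ MatrixCircuit.wire))) :=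
  calc A.toOrd ;; projCone M
      ≋ (A.toOrd ;; (Term.id n ⊠ coDelete)) ;; cone M := (comp_assoc _ _ _).symm
    _ ≋ ((Term.id k ⊠ coDelete) ;; (A.toOrd ⊠ wire)) ;; cone M := by
        refine .comp ?_ (.refl _)
        refine IHPEq.trans (.comp (tensor_unit _).symm (.refl _)) ?_
        exact whisker_exchange A.toOrd coDelete
    _ ≋ (Term.id k ⊠ coDelete) ;; (MatrixCircuit.toOrd (A ⊠ MatrixCircuit.wire) ;; cone M) :=
        comp_assoc _ _ _
    _ ≋ projCone (M.map (pull (A ⊠ MatrixCircuit.wire))) := .comp (.refl _) (comp_cone _ _)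

omit [IsStrictOrderedRing 𝕜] in
theorem proj_delete (P : OrdCircuit 𝕜 n 0) :
    (Term.id n ⊠ coDelete) ;; ((Term.id n ⊠ delete) ;; P) ≋ P :=
  (comp_assoc _ _ _).symm.trans ((IHPEq.comp ((interchange _ _ _ _).trans ((IHPEq.tensor (id_comp _)
    (coDelete_delete 𝕜)).trans (tensor_unit _))) (.refl _)).trans (id_comp _))

theorem cone_weaken (L : List (Fin n → 𝕜)) :
    (Term.id n ⊠ delete) ;; cone L ≋ cone (L.map weaken) := by
  have h : (weaken : (Fin n → 𝕜) → _) = pull (Term.id n ⊠ MatrixCircuit.delete) := by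
    funext v; exact (MatrixCircuit.pull_id_tensor_delete v).symm
  rw [h]
  exact comp_cone (Term.id n ⊠ MatrixCircuit.delete) L

theorem projCone_weaken (L : List (Fin n → 𝕜)) : projCone (L.map weaken) ≋ cone L :=
  (IHPEq.comp (.refl _) (cone_weaken L).symm).trans (proj_delete _)

-- Frobenius reciprocity: a predicate not involving the quantified variable can be moved under the
-- quantifier.
omit [IsStrictOrderedRing 𝕜] in
theorem copyN_projCone (P : OrdCircuit 𝕜 n 0) (Q : OrdCircuit 𝕜 (n + 1) 0) :
    copyN n ;; (P ⊠ ((Term.id n ⊠ coDelete) ;; Q)) ≋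
      (Term.id n ⊠ coDelete) ;; (copyN (n + 1) ;; (((Term.id n ⊠ delete) ;; P) ⊠ Q)) := by
  -- An identity between matrix circuits, settled by comparing matrices instead of by diagrams.
  have h : copyN (n + 1) ;; ((Term.id n ⊠ delete) ⊠ Term.id (n + 1) :) ≋
      (copyN n ⊠ wire : OrdCircuit 𝕜 (n + 1) (n + n + 1)) := by
    refine toOrd_eq_of_pull (A := MatrixCircuit.copyN (n + 1) ;;
      ((Term.id n ⊠ MatrixCircuit.delete) ⊠ Term.id (n + 1)))
      (B := (MatrixCircuit.copyN n ⊠ MatrixCircuit.wire : MatrixCircuit 𝕜 (n + 1) (n + n + 1)))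
      fun v => ?_
    funext i
    change pull (MatrixCircuit.copyN (n + 1)) (pull ((Term.id n ⊠ MatrixCircuit.delete) ⊠
      Term.id (n + 1)) v) i = _
    rw [MatrixCircuit.pull_copyN]
    change Fin.addCases (motive := fun _ => 𝕜) _ _ _ + Fin.addCases (motive := fun _ => 𝕜) _ _ _ = _
    rw [Fin.addCases_left, Fin.addCases_right]
    refine Fin.lastCases ?_ (fun i => ?_) i
    · rw [MatrixCircuit.pull_tensor_last, MatrixCircuit.pull_tensor_last]
      exact zero_add _
    · rw [MatrixCircuit.pull_tensor_castSucc, MatrixCircuit.pull_tensor_castSucc,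
        MatrixCircuit.pull_copyN]
      rfl
  calc copyN n ;; (P ⊠ ((Term.id n ⊠ coDelete) ;; Q))
      ≋ copyN n ;; ((Term.id n ⊠ (Term.id n ⊠ coDelete)) ;; (P ⊠ Q)) :=
        .comp (.refl _) ((IHPEq.tensor (id_comp _).symm (.refl _)).trans (interchange _ _ _ _).symm)
    _ ≋ (copyN n ;; ((Term.id n ⊠ Term.id n) ⊠ coDelete :)) ;; (P ⊠ Q :) :=
        (comp_assoc _ _ _).symm.trans
          (.comp (.comp (.refl _) (tensor_assoc _ _ _).symm) (.refl _))
    _ ≋ ((Term.id n ⊠ coDelete) ;; (copyN n ⊠ wire :)) ;; (P ⊠ Q :) := by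
        refine .comp ?_ (.refl _)
        refine IHPEq.trans (.comp (tensor_unit _).symm (.tensor (id_tensor_id 𝕜 _ _) (.refl _))) ?_
        exact whisker_exchange (copyN n) coDelete
    _ ≋ ((Term.id n ⊠ coDelete) ;; (copyN (n + 1) ;;
          ((Term.id n ⊠ delete) ⊠ Term.id (n + 1) :))) ;; (P ⊠ Q :) :=
        .comp (.comp (.refl _) h.symm) (.refl _)
    _ ≋ (Term.id n ⊠ coDelete) ;; (copyN (n + 1) ;;
          (((Term.id n ⊠ delete) ⊠ Term.id (n + 1) :) ;; (P ⊠ Q :))) :=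
        (comp_assoc _ _ _).trans (.comp (.refl _) (comp_assoc _ _ _))
    _ ≋ _ := .comp (.refl _) (.comp (.refl _) ((interchange _ _ _ _).trans
        (.tensor (.refl _) (id_comp _))))

/-- A solution of `M` that depends on a point of `cone L` may use the inequalities in `L`. -/
theorem cone_le_projCone_append {L : List (Fin n → 𝕜)} {M : List (Fin (n + 1) → 𝕜)}
    (h : cone L ≼ projCone M) : cone L ≼ projCone (L.map weaken ++ M) :=
  calc cone L ≼ copyN n ;; (cone L ⊠ cone L) := (isCone_cone L).2
    _ ≼ copyN n ;; (cone L ⊠ projCone M) := .comp (.refl _) (.tensor (.refl _) h)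
    _ ≋ (Term.id n ⊠ coDelete) ;; (copyN (n + 1) ;; (((Term.id n ⊠ delete) ;; cone L) ⊠ cone M)) :=
        copyN_projCone _ _
    _ ≼ (Term.id n ⊠ coDelete) ;; (copyN (n + 1) ;; (cone (L.map weaken) ⊠ cone M)) :=
        .comp (.refl _) (.comp (.refl _) (.tensor (cone_weaken L).1 (.refl _)))
    _ ≼ projCone (L.map weaken ++ M) := .comp (.refl _) (copyN_cone_le _ _)

/-- The outer variable is absent from the forms and is dropped. It sits last but one because the
inner quantifier always binds the last coordinate. -/
theorem projCone_projCone_weakenMiddle (N : List (Fin (n + 1) → 𝕜)) :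
    (Term.id n ⊠ coDelete) ;; projCone (N.map weakenMiddle) ≋ projCone N := by
  have h : (weakenMiddle : (Fin (n + 1) → 𝕜) → _) =
      pull ((Term.id n ⊠ MatrixCircuit.delete) ⊠ MatrixCircuit.wire) := by
    funext v i
    refine Fin.lastCases ?_ (fun i => ?_) i
    · rw [MatrixCircuit.pull_tensor_last, weakenMiddle, Fin.snoc_last]; rfl
    · rw [MatrixCircuit.pull_tensor_castSucc, MatrixCircuit.pull_id_tensor_delete, weakenMiddle,
        Fin.snoc_castSucc]; rfl
  rw [h]
  refine (IHPEq.comp (.refl _) (comp_projCone (Term.id n ⊠ MatrixCircuit.delete) N).symm).trans ?_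
  exact proj_delete _

/-- Solving `N` in two steps, using a solution of `M`. -/
theorem cone_le_projCone_trans {L : List (Fin n → 𝕜)} {M N : List (Fin (n + 1) → 𝕜)}
    (h : cone L ≼ projCone M)
    (h' : cone (L.map weaken ++ M) ≼ projCone (N.map weakenMiddle)) : cone L ≼ projCone N :=
  (cone_le_projCone_append h).trans
    ((Le.comp (.refl _) h').trans (projCone_projCone_weakenMiddle N).1)

/-- The substitution `x ↦ -x` is invertible, so an arbitrary number negated is again an arbitrary
number. -/
theorem projCone_neg (M : List (Fin (n + 1) → 𝕜)) :
    projCone (M.map fun v => (Fin.snoc (fun i => v i.castSucc) (-v (Fin.last n)) :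
      Fin (n + 1) → 𝕜)) ≋ projCone M := by
  have h : (fun v => (Fin.snoc (fun i => v i.castSucc) (-v (Fin.last n)) : Fin (n + 1) → 𝕜)) =
      pull (Term.id n ⊠ MatrixCircuit.scalar (-1 : 𝕜)) := by
    funext v i
    refine Fin.lastCases ?_ (fun i => ?_) i
    · rw [MatrixCircuit.pull_tensor_last, Fin.snoc_last]; exact (neg_one_mul _).symm
    · rw [MatrixCircuit.pull_tensor_castSucc, Fin.snoc_castSucc]; rfl
  rw [h]
  refine (IHPEq.comp (.refl _) (comp_cone _ M).symm).trans ((comp_assoc _ _ _).symm.trans ?_)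
  exact .comp ((interchange _ _ _ _).trans (.tensor (id_comp _)
    (coDelete_scalar (r := (-1 : 𝕜)) (neg_ne_zero.2 one_ne_zero) :))) (.refl _)

end Projection
end PolyCone

/-! ### The spider and direction axioms as existence statements. -/

namespace PolyCone

open OrdCircuit
open MatrixCircuit (pull)

variable {𝕜 : Type*} [Field 𝕜] [LinearOrder 𝕜]

section Slide

theorem slide_tensor {a b k : ℕ} (P : OrdCircuit 𝕜 k 0) :
    ((Term.id a ⊠ P) ⊠ Term.id b) ≋
      (Term.sym a k ⊠ Term.id b) ;; ((P ⊠ Term.id a) ⊠ Term.id b) := by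
  have h : (Term.id a ⊠ P) ≋ Term.sym a k ;; (P ⊠ Term.id a) :=
    calc (Term.id a ⊠ P) ≋ (Term.id a ⊠ P) ;; Term.id (a + 0) := (comp_id _).symm
      _ ≋ (Term.id a ⊠ P) ;; Term.sym a 0 := .comp (.refl _) (sym_zero_right 𝕜 a).symm
      _ ≋ Term.sym a k ;; (P ⊠ Term.id a) := sym_natural _ _
  exact (IHPEq.tensor h (.refl _)).trans (comp_tensor_id _ _ _)

/-- A predicate on inner wires is carried to the left edge, so that two nested systems appear side
by side and can be read as a single `geqZero`. -/
theorem slide {a b k : ℕ} (P : OrdCircuit 𝕜 k 0) (Q : OrdCircuit 𝕜 (a + b) 0) :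
    ((Term.id a ⊠ P) ⊠ Term.id b) ;; Q ≋
      Term.cast rfl (Nat.add_assoc k a b) (Term.sym a k ⊠ Term.id b) ;; (P ⊠ Q) := by
  let S : OrdCircuit 𝕜 (a + k + b) (k + (a + b)) :=
    Term.cast rfl (Nat.add_assoc k a b) (Term.sym a k ⊠ Term.id b)
  have h : (P ⊠ Term.id a) ⊠ Term.id b ≋ P ⊠ Term.id (a + b) :=
    (tensor_assoc _ _ _).trans (.tensor (.refl _) (id_tensor_id 𝕜 a b))
  have hQ : Term.id 0 ⊠ Q ≋ Q := unit_tensor Q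
  calc ((Term.id a ⊠ P) ⊠ Term.id b) ;; Q
      ≋ (S ;; (P ⊠ Term.id (a + b))) ;; (Term.id 0 ⊠ Q) :=
        .comp ((slide_tensor P).trans (.comp (IHPEq.cast _ _ _).symm h)) hQ.symm
    _ ≋ S ;; ((P ⊠ Term.id (a + b)) ;; (Term.id 0 ⊠ Q)) := comp_assoc _ _ _
    _ ≋ S ;; (P ⊠ Q) := .comp (.refl _) (tensor_eq_left P Q).symm

end Slide

section Bend

variable (𝕜)

theorem coCopy_cap : ((wire ⊠ coCopy :) ;; cap : OrdCircuit 𝕜 3 0) ≋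
    ((coCopy ⊠ wire :) ;; cap : OrdCircuit 𝕜 3 0) :=
  (comp_assoc (wire ⊠ coCopy : OrdCircuit 𝕜 3 2) coCopy delete).symm.trans
    ((IHPEq.comp (ih_op_eq .copy_assoc).symm (.refl _)).trans
      (comp_assoc (coCopy ⊠ wire : OrdCircuit 𝕜 3 2) coCopy delete))

theorem copy_cap_left : ((wire ⊠ copy :) ;; (cap ⊠ wire :) : OrdCircuit 𝕜 2 1) ≋
    (coCopy : OrdCircuit 𝕜 2 1) :=
  calc ((wire ⊠ copy :) ;; (cap ⊠ wire :) : OrdCircuit 𝕜 2 1)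
      ≋ ((wire ⊠ copy :) ;; (coCopy ⊠ wire :)) ;; (delete ⊠ wire :) := .of_normalize (by cbv)
    _ ≋ (coCopy ;; copy) ;; (delete ⊠ wire :) := .comp (coCopy_copy_right 𝕜).symm (.refl _)
    _ ≋ coCopy ;; (copy ;; (delete ⊠ wire :)) := comp_assoc _ _ _
    _ ≋ coCopy ;; wire := .comp (.refl _) (copy_delete_left 𝕜)
    _ ≋ coCopy := comp_id _

theorem copy_cap_right : ((copy ⊠ wire :) ;; (wire ⊠ cap :) : OrdCircuit 𝕜 2 1) ≋
    (coCopy : OrdCircuit 𝕜 2 1) :=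
  calc ((copy ⊠ wire :) ;; (wire ⊠ cap :) : OrdCircuit 𝕜 2 1)
      ≋ ((copy ⊠ wire :) ;; (wire ⊠ coCopy :)) ;; (wire ⊠ delete :) := .of_normalize (by cbv)
    _ ≋ (coCopy ;; copy) ;; (wire ⊠ delete :) := .comp (coCopy_copy_left 𝕜).symm (.refl _)
    _ ≋ coCopy ;; (copy ;; (wire ⊠ delete :)) := comp_assoc _ _ _
    _ ≋ coCopy ;; wire := .comp (.refl _) (copy_delete_right 𝕜)
    _ ≋ coCopy := comp_id _

theorem coCopy_cap_left : ((coCopy ⊠ wire :) ;; cap : OrdCircuit 𝕜 3 0) ≋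
    ((Term.id 2 ⊠ copy :) ;; ((wire ⊠ cap) ⊠ wire :) ;; cap : OrdCircuit 𝕜 3 0) :=
  calc ((coCopy ⊠ wire :) ;; cap : OrdCircuit 𝕜 3 0)
      ≋ (wire ⊠ coCopy :) ;; cap := (coCopy_cap 𝕜).symm
    _ ≋ (wire ⊠ ((wire ⊠ copy :) ;; (cap ⊠ wire :)) :) ;; cap :=
        .comp (.tensor (.refl _) (copy_cap_left 𝕜).symm) (.refl _)
    _ ≋ _ := .of_normalize (by cbv)

theorem coCopy_antiCap_right : ((wire ⊠ coCopy :) ;; antiCap : OrdCircuit 𝕜 3 0) ≋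
    ((copy ⊠ Term.id 2 :) ;; ((wire ⊠ antiCap) ⊠ wire :) ;; antiCap : OrdCircuit 𝕜 3 0) :=
  calc ((wire ⊠ coCopy :) ;; antiCap : OrdCircuit 𝕜 3 0)
      ≋ (wire ⊠ coCopy :) ;; (neg 𝕜 ⊠ wire :) ;; cap := .comp (.refl _) (neg_cap 𝕜).symm
    _ ≋ (neg 𝕜 ⊠ Term.id 2 :) ;; ((wire ⊠ coCopy :) ;; cap) := .of_normalize (by cbv)
    _ ≋ (neg 𝕜 ⊠ Term.id 2 :) ;; ((coCopy ⊠ wire :) ;; cap) := .comp (.refl _) (coCopy_cap 𝕜)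
    _ ≋ (neg 𝕜 ⊠ Term.id 2 :) ;; ((((copy ⊠ wire :) ;; (wire ⊠ cap :)) ⊠ wire :) ;; cap) :=
        .comp (.refl _) (.comp (.tensor (copy_cap_right 𝕜).symm (.refl _)) (.refl _))
    _ ≋ ((neg 𝕜 ;; copy) ⊠ Term.id 2 :) ;; ((wire ⊠ cap) ⊠ wire :) ;; cap := .of_normalize (by cbv)
    _ ≋ ((copy ;; (neg 𝕜 ⊠ neg 𝕜 :)) ⊠ Term.id 2 :) ;; ((wire ⊠ cap) ⊠ wire :) ;; cap :=
        .comp (.tensor (ih_eq (.scalar_copy (-1 : 𝕜)) :) (.refl _)) (.refl _)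
    _ ≋ (copy ⊠ Term.id 2 :) ;; ((wire ⊠ ((neg 𝕜 ⊠ wire :) ;; cap)) ⊠ wire :) ;;
          (neg 𝕜 ⊠ wire :) ;; cap := .of_normalize (by cbv)
    _ ≋ (copy ⊠ Term.id 2 :) ;; ((wire ⊠ antiCap) ⊠ wire :) ;; antiCap :=
        .comp (.refl _) (.comp (.tensor (.tensor (.refl _) (neg_cap 𝕜)) (.refl _)) (neg_cap 𝕜))

theorem coDelete_antiCap : ((wire ⊠ coDelete :) ;; antiCap : OrdCircuit 𝕜 1 0) ≋
    (delete : OrdCircuit 𝕜 1 0) :=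
  calc ((wire ⊠ coDelete :) ;; antiCap : OrdCircuit 𝕜 1 0)
      ≋ (wire ⊠ coDelete :) ;; (neg 𝕜 ⊠ wire :) ;; cap := .comp (.refl _) (neg_cap 𝕜).symm
    _ ≋ neg 𝕜 ;; ((wire ⊠ coDelete :) ;; coCopy) ;; delete := .of_normalize (by cbv)
    _ ≋ neg 𝕜 ;; wire ;; delete := .comp (.refl _) (.comp (coDelete_coCopy_right 𝕜) (.refl _))
    _ ≋ neg 𝕜 ;; delete := .comp (.refl _) (id_comp _)
    _ ≋ delete := scalar_delete (-1)

end Bend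

namespace MatrixCircuit

/-- The sums of the two inner and of the two outer inputs. -/
def crossAdd : MatrixCircuit 𝕜 4 2 := (Term.sym 1 2 ⊠ wire :) ;; (add ⊠ add :)

/-- The linear forms `a + u₁` and `a + u₂` in `(a, u₁, u₂)`, in reverse order. -/
def addBoth : MatrixCircuit 𝕜 3 2 := (copy ⊠ Term.id 2 :) ;; crossAdd

/-- The linear forms `b₁ - x` and `b₂ - x` in `(b₁, b₂, x)`, in reverse order. -/
def subBoth : MatrixCircuit 𝕜 3 2 :=
  (Term.id 2 ⊠ copy :) ;; ((Term.id 2 ⊠ scalar (-1 : 𝕜)) ⊠ scalar (-1 : 𝕜) :) ;; crossAdd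

/-- All sums of one of the first two and one of the last two inputs. -/
def pairwiseSums : MatrixCircuit 𝕜 4 4 :=
  (Term.id 2 ⊠ ((copy ⊠ copy :) ;; (wire ⊠ Term.sym 1 1 ⊠ wire :)) :) ;;
    (Term.sym 1 3 ⊠ Term.id 2 :) ;; (addBoth ⊠ addBoth :)

/-- The linear forms whose nonnegativity puts `x` below `b₁, b₂` and above `-a₁, -a₂`. -/
def bounds : MatrixCircuit 𝕜 5 4 :=
  (Term.id 4 ⊠ copy :) ;; (Term.sym 2 3 ⊠ Term.id 1 :) ;;
    (subBoth (𝕜 := 𝕜) ⊠ ((Term.id 2 ⊠ copy :) ;; crossAdd) :)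

/-- The linear forms `x - u` and `a + x` in `(a, u, x)`. -/
def lowerBounds : MatrixCircuit 𝕜 3 2 :=
  (Term.id 2 ⊠ copy :) ;; (Term.sym 1 2 ⊠ Term.id 1 :) ;;
    ((Term.sym 1 1 ;; (wire ⊠ scalar (-1 : 𝕜) :) ;; add) ⊠ add :)

omit [LinearOrder 𝕜]

theorem pull_pairwiseSums (w : Fin 4 → 𝕜) :
    pull pairwiseSums w = ![w 3 + w 2, w 1 + w 0, w 0 + w 2, w 1 + w 3] := by
  funext i; fin_cases i <;> rfl

theorem pull_bounds (w : Fin 4 → 𝕜) : pull bounds w =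
    ![w 3, w 2, w 1, w 0, (-1 * w 0 + -1 * w 1) + (w 2 + w 3)] := by
  funext i; fin_cases i <;> rfl

theorem pull_lowerBounds (w : Fin 2 → 𝕜) :
    pull lowerBounds w = ![w 1, -1 * w 0, w 0 + w 1] := by
  funext i; fin_cases i <;> rfl

end MatrixCircuit

section Spider

/-- Both pairs of wires, outer and inner, are opposite. -/
def bend : OrdCircuit 𝕜 4 0 := ((wire ⊠ antiCap) ⊠ wire :) ;; antiCap

/-- A common lower bound of two inputs. -/
def lowerBound : OrdCircuit 𝕜 2 1 := (geq ⊠ geq :) ;; coCopy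

variable (𝕜)

-- A circuit with one output is recovered from its graph, a predicate with the output turned into an
-- input. This introduces the explicit existential variable needed to turn a relation into a
-- projected cone.
variable {𝕜} in
theorem eq_cup_cap {k : ℕ} (G : OrdCircuit 𝕜 k 1) :
    G ≋ ((Term.id k ⊠ cup) ;; (((G ⊠ wire :) ;; cap) ⊠ wire :) : OrdCircuit 𝕜 k 1) :=
  calc G ≋ G ;; wire := (comp_id _).symm
    _ ≋ G ;; ((wire ⊠ cup :) ;; (cap ⊠ wire :)) := .comp (.refl _) (cup_cap 𝕜).symm
    _ ≋ ((G ⊠ Term.id 0) ;; (wire ⊠ cup :)) ;; (cap ⊠ wire :) :=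
        (comp_assoc _ _ _).symm.trans (.comp (.comp (tensor_unit _).symm (.refl _)) (.refl _))
    _ ≋ ((Term.id k ⊠ cup) ;; (G ⊠ Term.id 2)) ;; (cap ⊠ wire :) :=
        .comp (whisker_exchange G cup) (.refl _)
    _ ≋ (Term.id k ⊠ cup) ;; ((G ⊠ Term.id 2) ;; (cap ⊠ wire :)) := comp_assoc _ _ _
    _ ≋ (Term.id k ⊠ cup) ;; (((G ⊠ wire :) ⊠ wire :) ;; (cap ⊠ wire :)) :=
        .comp (.refl _) (.comp ((IHPEq.tensor (.refl _) (id_tensor_id 𝕜 1 1).symm).trans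
          (tensor_assoc _ _ _).symm) (.refl _))
    _ ≋ (Term.id k ⊠ cup) ;; (((G ⊠ wire :) ;; cap) ⊠ wire :) :=
        .comp (.refl _) (comp_tensor_id _ _ _).symm

theorem add_pos_add_pos : ((wire ⊠ (add ;; pos)) ⊠ wire :) ;; (add ;; pos) ≋
    (MatrixCircuit.crossAdd.geqZero : OrdCircuit 𝕜 4 0) :=
  (slide (a := 1) (b := 1) (add ;; pos : OrdCircuit 𝕜 2 0) (add ;; pos)).trans
    (.of_normalize (t := (Term.sym 1 2 ⊠ Term.id 1 :) ;; ((add ;; pos) ⊠ (add ;; pos) :))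
      (by cbv))

variable [IsStrictOrderedRing 𝕜]

theorem geq_bend : ((Term.id 2 ⊠ geq) ⊠ geq :) ;; bend ≋
    (MatrixCircuit.crossAdd.geqZero : OrdCircuit 𝕜 4 0) :=
  calc (((Term.id 2 ⊠ geq) ⊠ geq :) ;; bend : OrdCircuit 𝕜 4 0)
      ≋ ((wire ⊠ ((wire ⊠ geq :) ;; antiCap)) ⊠ wire :) ;; ((wire ⊠ geq :) ;; antiCap) :=
        .of_normalize (by cbv)
    _ ≋ ((wire ⊠ (add ;; pos)) ⊠ wire :) ;; (add ;; pos) :=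
        .comp (.tensor (.tensor (.refl _) (add_pos_eq_right 𝕜).symm) (.refl _))
          (add_pos_eq_right 𝕜).symm
    _ ≋ _ := add_pos_add_pos 𝕜

theorem lowerBound_antiCap : (wire ⊠ lowerBound :) ;; antiCap ≋
    (MatrixCircuit.addBoth.geqZero : OrdCircuit 𝕜 3 0) :=
  calc ((wire ⊠ lowerBound :) ;; antiCap : OrdCircuit 𝕜 3 0)
      ≋ (wire ⊠ (geq ⊠ geq) :) ;; ((wire ⊠ coCopy :) ;; antiCap) := .of_normalize (by cbv)
    _ ≋ (wire ⊠ (geq ⊠ geq) :) ;; ((copy ⊠ Term.id 2 :) ;; bend) :=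
        .comp (.refl _) (coCopy_antiCap_right 𝕜)
    _ ≋ (copy ⊠ Term.id 2 :) ;; (((Term.id 2 ⊠ geq) ⊠ geq :) ;; bend) := .of_normalize (by cbv)
    _ ≋ (copy ⊠ Term.id 2 :) ;; MatrixCircuit.crossAdd.geqZero := .comp (.refl _) (geq_bend 𝕜)
    _ ≋ MatrixCircuit.addBoth.geqZero := .of_normalize (by cbv)

theorem lowerBound_cap : (lowerBound ⊠ wire :) ;; cap ≋
    ((MatrixCircuit.subBoth (𝕜 := 𝕜)).geqZero : OrdCircuit 𝕜 3 0) :=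
  calc ((lowerBound ⊠ wire :) ;; cap : OrdCircuit 𝕜 3 0)
      ≋ ((geq ⊠ geq) ⊠ wire :) ;; ((coCopy ⊠ wire :) ;; cap) := .of_normalize (by cbv)
    _ ≋ ((geq ⊠ geq) ⊠ wire :) ;; ((Term.id 2 ⊠ copy :) ;; ((wire ⊠ cap) ⊠ wire :) ;; cap) :=
        .comp (.refl _) (coCopy_cap_left 𝕜)
    _ ≋ (Term.id 2 ⊠ copy :) ;; ((wire ⊠ ((geq ⊠ wire :) ;; cap)) ⊠ wire :) ;;
          ((geq ⊠ wire :) ;; cap) := .of_normalize (by cbv)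
    _ ≋ (Term.id 2 ⊠ copy :) ;; ((wire ⊠ ((wire ⊠ neg 𝕜 :) ;; add ;; pos)) ⊠ wire :) ;;
          ((wire ⊠ neg 𝕜 :) ;; add ;; pos) :=
        .comp (.refl _) (.comp (.tensor (.tensor (.refl _) (geq_cap 𝕜)) (.refl _)) (geq_cap 𝕜))
    _ ≋ (Term.id 2 ⊠ copy :) ;; ((Term.id 2 ⊠ neg 𝕜) ⊠ neg 𝕜 :) ;;
          (((wire ⊠ (add ;; pos)) ⊠ wire :) ;; (add ;; pos)) := .of_normalize (by cbv)
    _ ≋ (Term.id 2 ⊠ copy :) ;; ((Term.id 2 ⊠ neg 𝕜) ⊠ neg 𝕜 :) ;;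
          MatrixCircuit.crossAdd.geqZero :=
        .comp (.refl _) (.comp (.refl _) (add_pos_add_pos 𝕜))
    _ ≋ (MatrixCircuit.subBoth (𝕜 := 𝕜)).geqZero := .of_normalize (by cbv)

omit [IsStrictOrderedRing 𝕜] in
theorem geqs_midSwap : ((geq ⊠ geq) ⊠ (geq ⊠ geq) :) ;; midSwap ≋
    (midSwap ;; ((geq ⊠ geq) ⊠ (geq ⊠ geq) :) : OrdCircuit 𝕜 4 4) :=
  calc (((geq ⊠ geq) ⊠ (geq ⊠ geq) :) ;; midSwap : OrdCircuit 𝕜 4 4)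
      ≋ (geq ⊠ ((geq ⊠ geq :) ;; Term.sym 1 1) ⊠ geq :) := .of_normalize (by cbv)
    _ ≋ (geq ⊠ (Term.sym 1 1 ;; (geq ⊠ geq :)) ⊠ geq :) :=
        .tensor (.tensor (.refl _) (sym_natural _ _)) (.refl _)
    _ ≋ midSwap ;; ((geq ⊠ geq) ⊠ (geq ⊠ geq) :) := .of_normalize (by cbv)

/-- This is the quantifier-free side of the spider. Bending an output against an input `a` replaces
it by `-a`, so each inequality `b ≥ -a` reads `a + b ≥ 0`. -/
theorem pairwiseSums_geqZero : (Term.id 2 ⊠ ((copy ⊠ copy :) ;; ((geq ⊠ geq) ⊠ (geq ⊠ geq) :) ;;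
      midSwap ;; (coCopy ⊠ coCopy :)) :) ;; bend ≋
    ((MatrixCircuit.pairwiseSums (𝕜 := 𝕜)).geqZero : OrdCircuit 𝕜 4 0) :=
  calc ((Term.id 2 ⊠ ((copy ⊠ copy :) ;; ((geq ⊠ geq) ⊠ (geq ⊠ geq) :) ;;
          midSwap ;; (coCopy ⊠ coCopy :)) :) ;; bend : OrdCircuit 𝕜 4 0)
      ≋ (Term.id 2 ⊠ ((copy ⊠ copy :) ;; (((geq ⊠ geq) ⊠ (geq ⊠ geq) :) ;;
          midSwap) ;; (coCopy ⊠ coCopy :)) :) ;; bend := .of_normalize (by cbv)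
    _ ≋ (Term.id 2 ⊠ ((copy ⊠ copy :) ;; (midSwap ;; ((geq ⊠ geq) ⊠ (geq ⊠ geq) :)) ;;
          (coCopy ⊠ coCopy :)) :) ;; bend :=
        .comp (.tensor (.refl _) (.comp (.refl _) (.comp (geqs_midSwap 𝕜) (.refl _)))) (.refl _)
    _ ≋ (Term.id 2 ⊠ ((copy ⊠ copy :) ;; midSwap) :) ;;
          ((wire ⊠ ((wire ⊠ lowerBound :) ;; antiCap)) ⊠ Term.id 2 :) ;;
            ((wire ⊠ lowerBound :) ;; antiCap) := .of_normalize (by cbv)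
    _ ≋ (Term.id 2 ⊠ ((copy ⊠ copy :) ;; midSwap) :) ;;
          ((wire ⊠ MatrixCircuit.addBoth.geqZero) ⊠ Term.id 2 :) ;;
            MatrixCircuit.addBoth.geqZero :=
        .comp (.refl _) (.comp (.tensor (.tensor (.refl _) (lowerBound_antiCap 𝕜)) (.refl _))
          (lowerBound_antiCap 𝕜))
    _ ≋ (Term.id 2 ⊠ ((copy ⊠ copy :) ;; midSwap) :) ;; (Term.sym 1 3 ⊠ Term.id 2 :) ;;
          (MatrixCircuit.addBoth.geqZero ⊠ MatrixCircuit.addBoth.geqZero :) :=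
        .comp (.refl _) (slide (a := 1) (b := 2) _ _)
    _ ≋ MatrixCircuit.pairwiseSums.geqZero := .of_normalize (by cbv)

theorem lowerBound_eq : lowerBound ≋ ((Term.id 2 ⊠ coDelete :) ;; (Term.id 2 ⊠ copy :) ;;
    ((MatrixCircuit.subBoth (𝕜 := 𝕜)).geqZero ⊠ wire :) : OrdCircuit 𝕜 2 1) :=
  calc lowerBound
      ≋ ((Term.id 2 ⊠ cup :) ;; (((lowerBound ⊠ wire :) ;; cap) ⊠ wire :) : OrdCircuit 𝕜 2 1) :=
        eq_cup_cap _
    _ ≋ (Term.id 2 ⊠ cup :) ;; ((MatrixCircuit.subBoth (𝕜 := 𝕜)).geqZero ⊠ wire :) :=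
        .comp (.refl _) (.tensor (lowerBound_cap 𝕜) (.refl _))
    _ ≋ (Term.id 2 ⊠ coDelete :) ;; (Term.id 2 ⊠ copy :) ;;
          ((MatrixCircuit.subBoth (𝕜 := 𝕜)).geqZero ⊠ wire :) := .of_normalize (by cbv)

/-- This is the existential side of the spider: the wire in its centre is the number between the
bounds, exposed by `lowerBound_eq` as a `coDelete` on the last coordinate. -/
theorem bounds_geqZero : (Term.id 2 ⊠ ((geq ⊠ geq :) ;; coCopy ;; copy ;; (geq ⊠ geq :)) :) ;;
      bend ≋ ((Term.id 4 ⊠ coDelete :) ;; (MatrixCircuit.bounds (𝕜 := 𝕜)).geqZero : OrdCircuit 𝕜 4 0) :=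
  calc ((Term.id 2 ⊠ ((geq ⊠ geq :) ;; coCopy ;; copy ;; (geq ⊠ geq :)) :) ;;
          bend : OrdCircuit 𝕜 4 0)
      ≋ (Term.id 2 ⊠ lowerBound :) ;; (Term.id 2 ⊠ copy :) ;;
          (((Term.id 2 ⊠ geq) ⊠ geq :) ;; bend) := .of_normalize (by cbv)
    _ ≋ (Term.id 2 ⊠ ((Term.id 2 ⊠ coDelete :) ;; (Term.id 2 ⊠ copy :) ;;
          ((MatrixCircuit.subBoth (𝕜 := 𝕜)).geqZero ⊠ wire :)) :) ;; (Term.id 2 ⊠ copy :) ;;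
            MatrixCircuit.crossAdd.geqZero :=
        .comp (.tensor (.refl _) (lowerBound_eq 𝕜)) (.comp (.refl _) (geq_bend 𝕜))
    _ ≋ (Term.id 4 ⊠ coDelete :) ;; (Term.id 4 ⊠ copy :) ;;
          (((Term.id 2 ⊠ (MatrixCircuit.subBoth (𝕜 := 𝕜)).geqZero) ⊠ Term.id 1 :) ;;
            ((Term.id 2 ⊠ copy :) ;; MatrixCircuit.crossAdd.geqZero)) := .of_normalize (by cbv)
    _ ≋ (Term.id 4 ⊠ coDelete :) ;; (Term.id 4 ⊠ copy :) ;; ((Term.sym 2 3 ⊠ Term.id 1 :) ;;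
          ((MatrixCircuit.subBoth (𝕜 := 𝕜)).geqZero ⊠
            ((Term.id 2 ⊠ copy :) ;; MatrixCircuit.crossAdd.geqZero) :)) :=
        .comp (.refl _) (.comp (.refl _) (slide (a := 2) (b := 1) _ _))
    _ ≋ _ := .of_normalize (by cbv)

theorem pairwiseSums_le_bounds : ((MatrixCircuit.pairwiseSums (𝕜 := 𝕜)).geqZero : OrdCircuit 𝕜 4 0) ≼
    ((Term.id 4 ⊠ coDelete :) ;; (MatrixCircuit.bounds (𝕜 := 𝕜)).geqZero : OrdCircuit 𝕜 4 0) :=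
  -- Only the existence half of the spider axiom is used here.
  (pairwiseSums_geqZero 𝕜).2.trans ((Le.comp (.tensor (.refl _) (spider 𝕜).2) (.refl _)).trans
    (bounds_geqZero 𝕜).1)

end Spider

section Direction

variable (𝕜) [IsStrictOrderedRing 𝕜]

theorem leq_eq : leq ≋ ((wire ⊠ coDelete :) ;; (wire ⊠ copy :) ;;
    ((Term.sym 1 1 ;; (wire ⊠ neg 𝕜 :) ;; add ;; pos) ⊠ wire :) : OrdCircuit 𝕜 1 1) :=
  have h : (leq ⊠ wire :) ;; cap ≋
      (Term.sym 1 1 ;; (wire ⊠ neg 𝕜 :) ;; add ;; pos : OrdCircuit 𝕜 2 0) :=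
    calc ((leq ⊠ wire :) ;; cap : OrdCircuit 𝕜 2 0)
        ≋ (leq ⊠ wire :) ;; (Term.sym 1 1 ;; cap) := .comp (.refl _) (sym_cap 𝕜).symm
      _ ≋ ((leq ⊠ wire :) ;; Term.sym 1 1) ;; cap := (comp_assoc _ _ _).symm
      _ ≋ (Term.sym 1 1 ;; (wire ⊠ leq :)) ;; cap := .comp (sym_natural _ _) (.refl _)
      _ ≋ Term.sym 1 1 ;; ((wire ⊠ leq :) ;; cap) := comp_assoc _ _ _
      _ ≋ Term.sym 1 1 ;; (wire ⊠ neg 𝕜 :) ;; add ;; pos :=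
          .comp (.refl _) ((leq_cap 𝕜).trans (geq_cap 𝕜))
  calc leq ≋ ((wire ⊠ cup :) ;; (((leq ⊠ wire :) ;; cap) ⊠ wire :) : OrdCircuit 𝕜 1 1) :=
        eq_cup_cap _
    _ ≋ (wire ⊠ cup :) ;; ((Term.sym 1 1 ;; (wire ⊠ neg 𝕜 :) ;; add ;; pos) ⊠ wire :) :=
        .comp (.refl _) (.tensor h (.refl _))
    _ ≋ (wire ⊠ coDelete :) ;; (wire ⊠ copy :) ;;
          ((Term.sym 1 1 ;; (wire ⊠ neg 𝕜 :) ;; add ;; pos) ⊠ wire :) := .of_normalize (by cbv)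

/-- The axiom `direction` says that `u ≤ x ≥ y` is solvable in `x` for all `u` and `y`. Bending `y`
into `-a` makes this a projected cone that imposes no condition. -/
theorem lowerBounds_geqZero : ((Term.id 2 ⊠ coDelete :) ;;
      (MatrixCircuit.lowerBounds (𝕜 := 𝕜)).geqZero : OrdCircuit 𝕜 2 0) ≋
    (delete ⊠ delete : OrdCircuit 𝕜 2 0) :=
  .symm <|
  calc (delete ⊠ delete : OrdCircuit 𝕜 2 0)
      ≋ ((wire ⊠ coDelete :) ;; antiCap) ⊠ delete :=
        .tensor (coDelete_antiCap 𝕜).symm (.refl _)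
    _ ≋ (wire ⊠ (delete ;; coDelete) :) ;; antiCap := .of_normalize (by cbv)
    _ ≋ (wire ⊠ (leq ;; geq) :) ;; antiCap :=
        .comp (.tensor (.refl _) (ord_eq .direction).symm) (.refl _)
    _ ≋ (wire ⊠ leq :) ;; ((wire ⊠ geq :) ;; antiCap) := .of_normalize (by cbv)
    _ ≋ (wire ⊠ ((wire ⊠ coDelete :) ;; (wire ⊠ copy :) ;;
          ((Term.sym 1 1 ;; (wire ⊠ neg 𝕜 :) ;; add ;; pos) ⊠ wire :)) :) ;; (add ;; pos) :=
        .comp (.tensor (.refl _) (leq_eq 𝕜)) (add_pos_eq_right 𝕜).symm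
    _ ≋ (Term.id 2 ⊠ coDelete :) ;; (Term.id 2 ⊠ copy :) ;;
          (((Term.id 1 ⊠ (Term.sym 1 1 ;; (wire ⊠ neg 𝕜 :) ;; add ;; pos)) ⊠ Term.id 1 :) ;;
            (add ;; pos)) := .of_normalize (by cbv)
    _ ≋ (Term.id 2 ⊠ coDelete :) ;; (Term.id 2 ⊠ copy :) ;; ((Term.sym 1 2 ⊠ Term.id 1 :) ;;
          ((Term.sym 1 1 ;; (wire ⊠ neg 𝕜 :) ;; add ;; pos) ⊠ (add ;; pos) :)) :=
        .comp (.refl _) (.comp (.refl _) (slide (a := 1) (b := 1) _ _))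
    _ ≋ (Term.id 2 ⊠ coDelete :) ;; (MatrixCircuit.lowerBounds (𝕜 := 𝕜)).geqZero :=
        .of_normalize (by cbv)

end Direction

section Elimination

open MatrixCircuit (ofForms pull_ofForms_cons pull_tensor_castSucc pull_tensor_last)

variable [IsStrictOrderedRing 𝕜] {n : ℕ}

theorem geqZero_eq_cone {m : ℕ} (A : MatrixCircuit 𝕜 n m) :
    A.geqZero ≋ cone (List.ofFn fun i => pull A (Pi.single i 1)) := by
  constructor
  · refine (isCone_geqZero A).le_cone fun v hv => ?_
    obtain ⟨i, rfl⟩ := (List.mem_ofFn' _ _).1 hv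
    exact geqZero_entails A (single_nonneg i)
  · exact (isCone_cone _).le_geqZero fun i =>
      entails_of_mem ((List.mem_ofFn' _ _).2 ⟨i, rfl⟩)

omit [LinearOrder 𝕜] [IsStrictOrderedRing 𝕜] in
theorem pull_tensor_wire {m : ℕ} (A : MatrixCircuit 𝕜 n m) (w : Fin (m + 1) → 𝕜) :
    pull (A ⊠ MatrixCircuit.wire) w =
      (Fin.snoc (pull A fun i => w i.castSucc) (w (Fin.last m)) : Fin (n + 1) → 𝕜) := by
  funext i
  refine Fin.lastCases ?_ (fun i => ?_) i
  · rw [pull_tensor_last, Fin.snoc_last]; rfl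
  · rw [pull_tensor_castSucc, Fin.snoc_castSucc]; rfl

/-- The projection of a cone that is given by a matrix circuit, after a change of variables. -/
theorem comp_proj_geqZero_le {m k : ℕ} (F : MatrixCircuit 𝕜 n m) (A : MatrixCircuit 𝕜 (m + 1) k)
    {N : List (Fin (n + 1) → 𝕜)} (h : ∀ v ∈ N, ∃ i : Fin k,
      (Fin.snoc (pull F fun j => pull A (Pi.single i 1) j.castSucc)
        (pull A (Pi.single i 1) (Fin.last m)) : Fin (n + 1) → 𝕜) = v) :
    F.toOrd ;; (Term.id m ⊠ coDelete) ;; A.geqZero ≼ projCone N := by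
  refine (Le.comp (.refl _) (.comp (.refl _) (geqZero_eq_cone A).1)).trans
    ((comp_projCone F _).1.trans (projCone_mono fun v hv => entails_of_mem ?_))
  obtain ⟨i, rfl⟩ := h v hv
  rw [← pull_tensor_wire]
  exact List.mem_map_of_mem ((List.mem_ofFn' _ _).2 ⟨i, rfl⟩)

/-- Two lower bounds that are below two upper bounds can be separated from them. -/
theorem cone_le_projCone_bounds {L : List (Fin n → 𝕜)} {a₁ a₂ b₁ b₂ : Fin n → 𝕜}
    (h₁₁ : Entails (cone L) (a₁ + b₁)) (h₁₂ : Entails (cone L) (a₁ + b₂))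
    (h₂₁ : Entails (cone L) (a₂ + b₁)) (h₂₂ : Entails (cone L) (a₂ + b₂)) :
    cone L ≼ projCone [(Fin.snoc a₁ 1 : Fin (n + 1) → 𝕜), Fin.snoc a₂ 1, Fin.snoc b₁ (-1),
      Fin.snoc b₂ (-1)] := by
  -- The head of a list goes to the last wire, so the four wires carry `a₂, a₁, b₁, b₂` in this
  -- order.
  let F : MatrixCircuit 𝕜 n 4 := ofForms [b₂, b₁, a₁, a₂]
  have hF (w : Fin 4 → 𝕜) :
      pull F w = w 0 • a₂ + w 1 • a₁ + w 2 • b₁ + w 3 • b₂ := by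
    change pull (ofForms [b₂, b₁, a₁, a₂]) w = _
    rw [pull_ofForms_cons, pull_ofForms_cons, pull_ofForms_cons, pull_ofForms_cons,
      show pull (ofForms ([] : List (Fin n → 𝕜))) _ = 0 from MatrixCircuit.pull_deleteN _ _,
      zero_add]
    rfl
  have h : cone L ≼ MatrixCircuit.geqZero (F ;; MatrixCircuit.pairwiseSums) := by
    refine IsCone.le_geqZero (isCone_cone L) fun i => ?_
    change Entails _ (pull F (pull MatrixCircuit.pairwiseSums (Pi.single i 1)))
    rw [MatrixCircuit.pull_pairwiseSums, hF]
    fin_cases i <;> simpa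
  refine h.trans ((comp_geqZero F _).2.trans ((Le.comp (.refl _)
    (pairwiseSums_le_bounds 𝕜)).trans (comp_proj_geqZero_le F _ fun v hv => ?_)))
  simp only [MatrixCircuit.pull_bounds, hF]
  simp only [List.mem_cons, List.not_mem_nil, or_false] at hv
  rcases hv with rfl | rfl | rfl | rfl
  -- The witnesses are the outputs of `bounds`, which run through `b₂ - x`, `b₁ - x`, `a₁ + x`, `a₂
  -- + x`.
  · exact ⟨2, by congr 1 <;> simp⟩
  · exact ⟨3, by congr 1 <;> simp⟩
  · exact ⟨1, by congr 1 <;> simp⟩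
  · exact ⟨0, by congr 1 <;> simp⟩

/-- There is a number above two given ones. -/
theorem deleteN_le_projCone_bounds (a₁ a₂ : Fin n → 𝕜) :
    (deleteN n : OrdCircuit 𝕜 n 0) ≼
      projCone [(Fin.snoc a₁ 1 : Fin (n + 1) → 𝕜), Fin.snoc a₂ 1] := by
  -- The sign comes from `lowerBounds`, whose first output is `x - u`: with `u = -a₂` it becomes `a₂
  -- + x`.
  let F : MatrixCircuit 𝕜 n 2 := ofForms [-a₂, a₁]
  have hF (w : Fin 2 → 𝕜) : pull F w = w 0 • a₁ + w 1 • -a₂ := by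
    change pull (ofForms [-a₂, a₁]) w = _
    rw [pull_ofForms_cons, pull_ofForms_cons,
      show pull (ofForms ([] : List (Fin n → 𝕜))) _ = 0 from MatrixCircuit.pull_deleteN _ _,
      zero_add]
    rfl
  refine (deleteN_natural F).2.trans ((Le.comp (.refl _) ((deleteN_two 𝕜).1.trans
    (lowerBounds_geqZero 𝕜).2)).trans (comp_proj_geqZero_le F _ fun v hv => ?_))
  simp only [MatrixCircuit.pull_lowerBounds, hF]
  simp only [List.mem_cons, List.not_mem_nil, or_false] at hv
  rcases hv with rfl | rfl
  · exact ⟨1, by congr 1 <;> simp⟩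
  · exact ⟨0, by congr 1 <;> simp⟩

end Elimination

end PolyCone

/-! ### Fourier–Motzkin elimination for finite systems. -/

namespace PolyCone

open OrdCircuit
open MatrixCircuit (pull)

variable {𝕜 : Type*} [Field 𝕜] [LinearOrder 𝕜] [IsStrictOrderedRing 𝕜] {n : ℕ}

section Bounds

/-- The inequalities `a + x ≥ 0` for `a` in `As` and `b - x ≥ 0` for `b` in `Bs`. -/
def boundForms (As Bs : List (Fin n → 𝕜)) : List (Fin (n + 1) → 𝕜) :=
  As.map (fun a => Fin.snoc a 1) ++ Bs.map (fun b => Fin.snoc b (-1))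

omit [LinearOrder 𝕜] [IsStrictOrderedRing 𝕜] in
theorem mem_boundForms {As Bs : List (Fin n → 𝕜)} {v : Fin (n + 1) → 𝕜} :
    v ∈ boundForms As Bs ↔ (∃ a ∈ As, Fin.snoc a 1 = v) ∨ ∃ b ∈ Bs, Fin.snoc b (-1) = v := by
  simp only [boundForms, List.mem_append, List.mem_map]

omit [LinearOrder 𝕜] [IsStrictOrderedRing 𝕜] in
theorem snoc_add_snoc (v w : Fin n → 𝕜) (r s : 𝕜) :
    (Fin.snoc v r + Fin.snoc w s : Fin (n + 1) → 𝕜) = Fin.snoc (v + w) (r + s) := by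
  funext i
  refine Fin.lastCases ?_ (fun i => ?_) i <;> simp

omit [LinearOrder 𝕜] [IsStrictOrderedRing 𝕜] in
theorem smul_snoc (v : Fin n → 𝕜) (r s : 𝕜) :
    (s • Fin.snoc v r : Fin (n + 1) → 𝕜) = Fin.snoc (s • v) (s * r) := by
  funext i
  refine Fin.lastCases ?_ (fun i => ?_) i <;> simp

omit [LinearOrder 𝕜] [IsStrictOrderedRing 𝕜] in
theorem weakenMiddle_snoc (v : Fin n → 𝕜) (r : 𝕜) :
    weakenMiddle (Fin.snoc v r : Fin (n + 1) → 𝕜) = Fin.snoc (weaken v) r := by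
  simp [weakenMiddle]

theorem Entails.weaken {L : List (Fin n → 𝕜)} {v : Fin n → 𝕜} (h : Entails (cone L) v) :
    Entails (cone (L.map weaken)) (weaken v) := by
  have := h.comp (Term.id n ⊠ MatrixCircuit.delete)
  rw [MatrixCircuit.pull_id_tensor_delete] at this
  exact this.mono (cone_weaken L).2

theorem Entails.append_right {L : List (Fin n → 𝕜)} {v : Fin n → 𝕜} (h : Entails (cone L) v)
    (M : List (Fin n → 𝕜)) : Entails (cone (L ++ M)) v :=
  h.mono (cone_le fun _ hw => entails_of_mem (List.mem_append_left M hw))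

omit [IsStrictOrderedRing 𝕜] in
theorem entails_add {L : List (Fin n → 𝕜)} {v w : Fin n → 𝕜} (hv : Entails (cone L) v)
    (hw : Entails (cone L) w) : Entails (cone L) (v + w) := (isCone_cone L).entails_add hv hw

theorem projCone_boundForms_comm (As Bs : List (Fin n → 𝕜)) :
    projCone (boundForms As Bs) ≼ projCone (boundForms Bs As) := by
  refine (projCone_neg _).2.trans (projCone_mono fun v hv => entails_of_mem ?_)
  rw [List.mem_map]
  rcases mem_boundForms.1 hv with ⟨b, hb, rfl⟩ | ⟨a, ha, rfl⟩
  · exact ⟨Fin.snoc b (-1), mem_boundForms.2 (.inr ⟨b, hb, rfl⟩), by simp⟩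
  · exact ⟨Fin.snoc a 1, mem_boundForms.2 (.inl ⟨a, ha, rfl⟩), by simp⟩

/-- To add a lower bound, replace a solution by a larger one. -/
theorem cone_le_projCone_cons {L : List (Fin n → 𝕜)} {a : Fin n → 𝕜} {As Bs : List (Fin n → 𝕜)}
    (h : cone L ≼ projCone (boundForms As Bs))
    (h' : cone (L.map weaken ++ boundForms As Bs) ≼
      projCone (boundForms [Fin.snoc 0 (-1), weaken a] (Bs.map weaken))) :
    cone L ≼ projCone (boundForms (a :: As) Bs) := by
  -- Here `y` is the old solution, in the last but one coordinate, and `z` the new one, in the last.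
  -- Appending keeps the inequalities satisfied by `y` available.
  refine cone_le_projCone_trans h ((cone_le_projCone_append h').trans (projCone_mono fun w hw => ?_))
  obtain ⟨v, hv, rfl⟩ := List.mem_map.1 hw
  rcases mem_boundForms.1 hv with ⟨a', ha, rfl⟩ | ⟨b, hb, rfl⟩
  · rw [weakenMiddle_snoc]
    rcases List.mem_cons.1 ha with rfl | ha
    · exact entails_of_mem (List.mem_append_right _ (mem_boundForms.2
        (.inl ⟨_, List.mem_cons_of_mem _ (List.mem_singleton_self _), rfl⟩)))
    -- An old lower bound survives because `a' + z = (a' + y) + (z - y)`.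
    · have : (Fin.snoc (weaken a') 1 : Fin (n + 1 + 1) → 𝕜) =
          weaken (Fin.snoc a' 1) + Fin.snoc (Fin.snoc 0 (-1)) 1 := by
        rw [weaken, weaken, snoc_add_snoc, snoc_add_snoc]
        simp
      rw [this]
      exact entails_add
        (entails_of_mem (List.mem_append_left _ (List.mem_map_of_mem (List.mem_append_right _
          (mem_boundForms.2 (.inl ⟨_, ha, rfl⟩))))))
        (entails_of_mem (List.mem_append_right _ (mem_boundForms.2
          (.inl ⟨_, List.mem_cons_self, rfl⟩))))
  · rw [weakenMiddle_snoc]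
    exact entails_of_mem (List.mem_append_right _ (mem_boundForms.2
      (.inr ⟨_, List.mem_map_of_mem hb, rfl⟩)))

theorem cone_le_projCone_lower (L As : List (Fin n → 𝕜)) :
    cone L ≼ projCone (boundForms As []) := by
  induction As with
  | nil =>
    have h : cone L ≼ cone [] := cone_le fun v hv => absurd hv List.not_mem_nil
    exact h.trans (projCone_weaken []).2
  | cons a As ih =>
    exact cone_le_projCone_cons ih ((isCone_cone _).1.trans (deleteN_le_projCone_bounds _ _))

/-- Given a solution `y` for the earlier lower bounds, the next one asks for `z` above `y` and `-a`
and below both upper bounds. That is the two-by-two case: `y` lies below both because it is a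
solution, and `-a` by hypothesis. -/
theorem cone_le_projCone_two {L : List (Fin n → 𝕜)} {As : List (Fin n → 𝕜)} {b₁ b₂ : Fin n → 𝕜}
    (h₁ : ∀ a ∈ As, Entails (cone L) (a + b₁)) (h₂ : ∀ a ∈ As, Entails (cone L) (a + b₂)) :
    cone L ≼ projCone (boundForms As [b₁, b₂]) := by
  induction As with
  | nil => exact (cone_le_projCone_lower L [b₁, b₂]).trans (projCone_boundForms_comm _ _)
  | cons a As ih =>
    have ih := ih (fun a ha => h₁ a (List.mem_cons_of_mem _ ha))
      fun a ha => h₂ a (List.mem_cons_of_mem _ ha)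
    have hy {b : Fin n → 𝕜} (hb : b ∈ [b₁, b₂]) :
        Entails (cone (L.map weaken ++ boundForms As [b₁, b₂])) (Fin.snoc 0 (-1) + weaken b) := by
      rw [weaken, snoc_add_snoc, zero_add, add_zero]
      exact entails_of_mem (List.mem_append_right _ (mem_boundForms.2 (.inr ⟨b, hb, rfl⟩)))
    have ha {b : Fin n → 𝕜} (hb : Entails (cone L) (a + b)) :
        Entails (cone (L.map weaken ++ boundForms As [b₁, b₂])) (weaken a + weaken b) := by
      have := hb.weaken.append_right (boundForms As [b₁, b₂])
      -- The last coefficient `0` is split as `0 + 0` so that the weakened sum becomes a sum of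
      -- weakened forms.
      rwa [weaken, ← add_zero (0 : 𝕜), ← snoc_add_snoc] at this
    exact cone_le_projCone_cons ih (cone_le_projCone_bounds (hy (by simp)) (hy (by simp))
      (ha (h₁ a List.mem_cons_self)) (ha (h₂ a List.mem_cons_self)))

theorem cone_le_projCone_boundForms {L As Bs : List (Fin n → 𝕜)}
    (h : ∀ a ∈ As, ∀ b ∈ Bs, Entails (cone L) (a + b)) :
    cone L ≼ projCone (boundForms As Bs) := by
  induction Bs with
  | nil => exact cone_le_projCone_lower L As
  | cons b Bs ih =>
    have ih := ih fun a ha b hb => h a ha b (List.mem_cons_of_mem _ hb)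
    -- After reflection the new upper bound `b` is added as a lower bound. In the original
    -- orientation this asks for `z` below both `y` and `b` and above every `-a`, which is
    -- `cone_le_projCone_two`.
    refine (cone_le_projCone_cons (ih.trans (projCone_boundForms_comm _ _)) ?_).trans
      (projCone_boundForms_comm _ _)
    refine (cone_le_projCone_two (fun a ha => ?_) fun a ha => ?_).trans
      (projCone_boundForms_comm _ _)
    · obtain ⟨a, ha', rfl⟩ := List.mem_map.1 ha
      rw [weaken, snoc_add_snoc, add_zero, zero_add]
      exact entails_of_mem (List.mem_append_right _ (mem_boundForms.2 (.inr ⟨a, ha', rfl⟩)))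
    · obtain ⟨a, ha', rfl⟩ := List.mem_map.1 ha
      have := (h a ha' b List.mem_cons_self).weaken.append_right (boundForms Bs As)
      rwa [weaken, ← add_zero (0 : 𝕜), ← snoc_add_snoc] at this

end Bounds

section Elimination

/-- The linear form in the first `n` variables, normalised by the last coefficient. -/
def eliminated (v : Fin (n + 1) → 𝕜) : Fin n → 𝕜 :=
  |v (Fin.last n)|⁻¹ • fun i => v i.castSucc

/-- Fourier–Motzkin elimination of the last variable. -/
def eliminate (M : List (Fin (n + 1) → 𝕜)) : List (Fin n → 𝕜) :=
  (M.filter (· (Fin.last n) = 0)).map (fun v i => v i.castSucc) ++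
    ((M.filter (0 < · (Fin.last n))).map eliminated ×ˢ
      (M.filter (· (Fin.last n) < 0)).map eliminated).map fun p => p.1 + p.2

theorem smul_eliminated_of_pos {v : Fin (n + 1) → 𝕜} (hv : 0 < v (Fin.last n)) :
    v (Fin.last n) • (Fin.snoc (eliminated v) 1 : Fin (n + 1) → 𝕜) = v := by
  rw [smul_snoc, eliminated, abs_of_pos hv, smul_inv_smul₀ hv.ne', mul_one]
  exact Fin.snoc_init_self v

theorem smul_eliminated_of_neg {v : Fin (n + 1) → 𝕜} (hv : v (Fin.last n) < 0) :
    (-v (Fin.last n)) • (Fin.snoc (eliminated v) (-1) : Fin (n + 1) → 𝕜) = v := by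
  rw [smul_snoc, eliminated, abs_of_neg hv, smul_inv_smul₀ (neg_pos.2 hv).ne', neg_mul_neg, mul_one]
  exact Fin.snoc_init_self v

theorem entails_of_smul_mem {L : List (Fin n → 𝕜)} {v w : Fin n → 𝕜} {r : 𝕜} (hr : 0 < r)
    (h : r • v = w) (hw : w ∈ L) : Entails (cone L) v := by
  have := (entails_of_mem hw).smul (inv_pos.2 hr).le
  rwa [← h, inv_smul_smul₀ hr.ne'] at this

theorem projCone_eliminate (M : List (Fin (n + 1) → 𝕜)) :
    projCone M ≋ cone (eliminate M) := by
  constructor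
  -- Soundness: each eliminated form is either a member of `M` free of the variable or a sum of two
  -- normalised members, with coefficients `1` and `-1` that cancel.
  · refine (projCone_mono fun u hu => ?_).trans (projCone_weaken (eliminate M)).1
    obtain ⟨u, hu', rfl⟩ := List.mem_map.1 hu
    rcases List.mem_append.1 hu' with hu' | hu'
    · obtain ⟨v, hv, rfl⟩ := List.mem_map.1 hu'
      obtain ⟨hv, h₀⟩ := List.mem_filter.1 hv
      have : weaken (fun i => v i.castSucc) = v := by
        rw [weaken, ← of_decide_eq_true h₀]
        exact Fin.snoc_init_self v
      rw [this]
      exact entails_of_mem hv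
    · obtain ⟨⟨a, b⟩, hab, rfl⟩ := List.mem_map.1 hu'
      obtain ⟨ha, hb⟩ := List.mem_product.1 hab
      obtain ⟨v, hv, rfl⟩ := List.mem_map.1 ha
      obtain ⟨w, hw, rfl⟩ := List.mem_map.1 hb
      obtain ⟨hv, hv₀⟩ := List.mem_filter.1 hv
      obtain ⟨hw, hw₀⟩ := List.mem_filter.1 hw
      have hv₀ := of_decide_eq_true hv₀
      have hw₀ := of_decide_eq_true hw₀
      have h := entails_add (entails_of_smul_mem hv₀ (smul_eliminated_of_pos hv₀) hv)
        (entails_of_smul_mem (neg_pos.2 hw₀) (smul_eliminated_of_neg hw₀) hw)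
      rwa [snoc_add_snoc, add_neg_cancel] at h
  -- Existence: the pairwise sums in `eliminate M` are exactly the hypotheses that make the
  -- normalised bounds solvable. The forms free of the variable are kept by
  -- `cone_le_projCone_append`, and rescaling recovers the original forms.
  · have h := cone_le_projCone_boundForms (L := eliminate M)
      (As := (M.filter (0 < · (Fin.last n))).map eliminated)
      (Bs := (M.filter (· (Fin.last n) < 0)).map eliminated) fun a ha b hb =>
        entails_of_mem (List.mem_append_right _ (List.mem_map.2
          ⟨(a, b), List.mem_product.2 ⟨ha, hb⟩, rfl⟩))
    refine (cone_le_projCone_append h).trans (projCone_mono fun v hv => ?_)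
    rcases lt_trichotomy (v (Fin.last n)) 0 with h₀ | h₀ | h₀
    · rw [← smul_eliminated_of_neg h₀]
      refine Entails.smul (entails_of_mem (List.mem_append_right _ (mem_boundForms.2 (.inr
        ⟨_, List.mem_map_of_mem (List.mem_filter.2 ⟨hv, decide_eq_true h₀⟩), rfl⟩))))
        (neg_pos.2 h₀).le
    · have : weaken (fun i => v i.castSucc) = v := by
        rw [weaken, ← h₀]
        exact Fin.snoc_init_self v
      rw [← this]
      exact entails_of_mem (List.mem_append_left _ (List.mem_map_of_mem (List.mem_append_left _
        (List.mem_map.2 ⟨v, List.mem_filter.2 ⟨hv, decide_eq_true h₀⟩, rfl⟩))))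
    · rw [← smul_eliminated_of_pos h₀]
      refine Entails.smul (entails_of_mem (List.mem_append_right _ (mem_boundForms.2 (.inl
        ⟨_, List.mem_map_of_mem (List.mem_filter.2 ⟨hv, decide_eq_true h₀⟩), rfl⟩))))
        h₀.le

-- The theorem eliminates the first variable while the development quantifies over the last; a
-- symmetry, itself a matrix circuit, absorbs the difference.
omit [IsStrictOrderedRing 𝕜] in
theorem coDelete_tensor_comp_geqZero {m : ℕ} (A : MatrixCircuit 𝕜 (1 + n) m) :
    (coDelete ⊠ Term.id n) ;; A.geqZero ≋
      (Term.id n ⊠ coDelete) ;; MatrixCircuit.geqZero (Term.sym n 1 ;; A) := by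
  have h : (coDelete ⊠ Term.id n : OrdCircuit 𝕜 (0 + n) (1 + n)) ≋
      ((Term.id n ⊠ coDelete) ;; Term.sym n 1 : OrdCircuit 𝕜 (n + 0) (1 + n)) :=
    calc (coDelete ⊠ Term.id n : OrdCircuit 𝕜 (0 + n) (1 + n))
        ≋ Term.id (0 + n) ;; (coDelete ⊠ Term.id n) := (id_comp _).symm
      _ ≋ Term.sym n 0 ;; (coDelete ⊠ Term.id n) :=
          .comp ((IHPEq.id_of_eq (Nat.zero_add n)).trans (sym_zero_right 𝕜 n).symm) (.refl _)
      _ ≋ (Term.id n ⊠ coDelete) ;; Term.sym n 1 := (sym_natural _ _).symm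
  exact (IHPEq.comp h (.refl _)).trans ((comp_assoc _ _ _).trans
    (.comp (.refl _) (comp_geqZero (Term.sym n 1) A)))

end Elimination
end PolyCone

theorem mainTheorem8 {𝕜 : Type*} [Field 𝕜] [LinearOrder 𝕜] [IsStrictOrderedRing 𝕜]
    (n m : ℕ) (A : PolyCone.MatrixCircuit 𝕜 (1 + n) m) :
    ∃ (l : ℕ) (B : PolyCone.MatrixCircuit 𝕜 n l),
      PolyCone.IHPEq
        (PolyCone.Term.comp
          (PolyCone.Term.tensor PolyCone.OrdCircuit.coDelete (PolyCone.Term.id n))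
          A.geqZero)
        B.geqZero :=
  ⟨_, _, (PolyCone.coDelete_tensor_comp_geqZero A).trans
    ((PolyCone.IHPEq.comp (.refl _) (PolyCone.geqZero_eq_cone _)).trans
      (PolyCone.projCone_eliminate _))⟩
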